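/- \textbf{Setting.} Let $0<q<1$, let $M$ be the field of meromorphic functions on $\mathbb C$ and let $(T_sf)(\lambda)=f(\lambda+s)$. Put $$F(\lambda)=\frac{q^{2(\lambda+1)}-q^{-2}}{q^{2(\lambda+1)}-1},\qquad G(\lambda)=\frac{(q^{2(\lambda+1)}-q^2)(q^{2(\lambda+1)}-q^{-2})}{(q^{2(\lambda+1)}-1)^2},$$ $$H(\lambda,\mu)=\frac{(q-q^{-1})(q^{2(\lambda+\mu+2)}-1)}{(q^{2(\lambda+1)}-1)(q^{2(\mu+1)}-1)},\qquad I(\lambda,\mu)=\frac{(q-q^{-1})(q^{2(\mu+1)}-q^{2(\lambda+1)})}{(q^{2(\lambda+1)}-1)(q^{2(\mu+1)}-1)}.$$ The algebra $\mathcal F_R(\mathrm{SL}(2))$ is the complex algebra generated by $\alpha,\beta,\gamma,\delta$ and two commuting copies $f(\lambda)$, $f(\mu)$ of $M$ (the images of the left and right moment maps $\mu_l,\mu_r$), subject to $f(\lambda)x=x\,(T_{a}f)(\lambda)$, $f(\mu)x=x\,(T_{b}f)(\mu)$ with $(a,b)=(1,1),(1,-1),(-1,1),(-1,-1)$ for $x=\alpha,\beta,\gamma,\delta$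 respectively, to $$\alpha\beta=qF(\mu-1)\beta\alpha,\quad \alpha\gamma=qF(\lambda)\gamma\alpha,\quad \beta\delta=qF(\lambda)\delta\beta,\quad \gamma\delta=qF(\mu-1)\delta\gamma,$$ $$\alpha\delta-\delta\alpha=H(\lambda,\mu)\gamma\beta,\quad G(\mu)\alpha\delta-G(\lambda)\delta\alpha=H(\lambda,\mu)\beta\gamma,$$ $$\beta\gamma-G(\mu)\gamma\beta=I(\lambda,\mu)\delta\alpha,\quad \beta\gamma-G(\lambda)\gamma\beta=I(\lambda,\mu)\alpha\delta,$$ and to the determinant relation $\alpha\delta-qF(\lambda)\gamma\beta=1$. It is bigraded by the degrees $(a,b)$ above, functions having degree $(0,0)$. Its Casimir element is $$\Xi=q^{\lambda-\mu+1}+q^{\mu-\lambda-1}-q^{-(\lambda+\mu+2)}(1-q^{2(\lambda+2)})(1-q^{2\mu})\gamma\beta .$$ An $\mathfrak h$-space is an $M$-vector space $V=\bigoplus_{c\in\mathbb C}V_c$. A dynamical representation of $\mathcal F_R(\mathrm{SL}(2))$ on $V$ is an algebra homomorphism $\pi$ into the $\mathbb C$-linear operators on $V$ such that $\pi(f(\mu))v=fv$,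 $\pi(f(\lambda))v=(T_{-c}f)v$ for $v\in V_c$, and an element $x$ of degree $(a,b)$ acts with $\pi(x)(gv)=(T_{-b}g)\,\pi(x)v$ and $\pi(x)V_c\subseteq V_{c+b-a}$. An intertwiner is a weight-preserving $M$-linear map that commutes with the action. For $\mathfrak h$-spaces $V,W$, the space $V\bar\otimes W$ is the quotient of $V\otimes_{\mathbb C}W$ by $fv\otimes w=v\otimes(T_{-b}f)w$ for $w\in W_b$, with scalars $f(v\otimes w)=v\otimes fw$ and $V_a\bar\otimes W_b$ in weight $a+b$; the tensor product of two dynamical representations is given by $\Delta(\alpha)=\alpha\otimes\alpha+\beta\otimes\gamma$, $\Delta(\beta)=\alpha\otimes\beta+\beta\otimes\delta$, $\Delta(\gamma)=\gamma\otimes\alpha+\delta\otimes\gamma$, $\Delta(\delta)=\gamma\otimes\beta+\delta\otimes\delta$, $f(\lambda)\mapsto f(\lambda)\otimes1$, $f(\mu)\mapsto1\otimes f(\mu)$. For $\omega\in\mathbb C$, $\mathcal H^\omega$ is the dynamical representation with $M$-basis $e_0,e_1,e_2,\dots$, $e_k$ of weight $\omega+2k$, and, for $g\in M$, $$\alpha\,ge_k=A_k(T_{-1}g)e_k,\quad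 \beta\,ge_k=B_k(T_1g)e_{k-1},\quad \gamma\,ge_k=-q^{-1}(T_{-1}g)e_{k+1},\quad \delta\,ge_k=D_k(T_1g)e_k,$$ $$A_k=q^{-k}\frac{1-q^{2(\lambda-\omega-k+1)}}{1-q^{2(\lambda-\omega-2k+1)}},\quad B_k=\frac{(1-q^{2k})(1-q^{2(\omega+k-1)})}{(1-q^{2(\lambda+1)})(1-q^{2(\omega+2k-\lambda-3)})},\quad D_k=q^k\frac{1-q^{2(\lambda+1-k)}}{1-q^{2(\lambda+1)}}.$$ Finally $(a;q)_n=\prod_{j<n}(1-aq^j)$, $(a_1,\dots,a_r;q)_n=\prod_i(a_i;q)_n$, and the $q$-Racah polynomials are, for $n,x\in\mathbb Z_{\ge0}$, $$R_n(\mu(x);a,b,c,d;q)=\sum_{j=0}^n\frac{(q^{-n},abq^{n+1},q^{-x},cdq^{x+1};q)_j}{(q,aq,bdq,cq;q)_j}\,q^j .$$ \textbf{Theorem.} Let $\omega_1,\omega_2\in\mathbb C$ and let $\pi$ be the tensor product representation on $\mathcal H^{\omega_1}\bar\otimes\mathcal H^{\omega_2}$. (1) Let $p\in\mathbb Z_{\ge0}$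 be such that $q^{2(\omega_1+j)}\ne1$ and $q^{2(\omega_2+j)}\neq1$ for $0\le j<p$. Then for each $y\in\{0,1,\dots,p\}$ the vector $v(y;p)=\sum_{k=0}^pv_k(e_{p-k}\otimes e_k)$ with $$v_k(\lambda)=(-1)^kq^{2k(\omega_1+\omega_2)+k(3p-1)}\frac{(q^{-2\lambda},q^{-2(\omega_1+p-1)},q^{-2p};q^2)_k}{(q^2,q^{2\omega_2},q^{2(\omega_1+\omega_2+p-\lambda-1)};q^2)_k}\,R_k(\mu(p-y);q^{-2(\lambda+1)},q^{2(\omega_2-1)},q^{-2(p+1)},q^{-2(\omega_1+\omega_2+p-1)};q^2)$$ is a nonzero vector of weight $\omega_1+\omega_2+2p$ and an eigenvector of $\pi(\Xi)$ with eigenvalue $q^{\omega_1+\omega_2+2y-1}+q^{1-\omega_1-\omega_2-2y}$. (2) Assume that $q^{2(\omega_1+\omega_2+n)}\neq1$ for all integers $n\ge0$ (for real $\omega_1+\omega_2$ this says $\omega_1+\omega_2\notin\mathbb Z_{\le0}$). Then there is an isomorphism of dynamical representations $$\Phi:\ \bigoplus_{s=0}^\infty\mathcal H^{\omega_1+\omega_2+2s}\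 \longrightarrow\ \mathcal H^{\omega_1}\bar\otimes\mathcal H^{\omega_2}.$$ If moreover $q^{2(\omega_1+j)}\ne1$ and $q^{2(\omega_2+j)}\ne1$ for all integers $j\ge0$, then, for every $s\ge0$, the $M$-linear map $C:\mathcal H^{\omega_1+\omega_2+2s}\to\mathcal H^{\omega_1}\bar\otimes\mathcal H^{\omega_2}$ given by $$Ce_k=q^{s(k-\lambda)}(q^{2(\lambda+2-\omega_1-\omega_2-2s-k)};q^2)_s\;v(s;s+k),\qquad k\ge0,$$ is an intertwiner, and $\Phi$ can be chosen so that its restriction to the $s$-th summand is this $C$ for all $s$. -/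

import Mathlib

set_option linter.unusedSectionVars false
set_option linter.unusedSimpArgs false

open Filter Topology

noncomputable section

/-! # The field of meromorphic functions on the plane -/

/-- Functions on `ℂ` that are meromorphic at every point (with arbitrary values at the poles). -/
def MerFun : Subalgebra ℂ (ℂ → ℂ) where
  carrier := {f | Meromorphic f}
  mul_mem' := fun hf hg => Meromorphic.mul hf hg
  add_mem' := fun hf hg => Meromorphic.add hf hg
  algebraMap_mem' := fun c => Meromorphic.const c

/-- The functions that vanish off a discrete closed set. -/
def merNull : Ideal MerFun where
  carrier := {f | ∀ z : ℂ, ∀ᶠ w in 𝓝[≠] z, (f : ℂ → ℂ) w = 0}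
  add_mem' := by
    intro f g hf hg z
    filter_upwards [hf z, hg z] with w h1 h2
    simp [h1, h2]
  zero_mem' := fun z => by simp
  smul_mem' := by
    intro c f hf z
    filter_upwards [hf z] with w h1
    simp [h1]

/-- The field of meromorphic functions on `ℂ`: two functions are identified when they agree off a
discrete closed set. -/
def Mer : Type := MerFun ⧸ merNull

namespace Mer

instance : CommRing Mer := inferInstanceAs (CommRing (MerFun ⧸ merNull))
instance : Algebra ℂ Mer := inferInstanceAs (Algebra ℂ (MerFun ⧸ merNull))

/-- The class of a meromorphic function. -/
def mk : MerFun →ₐ[ℂ] Mer := Ideal.Quotient.mkₐ ℂ merNull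

theorem mk_surjective : Function.Surjective mk := Ideal.Quotient.mk_surjective

theorem mk_eq_zero {f : MerFun} :
    mk f = 0 ↔ ∀ z : ℂ, ∀ᶠ w in 𝓝[≠] z, (f : ℂ → ℂ) w = 0 :=
  Ideal.Quotient.eq_zero_iff_mem

theorem exists_inv (x : Mer) (hx : x ≠ 0) : ∃ y, x * y = 1 := by
  obtain ⟨f, rfl⟩ := mk_surjective x
  have hf : Meromorphic (f : ℂ → ℂ) := f.2
  refine ⟨mk ⟨(f : ℂ → ℂ)⁻¹, hf.inv⟩, ?_⟩
  rw [← map_mul, ← sub_eq_zero, ← map_one mk, ← map_sub, mk_eq_zero]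
  rw [Ne, mk_eq_zero, not_forall] at hx
  obtain ⟨z₀, hz₀⟩ := hx
  have h0 : meromorphicOrderAt (f : ℂ → ℂ) z₀ ≠ ⊤ := by
    rwa [Ne, meromorphicOrderAt_eq_top_iff]
  intro z
  have h1 : meromorphicOrderAt (f : ℂ → ℂ) z ≠ ⊤ :=
    (hf.meromorphicOn (s := Set.univ)).meromorphicOrderAt_ne_top_of_isPreconnected
      isPreconnected_univ (Set.mem_univ _) (Set.mem_univ _) h0
  filter_upwards [(meromorphicOrderAt_ne_top_iff_eventually_ne_zero (hf z)).1 h1] with w hw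
  simp [hw]

instance : Nontrivial Mer := ⟨0, 1, by
  intro h
  have h1 : mk 1 = 0 := by rw [map_one, h]
  rw [mk_eq_zero] at h1
  obtain ⟨w, hw⟩ := (h1 0).exists
  exact one_ne_zero hw⟩

open Classical in
instance : Field Mer where
  inv x := if h : x ≠ 0 then (exists_inv x h).choose else 0
  mul_inv_cancel x hx := by
    rw [dif_pos hx]; exact (exists_inv x hx).choose_spec
  inv_zero := by simp
  nnqsmul := _
  nnqsmul_def := fun _ _ => rfl
  qsmul := _
  qsmul_def := fun _ _ => rfl

/-- Translation of functions, `f ↦ f(· + s)`, before passing to classes. -/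
def shiftFun (s : ℂ) : MerFun →ₐ[ℂ] MerFun where
  toFun f := ⟨fun z => (f : ℂ → ℂ) (z + s),
    Meromorphic.meromorphic_fun_comp_add_const_iff_meromorphic.2 f.2⟩
  map_one' := rfl
  map_mul' _ _ := rfl
  map_zero' := rfl
  map_add' _ _ := rfl
  commutes' _ := rfl

theorem shiftFun_null (s : ℂ) (f : MerFun) (hf : mk f = 0) : mk (shiftFun s f) = 0 := by
  rw [mk_eq_zero] at hf ⊢
  intro z
  have h : Tendsto (fun w : ℂ => w + s) (𝓝[≠] z) (𝓝[≠] (z + s)) := by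
    refine tendsto_nhdsWithin_of_tendsto_nhds_of_eventually_within _ ?_ ?_
    · exact ((continuous_id.add continuous_const).tendsto z).mono_left nhdsWithin_le_nhds
    · filter_upwards [self_mem_nhdsWithin] with w hw
      simpa using hw
  exact h.eventually (hf (z + s))

/-- The automorphism `T_s` of the field of meromorphic functions, `(T_s f)(λ) = f(λ + s)`. -/
def T (s : ℂ) : Mer →ₐ[ℂ] Mer :=
  Ideal.Quotient.liftₐ merNull (mk.comp (shiftFun s)) (fun f hf =>
    shiftFun_null s f (mk_eq_zero.2 hf))

theorem T_mk (s : ℂ) (f : MerFun) : T s (mk f) = mk (shiftFun s f) := rfl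

@[simp] theorem T_zero (f : Mer) : T 0 f = f := by
  obtain ⟨f, rfl⟩ := mk_surjective f
  rw [T_mk]; congr 1; ext z; simp [shiftFun]

@[simp] theorem T_T (s t : ℂ) (f : Mer) : T s (T t f) = T (s + t) f := by
  obtain ⟨f, rfl⟩ := mk_surjective f
  simp only [T_mk]; congr 1; ext z
  exact congrArg (f : ℂ → ℂ) (add_assoc z s t)

theorem qexp_mem {q : ℝ} (a b : ℂ) : (fun z : ℂ => (q : ℂ) ^ (a * z + b)) ∈ MerFun := by
  rcases eq_or_ne q 0 with rfl | hq
  · rcases eq_or_ne a 0 with rfl | ha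
    · have h : Meromorphic (fun _ : ℂ => ((0 : ℝ) : ℂ) ^ b) := Meromorphic.const _
      simp only [zero_mul, zero_add]; exact h
    · have h : Meromorphic (fun _ : ℂ => (0 : ℂ)) := Meromorphic.const 0
      intro z
      refine (h z).congr ?_
      have h2 : ∀ᶠ w in 𝓝[≠] z, w ≠ -b / a := by
        rcases eq_or_ne z (-b / a) with rfl | hz
        · exact self_mem_nhdsWithin
        · exact nhdsWithin_le_nhds (isOpen_ne.mem_nhds hz)
      filter_upwards [h2] with w hw
      have : a * w + b ≠ 0 := fun h => hw (by field_simp; linear_combination h)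
      simp [Complex.zero_cpow this]
  · have : Differentiable ℂ (fun z : ℂ => (q : ℂ) ^ (a * z + b)) := by
      intro z
      exact ((differentiableAt_id.const_mul a).add_const b).const_cpow
        (Or.inl (by exact_mod_cast hq))
    exact fun z => (this.analyticAt z).meromorphicAt

/-- The meromorphic function `λ ↦ q^(a λ + b)`. -/
def qexp (q : ℝ) (a b : ℂ) : Mer := mk ⟨fun z : ℂ => (q : ℂ) ^ (a * z + b), qexp_mem a b⟩

end Mer
end
noncomputable section
namespace Mer

variable {q : ℝ}

theorem qexp_mul (hq : 0 < q) (a b c d : ℂ) :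
    qexp q a b * qexp q c d = qexp q (a + c) (b + d) := by
  rw [qexp, qexp, ← map_mul]
  refine congrArg mk (Subtype.ext (funext fun z => ?_))
  have h : (q : ℂ) ≠ 0 := by exact_mod_cast hq.ne'
  change (q : ℂ) ^ (a * z + b) * (q : ℂ) ^ (c * z + d) = (q : ℂ) ^ ((a + c) * z + (b + d))
  rw [← Complex.cpow_add _ _ h]; congr 1; ring

theorem qexp_zero_left (b : ℂ) : qexp q 0 b = algebraMap ℂ Mer ((q : ℂ) ^ b) := by
  rw [← mk.commutes]
  refine congrArg mk (Subtype.ext (funext fun z => ?_))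
  change (q : ℂ) ^ (0 * z + b) = (q : ℂ) ^ b
  rw [zero_mul, zero_add]

theorem T_qexp (s a b : ℂ) : T s (qexp q a b) = qexp q a (b + a * s) := by
  rw [qexp, T_mk]
  refine congrArg mk (Subtype.ext (funext fun z => ?_))
  change (q : ℂ) ^ (a * (z + s) + b) = (q : ℂ) ^ (a * z + (b + a * s))
  congr 1; ring

theorem qexp_split (hq : 0 < q) (a b : ℂ) :
    qexp q a b = algebraMap ℂ Mer ((q : ℂ) ^ b) * qexp q a 0 := by
  rw [← qexp_zero_left, qexp_mul hq, zero_add, add_zero]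

theorem qexp_ne_const (hq : 0 < q) (hq1 : q < 1) {a : ℂ} (ha : a ≠ 0) (b c : ℂ) :
    qexp q a b ≠ algebraMap ℂ Mer c := by
  intro h
  -- translating by `1 / a` multiplies the left side by `q ≠ 1` and fixes the right side
  have h1 := congrArg (T (1 / a)) h
  rw [T_qexp, AlgHom.commutes, ← h, mul_one_div_cancel ha, qexp_split hq,
    qexp_split hq a b, Complex.cpow_add _ _ (by exact_mod_cast hq.ne'), Complex.cpow_one] at h1
  have h2 : qexp q a 0 * qexp q (-a) 0 = 1 := by
    rw [qexp_mul hq, add_neg_cancel, add_zero, qexp_zero_left, Complex.cpow_zero, map_one]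
  have h3 := congrArg (· * qexp q (-a) 0) h1
  simp only [mul_assoc, h2, mul_one] at h3
  have h4 := (algebraMap ℂ Mer).injective h3
  have h5 : (q : ℂ) ^ b ≠ 0 := by
    rw [Ne, Complex.cpow_eq_zero_iff]; push Not; intro h6
    exact absurd h6 (by exact_mod_cast hq.ne')
  have h6 : (q : ℂ) = 1 := mul_left_cancel₀ h5 (by rw [h4, mul_one])
  exact hq1.ne (by exact_mod_cast h6)

theorem qexp_ne_zero (hq : 0 < q) (a b : ℂ) : qexp q a b ≠ 0 := by
  intro h
  have h2 : qexp q a b * qexp q (-a) (-b) = 1 := by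
    rw [qexp_mul hq, add_neg_cancel, add_neg_cancel, qexp_zero_left, Complex.cpow_zero, map_one]
  rw [h, zero_mul] at h2
  exact zero_ne_one h2

end Mer

/-! # The dynamical quantum group `F_R(SL(2))` -/

/-- The real number `q` as a constant function. -/
abbrev qc (q : ℝ) : Mer := algebraMap ℂ Mer (q : ℂ)

/-- `F(λ) = (q^(2(λ+1)) - q^(-2)) / (q^(2(λ+1)) - 1)`. -/
def dynF (q : ℝ) : Mer := (Mer.qexp q 2 2 - (qc q)⁻¹ ^ 2) / (Mer.qexp q 2 2 - 1)

/-- `G(λ) = (q^(2(λ+1)) - q^2)(q^(2(λ+1)) - q^(-2)) / (q^(2(λ+1)) - 1)^2`. -/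
def dynG (q : ℝ) : Mer :=
  (Mer.qexp q 2 2 - qc q ^ 2) * (Mer.qexp q 2 2 - (qc q)⁻¹ ^ 2) / (Mer.qexp q 2 2 - 1) ^ 2

/-- `1 / (q^(2(λ+1)) - 1)`. -/
def dynE (q : ℝ) : Mer := 1 / (Mer.qexp q 2 2 - 1)

/-- `q^(2(λ+1)) / (q^(2(λ+1)) - 1)`. -/
def dynE' (q : ℝ) : Mer := Mer.qexp q 2 2 / (Mer.qexp q 2 2 - 1)

/-- `H(λ,μ) = (q - q⁻¹)(q^(2(λ+μ+2)) - 1) / ((q^(2(λ+1)) - 1)(q^(2(μ+1)) - 1))`, in an algebra with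
two copies `l`, `m` of the meromorphic functions. -/
def dynH (q : ℝ) {R : Type*} [Ring R] [Algebra ℂ R] (l m : Mer → R) : R :=
  ((q : ℂ) - (q : ℂ)⁻¹) • (l (dynE' q) * m (dynE' q) - l (dynE q) * m (dynE q))

/-- `I(λ,μ) = (q - q⁻¹)(q^(2(μ+1)) - q^(2(λ+1))) / ((q^(2(λ+1)) - 1)(q^(2(μ+1)) - 1))`. -/
def dynI (q : ℝ) {R : Type*} [Ring R] [Algebra ℂ R] (l m : Mer → R) : R :=
  ((q : ℂ) - (q : ℂ)⁻¹) • (l (dynE q) * m (dynE' q) - l (dynE' q) * m (dynE q))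

/-- Generators: `α, β, γ, δ` and two copies `f(λ)`, `f(μ)` of the meromorphic functions. -/
inductive FGen : Type
  | α | β | γ | δ
  | lam (f : Mer)
  | mu (f : Mer)

namespace FGen

/-- Generators inside the free algebra. -/
abbrev a : FreeAlgebra ℂ FGen := FreeAlgebra.ι ℂ FGen.α
abbrev b : FreeAlgebra ℂ FGen := FreeAlgebra.ι ℂ FGen.β
abbrev c : FreeAlgebra ℂ FGen := FreeAlgebra.ι ℂ FGen.γ
abbrev d : FreeAlgebra ℂ FGen := FreeAlgebra.ι ℂ FGen.δ
abbrev l (f : Mer) : FreeAlgebra ℂ FGen := FreeAlgebra.ι ℂ (FGen.lam f)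
abbrev m (f : Mer) : FreeAlgebra ℂ FGen := FreeAlgebra.ι ℂ (FGen.mu f)

end FGen

open FGen in
/-- Defining relations of `F_R(SL(2))`. -/
inductive FRel (q : ℝ) : FreeAlgebra ℂ FGen → FreeAlgebra ℂ FGen → Prop
  -- `f ↦ f(λ)` and `f ↦ f(μ)` are homomorphisms of complex algebras with commuting images
  | lam_add (f g : Mer) : FRel q (l (f + g)) (l f + l g)
  | lam_mul (f g : Mer) : FRel q (l (f * g)) (l f * l g)
  | lam_const (z : ℂ) : FRel q (l (algebraMap ℂ Mer z)) (algebraMap ℂ _ z)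
  | mu_add (f g : Mer) : FRel q (m (f + g)) (m f + m g)
  | mu_mul (f g : Mer) : FRel q (m (f * g)) (m f * m g)
  | mu_const (z : ℂ) : FRel q (m (algebraMap ℂ Mer z)) (algebraMap ℂ _ z)
  | lam_mu (f g : Mer) : FRel q (l f * m g) (m g * l f)
  -- commutation of functions with the generators
  | lam_α (f : Mer) : FRel q (l f * a) (a * l (Mer.T 1 f))
  | mu_α (f : Mer) : FRel q (m f * a) (a * m (Mer.T 1 f))
  | lam_β (f : Mer) : FRel q (l f * b) (b * l (Mer.T 1 f))
  | mu_β (f : Mer) : FRel q (m f * b) (b * m (Mer.T (-1) f))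
  | lam_γ (f : Mer) : FRel q (l f * c) (c * l (Mer.T (-1) f))
  | mu_γ (f : Mer) : FRel q (m f * c) (c * m (Mer.T 1 f))
  | lam_δ (f : Mer) : FRel q (l f * d) (d * l (Mer.T (-1) f))
  | mu_δ (f : Mer) : FRel q (m f * d) (d * m (Mer.T (-1) f))
  -- quadratic relations
  | αβ : FRel q (a * b) ((q : ℂ) • (m (Mer.T (-1) (dynF q)) * b * a))
  | αγ : FRel q (a * c) ((q : ℂ) • (l (dynF q) * c * a))
  | βδ : FRel q (b * d) ((q : ℂ) • (l (dynF q) * d * b))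
  | γδ : FRel q (c * d) ((q : ℂ) • (m (Mer.T (-1) (dynF q)) * d * c))
  | cross₁ : FRel q (a * d - d * a) (dynH q l m * c * b)
  | cross₂ : FRel q (m (dynG q) * a * d - l (dynG q) * d * a) (dynH q l m * b * c)
  | cross₃ : FRel q (b * c - m (dynG q) * c * b) (dynI q l m * d * a)
  | cross₄ : FRel q (b * c - l (dynG q) * c * b) (dynI q l m * a * d)
  -- the determinant is `1`
  | det : FRel q (a * d - (q : ℂ) • (l (dynF q) * c * b)) 1

/-- The algebra `F_R(SL(2))`. -/
def FRSL2 (q : ℝ) : Type := RingQuot (FRel q)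

namespace FRSL2

variable (q : ℝ)

instance : Ring (FRSL2 q) := inferInstanceAs (Ring (RingQuot (FRel q)))
instance : Algebra ℂ (FRSL2 q) := inferInstanceAs (Algebra ℂ (RingQuot (FRel q)))

/-- The quotient map from the free algebra. -/
def proj : FreeAlgebra ℂ FGen →ₐ[ℂ] FRSL2 q := RingQuot.mkAlgHom ℂ (FRel q)

variable {q} in
theorem proj_rel {x y : FreeAlgebra ℂ FGen} (h : FRel q x y) : proj q x = proj q y :=
  RingQuot.mkAlgHom_rel ℂ h

/-- The generator `α`. -/
def gα : FRSL2 q := proj q FGen.a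
/-- The generator `β`. -/
def gβ : FRSL2 q := proj q FGen.b
/-- The generator `γ`. -/
def gγ : FRSL2 q := proj q FGen.c
/-- The generator `δ`. -/
def gδ : FRSL2 q := proj q FGen.d

/-- The left moment map `f ↦ f(λ)`. -/
def lam : Mer →ₐ[ℂ] FRSL2 q :=
  AlgHom.ofLinearMap
    { toFun := fun f => proj q (FGen.l f)
      map_add' := fun f g => by rw [proj_rel (FRel.lam_add f g), map_add]
      map_smul' := fun z f => by
        rw [Algebra.smul_def, proj_rel (FRel.lam_mul _ f), map_mul, proj_rel (FRel.lam_const z),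
          AlgHom.commutes, RingHom.id_apply, Algebra.smul_def] }
    (by
      change proj q (FGen.l 1) = 1
      rw [← map_one (algebraMap ℂ Mer), proj_rel (FRel.lam_const 1), map_one, map_one])
    (fun f g => by
      change proj q (FGen.l (f * g)) = proj q (FGen.l f) * proj q (FGen.l g)
      rw [proj_rel (FRel.lam_mul f g), map_mul])

/-- The right moment map `f ↦ f(μ)`. -/
def mu : Mer →ₐ[ℂ] FRSL2 q :=
  AlgHom.ofLinearMap
    { toFun := fun f => proj q (FGen.m f)
      map_add' := fun f g => by rw [proj_rel (FRel.mu_add f g), map_add]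
      map_smul' := fun z f => by
        rw [Algebra.smul_def, proj_rel (FRel.mu_mul _ f), map_mul, proj_rel (FRel.mu_const z),
          AlgHom.commutes, RingHom.id_apply, Algebra.smul_def] }
    (by
      change proj q (FGen.m 1) = 1
      rw [← map_one (algebraMap ℂ Mer), proj_rel (FRel.mu_const 1), map_one, map_one])
    (fun f g => by
      change proj q (FGen.m (f * g)) = proj q (FGen.m f) * proj q (FGen.m g)
      rw [proj_rel (FRel.mu_mul f g), map_mul])

open Mer in
/-- The Casimir element
`Ξ = q^(λ-μ+1) + q^(μ-λ-1) - q^(-(λ+μ+2)) (1 - q^(2(λ+2))) (1 - q^(2μ)) γ β`. -/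
def Xi : FRSL2 q :=
  lam q (qexp q 1 1) * mu q (qexp q (-1) 0) + lam q (qexp q (-1) (-1)) * mu q (qexp q 1 0)
    - lam q (qexp q (-1) (-2) * (1 - qexp q 2 4)) * mu q (qexp q (-1) 0 * (1 - qexp q 2 0))
      * gγ q * gβ q

end FRSL2

/-! ### A shorter presentation, used to construct representations -/

/-- `q F(λ)`. -/
def dynK (q : ℝ) : Mer := qc q * dynF q

theorem qc_ne {q : ℝ} (hq : 0 < q) : qc q ≠ 0 := by
  rw [Ne, map_eq_zero]; exact_mod_cast hq.ne'

theorem dyn_denom_ne {q : ℝ} (hq : 0 < q) (hq1 : q < 1) : Mer.qexp q 2 2 - 1 ≠ 0 := by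
  have := Mer.qexp_ne_const hq hq1 two_ne_zero 2 1
  rw [map_one] at this
  exact sub_ne_zero.2 this

/-- `q F(λ)` as a polynomial in `1 / (q^(2(λ+1)) - 1)`. -/
theorem dynK_eq {q : ℝ} (hq : 0 < q) (hq1 : q < 1) :
    dynK q = qc q + (qc q - (qc q)⁻¹) * dynE q := by
  have h1 := dyn_denom_ne hq hq1
  have h2 := qc_ne hq
  rw [dynK, dynF, dynE]; field_simp; ring

theorem dynK_mul {q : ℝ} (hq : 0 < q) (hq1 : q < 1) :
    (qc q + (qc q)⁻¹ - dynK q) * Mer.T (-1) (dynK q) = 1 := by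
  have h1 := dyn_denom_ne hq hq1
  have h2 := qc_ne hq
  have h3 : Mer.T (-1) (Mer.qexp q 2 2) = (qc q)⁻¹ ^ 2 * Mer.qexp q 2 2 := by
    rw [Mer.T_qexp, show (2 : ℂ) + 2 * (-1) = 0 by norm_num, Mer.qexp_split hq 2 2,
      show (2 : ℂ) = ((2 : ℕ) : ℂ) by norm_num, Complex.cpow_natCast, map_pow, ← mul_assoc,
      ← mul_pow, inv_mul_cancel₀ h2, one_pow, one_mul]
  have h4 : Mer.qexp q 2 2 - qc q ^ 2 ≠ 0 := by
    rw [← map_pow]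
    exact sub_ne_zero.2 (Mer.qexp_ne_const hq hq1 two_ne_zero _ _)
  have h5 : Mer.T (-1) (dynK q) = qc q * (qc q)⁻¹ ^ 2 * (Mer.qexp q 2 2 - 1) /
      ((qc q)⁻¹ ^ 2 * (Mer.qexp q 2 2 - qc q ^ 2)) := by
    rw [dynK, dynF, map_mul, map_div₀, map_sub, map_sub, map_pow, map_inv₀, h3, AlgHom.commutes,
      map_one]
    have h6 : (qc q)⁻¹ ^ 2 * Mer.qexp q 2 2 - 1 =
        (qc q)⁻¹ ^ 2 * (Mer.qexp q 2 2 - qc q ^ 2) := by field_simp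
    rw [← h6]; ring
  rw [h5, dynK, dynF]; field_simp; ring

theorem dynG_eq {q : ℝ} (hq : 0 < q) (hq1 : q < 1) :
    dynG q = dynK q * (qc q + (qc q)⁻¹ - dynK q) := by
  have h1 := dyn_denom_ne hq hq1
  have h2 := qc_ne hq
  rw [dynK, dynF, dynG]; field_simp; ring

theorem dynE'_eq {q : ℝ} (hq : 0 < q) (hq1 : q < 1) : dynE' q = 1 + dynE q := by
  have h1 := dyn_denom_ne hq hq1
  rw [dynE', dynE]; field_simp; ring

section
variable {q : ℝ} {R : Type*} [Ring R] [Algebra ℂ R]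

theorem map_dynK (hq : 0 < q) (hq1 : q < 1) (l : Mer →ₐ[ℂ] R) :
    l (dynK q) = (q : ℂ) • 1 + ((q : ℂ) - (q : ℂ)⁻¹) • l (dynE q) := by
  rw [dynK_eq hq hq1, ← map_inv₀, ← map_sub, map_add, map_mul, AlgHom.commutes, AlgHom.commutes,
    Algebra.smul_def, Algebra.smul_def, mul_one]

theorem dynH_eq (hq : 0 < q) (hq1 : q < 1) (l m : Mer →ₐ[ℂ] R) :
    dynH q l m = l (dynK q) + m (dynK q) - ((q : ℂ) + (q : ℂ)⁻¹) • 1 := by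
  rw [dynH, dynE'_eq hq hq1, map_dynK hq hq1, map_dynK hq hq1, map_add, map_add, map_one, map_one,
    add_mul, one_mul, mul_add, mul_one]
  module

theorem dynI_eq (hq : 0 < q) (hq1 : q < 1) (l m : Mer →ₐ[ℂ] R) :
    dynI q l m = l (dynK q) - m (dynK q) := by
  rw [dynI, dynE'_eq hq hq1, map_dynK hq hq1, map_dynK hq hq1, map_add, map_add, map_one, map_one,
    add_mul, one_mul, mul_add, mul_one]
  module

theorem map_dynG (hq : 0 < q) (hq1 : q < 1) (l : Mer →ₐ[ℂ] R) :
    l (dynG q) = ((q : ℂ) + (q : ℂ)⁻¹) • l (dynK q) - l (dynK q) * l (dynK q) := by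
  rw [dynG_eq hq hq1, mul_sub, map_sub, map_mul, map_mul, ← map_inv₀, ← map_add,
    AlgHom.commutes, Algebra.smul_def, Algebra.commutes]

/-- Elements of an algebra subject to a system of relations that is equivalent to the defining
relations of `F_R(SL(2))`. -/
structure FCore (q : ℝ) (a b c d : R) (l m : Mer →ₐ[ℂ] R) : Prop where
  lm : ∀ f g, l f * m g = m g * l f
  la : ∀ f, l f * a = a * l (Mer.T 1 f)
  ma : ∀ f, m f * a = a * m (Mer.T 1 f)
  lb : ∀ f, l f * b = b * l (Mer.T 1 f)
  mb : ∀ f, m f * b = b * m (Mer.T (-1) f)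
  lc : ∀ f, l f * c = c * l (Mer.T (-1) f)
  mc : ∀ f, m f * c = c * m (Mer.T 1 f)
  ld : ∀ f, l f * d = d * l (Mer.T (-1) f)
  md : ∀ f, m f * d = d * m (Mer.T (-1) f)
  ab : a * b = m (Mer.T (-1) (dynK q)) * (b * a)
  ac : a * c = l (dynK q) * (c * a)
  bd : b * d = l (dynK q) * (d * b)
  cd : c * d = m (Mer.T (-1) (dynK q)) * (d * c)
  ad : a * d = 1 + l (dynK q) * (c * b)
  da : d * a = 1 + (((q : ℂ) + (q : ℂ)⁻¹) • 1 - m (dynK q)) * (c * b)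
  bc : b * c = (((q : ℂ) + (q : ℂ)⁻¹) • 1 - m (dynK q)) * (a * d)
    - (((q : ℂ) + (q : ℂ)⁻¹) • 1 - l (dynK q))

variable {a b c d : R} {l m : Mer →ₐ[ℂ] R}

theorem map_qc_mul (l : Mer →ₐ[ℂ] R) (f : Mer) : l (qc q * f) = (q : ℂ) • l f := by
  rw [map_mul, AlgHom.commutes, Algebra.smul_def]

theorem FCore.bc' (h : FCore q a b c d l m) :
    b * c = l (dynK q) - m (dynK q) +
      ((q : ℂ) + (q : ℂ)⁻¹) • (l (dynK q) * (c * b)) - l (dynK q) * (m (dynK q) * (c * b)) := by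
  rw [h.bc, h.ad, ← mul_assoc (l (dynK q)) (m _), h.lm]
  simp only [mul_add, sub_mul, mul_one, smul_mul_assoc, one_mul, mul_assoc]
  module

/-- The images of the generators of the free algebra. -/
def genMap (a b c d : R) (l m : Mer →ₐ[ℂ] R) : FGen → R
  | .α => a | .β => b | .γ => c | .δ => d | .lam f => l f | .mu f => m f

theorem FCore.rel (hq : 0 < q) (hq1 : q < 1) (h : FCore q a b c d l m)
    ⦃x y : FreeAlgebra ℂ FGen⦄ (hxy : FRel q x y) :
    FreeAlgebra.lift ℂ (genMap a b c d l m) x = FreeAlgebra.lift ℂ (genMap a b c d l m) y := by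
  have hT : ∀ l : Mer →ₐ[ℂ] R, l (Mer.T (-1) (dynK q)) = (q : ℂ) • l (Mer.T (-1) (dynF q)) := by
    intro l; rw [dynK, map_mul, AlgHom.commutes, map_qc_mul]
  have hK : ∀ l : Mer →ₐ[ℂ] R, l (dynK q) = (q : ℂ) • l (dynF q) := fun l => map_qc_mul l _
  have hH : ∀ l' m' : Mer → FreeAlgebra ℂ FGen,
      (∀ f, FreeAlgebra.lift ℂ (genMap a b c d l m) (l' f) = l f) →
      (∀ f, FreeAlgebra.lift ℂ (genMap a b c d l m) (m' f) = m f) →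
      FreeAlgebra.lift ℂ (genMap a b c d l m) (dynH q l' m') = dynH q l m ∧
      FreeAlgebra.lift ℂ (genMap a b c d l m) (dynI q l' m') = dynI q l m := by
    intro l' m' h1 h2
    constructor
    · rw [dynH, dynH, map_smul, map_sub, map_mul, map_mul, h1, h1, h2, h2]
    · rw [dynI, dynI, map_smul, map_sub, map_mul, map_mul, h1, h1, h2, h2]
  have hHI := hH FGen.l FGen.m (fun f => by simp [genMap]) (fun f => by simp [genMap])
  have hlm := h.lm (dynK q) (dynK q)
  have e0 := h.bc'
  have e1 := h.ad
  have e2 := h.da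
  cases hxy with
  | lam_add f g => simp [genMap]
  | lam_mul f g => simp [genMap]
  | lam_const z => simp [genMap]
  | mu_add f g => simp [genMap]
  | mu_mul f g => simp [genMap]
  | mu_const z => simp [genMap]
  | lam_mu f g => simpa [genMap] using h.lm f g
  | lam_α f => simpa [genMap] using h.la f
  | mu_α f => simpa [genMap] using h.ma f
  | lam_β f => simpa [genMap] using h.lb f
  | mu_β f => simpa [genMap] using h.mb f
  | lam_γ f => simpa [genMap] using h.lc f
  | mu_γ f => simpa [genMap] using h.mc f
  | lam_δ f => simpa [genMap] using h.ld f
  | mu_δ f => simpa [genMap] using h.md f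
  | αβ => simpa [genMap, hT, mul_assoc, -Complex.coe_smul] using h.ab
  | αγ => simpa [genMap, hK, mul_assoc, -Complex.coe_smul] using h.ac
  | βδ => simpa [genMap, hK, mul_assoc, -Complex.coe_smul] using h.bd
  | γδ => simpa [genMap, hT, mul_assoc, -Complex.coe_smul] using h.cd
  | cross₁ =>
    simp only [map_sub, map_mul, hHI, FreeAlgebra.lift_ι_apply, genMap]
    rw [dynH_eq hq hq1, e1, e2]
    simp only [sub_mul, add_mul, smul_mul_assoc, one_mul, mul_assoc]
    module
  | cross₂ =>
    simp only [map_sub, map_mul, hHI, FreeAlgebra.lift_ι_apply, genMap]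
    rw [dynH_eq hq hq1, map_dynG hq hq1, map_dynG hq hq1, mul_assoc, mul_assoc, mul_assoc, e1, e2, e0]
    have r1 : ∀ x : R, m (dynK q) * (l (dynK q) * x) = l (dynK q) * (m (dynK q) * x) := by
      intro x; rw [← mul_assoc, ← hlm, mul_assoc]
    simp only [sub_mul, add_mul, mul_add, mul_sub, smul_mul_assoc, mul_smul_comm, one_mul,
      mul_one, mul_assoc, r1, ← hlm]
    module
  | cross₃ =>
    simp only [map_sub, map_mul, hHI, FreeAlgebra.lift_ι_apply, genMap]
    rw [dynI_eq hq hq1, map_dynG hq hq1, mul_assoc, mul_assoc, e2, e0]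
    have r1 : ∀ x : R, m (dynK q) * (l (dynK q) * x) = l (dynK q) * (m (dynK q) * x) := by
      intro x; rw [← mul_assoc, ← hlm, mul_assoc]
    simp only [sub_mul, add_mul, mul_add, mul_sub, smul_mul_assoc, mul_smul_comm, one_mul,
      mul_one, mul_assoc, r1, ← hlm]
    module
  | cross₄ =>
    simp only [map_sub, map_mul, hHI, FreeAlgebra.lift_ι_apply, genMap]
    rw [dynI_eq hq hq1, map_dynG hq hq1, mul_assoc, mul_assoc, e1, e0]
    have r1 : ∀ x : R, m (dynK q) * (l (dynK q) * x) = l (dynK q) * (m (dynK q) * x) := by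
      intro x; rw [← mul_assoc, ← hlm, mul_assoc]
    simp only [sub_mul, add_mul, mul_add, mul_sub, smul_mul_assoc, mul_smul_comm, one_mul,
      mul_one, mul_assoc, r1, ← hlm]
    module
  | det =>
    have := h.ad
    rw [hK, smul_mul_assoc] at this
    simp [genMap, mul_assoc, this, -Complex.coe_smul]

/-- The homomorphism from `F_R(SL(2))` given by the images of the generators. -/
def FCore.lift (hq : 0 < q) (hq1 : q < 1) (h : FCore q a b c d l m) : FRSL2 q →ₐ[ℂ] R :=
  RingQuot.liftAlgHom ℂ ⟨FreeAlgebra.lift ℂ (genMap a b c d l m), h.rel hq hq1⟩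

theorem FCore.lift_proj (hq : 0 < q) (hq1 : q < 1) (h : FCore q a b c d l m)
    (x : FreeAlgebra ℂ FGen) :
    h.lift hq hq1 (FRSL2.proj q x) = FreeAlgebra.lift ℂ (genMap a b c d l m) x :=
  RingQuot.liftAlgHom_mkAlgHom_apply ℂ _ _ _

theorem FCore.lift_α (hq : 0 < q) (hq1 : q < 1) (h : FCore q a b c d l m) :
    h.lift hq hq1 (FRSL2.gα q) = a := by simp [FRSL2.gα, FCore.lift_proj, genMap]
theorem FCore.lift_β (hq : 0 < q) (hq1 : q < 1) (h : FCore q a b c d l m) :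
    h.lift hq hq1 (FRSL2.gβ q) = b := by simp [FRSL2.gβ, FCore.lift_proj, genMap]
theorem FCore.lift_γ (hq : 0 < q) (hq1 : q < 1) (h : FCore q a b c d l m) :
    h.lift hq hq1 (FRSL2.gγ q) = c := by simp [FRSL2.gγ, FCore.lift_proj, genMap]
theorem FCore.lift_δ (hq : 0 < q) (hq1 : q < 1) (h : FCore q a b c d l m) :
    h.lift hq hq1 (FRSL2.gδ q) = d := by simp [FRSL2.gδ, FCore.lift_proj, genMap]
theorem FCore.lift_lam (hq : 0 < q) (hq1 : q < 1) (h : FCore q a b c d l m) (f : Mer) :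
    h.lift hq hq1 (FRSL2.lam q f) = l f := by
  change h.lift hq hq1 (FRSL2.proj q _) = _
  simp [FCore.lift_proj, genMap]
theorem FCore.lift_mu (hq : 0 < q) (hq1 : q < 1) (h : FCore q a b c d l m) (f : Mer) :
    h.lift hq hq1 (FRSL2.mu q f) = m f := by
  change h.lift hq hq1 (FRSL2.proj q _) = _
  simp [FCore.lift_proj, genMap]

/-- `F_R(SL(2))` itself, and hence any image of it, satisfies the short system. -/
theorem FRSL2.core (hq : 0 < q) (hq1 : q < 1) (π : FRSL2 q →ₐ[ℂ] R) :
    FCore q (π (FRSL2.gα q)) (π (FRSL2.gβ q)) (π (FRSL2.gγ q)) (π (FRSL2.gδ q))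
      (π.comp (FRSL2.lam q)) (π.comp (FRSL2.mu q)) := by
  set a := π (FRSL2.gα q) with ha
  set b := π (FRSL2.gβ q) with hb
  set c := π (FRSL2.gγ q) with hc
  set d := π (FRSL2.gδ q) with hd
  set l := π.comp (FRSL2.lam q) with hl
  set m := π.comp (FRSL2.mu q) with hm
  have hrel : ∀ {x y}, FRel q x y → FreeAlgebra.lift ℂ (genMap a b c d l m) x =
      FreeAlgebra.lift ℂ (genMap a b c d l m) y := by
    intro x y hxy
    have : FreeAlgebra.lift ℂ (genMap a b c d l m) = π.comp (FRSL2.proj q) := by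
      apply FreeAlgebra.hom_ext
      funext g
      cases g <;> simp [genMap] <;> rfl
    rw [this]
    exact congrArg π (FRSL2.proj_rel hxy)
  have hT : ∀ l : Mer →ₐ[ℂ] R, l (Mer.T (-1) (dynK q)) = (q : ℂ) • l (Mer.T (-1) (dynF q)) := by
    intro l; rw [dynK, map_mul, AlgHom.commutes, map_qc_mul]
  have hK : ∀ l : Mer →ₐ[ℂ] R, l (dynK q) = (q : ℂ) • l (dynF q) := fun l => map_qc_mul l _
  have hlm : ∀ f g, l f * m g = m g * l f := fun f g => by
    simpa [genMap] using hrel (FRel.lam_mu f g)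
  have had : a * d = 1 + l (dynK q) * (c * b) := by
    have := hrel FRel.det
    rw [hK, smul_mul_assoc]
    simp only [map_sub, map_mul, map_smul, FreeAlgebra.lift_ι_apply, genMap, map_one,
      mul_assoc] at this
    rw [← this]; abel
  have c1 := hrel FRel.cross₁
  have c4 := hrel FRel.cross₄
  have hHI : FreeAlgebra.lift ℂ (genMap a b c d l m) (dynH q FGen.l FGen.m) = dynH q l m ∧
      FreeAlgebra.lift ℂ (genMap a b c d l m) (dynI q FGen.l FGen.m) = dynI q l m := by
    constructor
    · simp [dynH, genMap]
    · simp [dynI, genMap]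
  simp only [map_sub, map_mul, hHI, FreeAlgebra.lift_ι_apply, genMap] at c1 c4
  rw [dynH_eq hq hq1] at c1
  rw [dynI_eq hq hq1, map_dynG hq hq1] at c4
  refine ⟨hlm, ?_, ?_, ?_, ?_, ?_, ?_, ?_, ?_, ?_, ?_, ?_, ?_, had, ?_, ?_⟩
  · intro f; simpa [genMap] using hrel (FRel.lam_α f)
  · intro f; simpa [genMap] using hrel (FRel.mu_α f)
  · intro f; simpa [genMap] using hrel (FRel.lam_β f)
  · intro f; simpa [genMap] using hrel (FRel.mu_β f)
  · intro f; simpa [genMap] using hrel (FRel.lam_γ f)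
  · intro f; simpa [genMap] using hrel (FRel.mu_γ f)
  · intro f; simpa [genMap] using hrel (FRel.lam_δ f)
  · intro f; simpa [genMap] using hrel (FRel.mu_δ f)
  · simpa [genMap, hT, mul_assoc, -Complex.coe_smul] using hrel FRel.αβ
  · simpa [genMap, hK, mul_assoc, -Complex.coe_smul] using hrel FRel.αγ
  · simpa [genMap, hK, mul_assoc, -Complex.coe_smul] using hrel FRel.βδ
  · simpa [genMap, hT, mul_assoc, -Complex.coe_smul] using hrel FRel.γδ
  · rw [show d * a = a * d - (a * d - d * a) by abel, c1, had]
    simp only [sub_mul, add_mul, smul_mul_assoc, one_mul, mul_assoc]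
    module
  · have e : l (dynK q) * (c * b) = a * d - 1 := by rw [had]; abel
    rw [show b * c = (b * c - (((q : ℂ) + (q : ℂ)⁻¹) • l (dynK q) - l (dynK q) * l (dynK q)) * c * b)
      + (((q : ℂ) + (q : ℂ)⁻¹) • l (dynK q) - l (dynK q) * l (dynK q)) * c * b by abel, c4]
    simp only [sub_mul, add_mul, smul_mul_assoc, one_mul, mul_assoc, e, mul_sub, mul_one]
    module

end

/-! # Dynamical representations -/

/-- An `𝔥`-space for `𝔥 = ℂ`: a vector space over the field of meromorphic functions with a
diagonalizable `Mer`-linear action of `𝔥` (given by the action `wt` of `1 ∈ 𝔥`), whose weights lie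
in `𝔥* = ℂ`. -/
class DynSpace (V : Type*) [AddCommGroup V] [Module ℂ V] [Module Mer V] [IsScalarTower ℂ Mer V] where
  wt : Module.End Mer V
  diag : ⨆ c : ℂ, Module.End.eigenspace wt (algebraMap ℂ Mer c) = ⊤

section DynSpace

variable (V : Type*) [AddCommGroup V] [Module ℂ V] [Module Mer V] [IsScalarTower ℂ Mer V]
  [DynSpace V]

/-- The weight space `V_c`. -/
def wtSpace (c : ℂ) : Submodule Mer V :=
  Module.End.eigenspace (DynSpace.wt : Module.End Mer V) (algebraMap ℂ Mer c)

/-- The homogeneous component `(D_{𝔥,V})_{ab}`: operators `U` with `U(g v) = T_{-b}(g) U(v)` and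
`U(V_c) ⊆ V_{c+b-a}`. -/
def DOp (a b : ℂ) : Submodule ℂ (Module.End ℂ V) where
  carrier := {U | (∀ (g : Mer) (v : V), U (g • v) = Mer.T (-b) g • U v) ∧
    ∀ (c : ℂ) (v : V), v ∈ wtSpace V c → U v ∈ wtSpace V (c + b - a)}
  add_mem' := by
    rintro U U' ⟨h1, h2⟩ ⟨h3, h4⟩
    refine ⟨fun g v => ?_, fun c v hv => ?_⟩
    · rw [LinearMap.add_apply, h1, h3, LinearMap.add_apply, smul_add]
    · exact add_mem (h2 c v hv) (h4 c v hv)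
  zero_mem' := ⟨fun g v => by simp, fun c v _ => by simp⟩
  smul_mem' := by
    rintro z U ⟨h1, h2⟩
    refine ⟨fun g v => ?_, fun c v hv => ?_⟩
    · rw [LinearMap.smul_apply, h1, LinearMap.smul_apply, smul_comm]
    · rw [LinearMap.smul_apply, ← IsScalarTower.algebraMap_smul Mer]
      exact Submodule.smul_mem _ _ (h2 c v hv)

variable {V}

theorem mem_wtSpace {c : ℂ} {v : V} :
    v ∈ wtSpace V c ↔ (DynSpace.wt : Module.End Mer V) v = c • v := by
  rw [wtSpace, Module.End.mem_eigenspace_iff, IsScalarTower.algebraMap_smul]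

theorem DynSpace.induction {P : V → Prop} (h0 : P 0) (hadd : ∀ v w, P v → P w → P (v + w))
    (hom : ∀ c, ∀ v ∈ wtSpace V c, P v) (v : V) : P v := by
  have hv : v ∈ ⨆ c : ℂ, Module.End.eigenspace (DynSpace.wt : Module.End Mer V)
      (algebraMap ℂ Mer c) := by rw [DynSpace.diag]; trivial
  exact Submodule.iSup_induction _ (motive := P) hv hom h0 hadd

/-- The homogeneous vectors on which `L` is multiplication by `T_{-c} f`. -/
def lamSub (L : V →ₗ[Mer] V) (f : Mer) (c : ℂ) : Submodule Mer V :=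
  wtSpace V c ⊓ LinearMap.ker (L - Mer.T (-c) f • LinearMap.id)

theorem mem_lamSub {L : V →ₗ[Mer] V} {f : Mer} {c : ℂ} {v : V} (h1 : v ∈ wtSpace V c)
    (h2 : L v = Mer.T (-c) f • v) : v ∈ lamSub L f c :=
  ⟨h1, by simp [h2]⟩

theorem lam_of_iSup {L : V →ₗ[Mer] V} {f : Mer} (h : ∀ v, v ∈ ⨆ c, lamSub L f c) (c : ℂ) (v : V)
    (hv : v ∈ wtSpace V c) : L v = Mer.T (-c) f • v := by
  have hind : iSupIndep (wtSpace V) :=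
    (Module.End.eigenspaces_iSupIndep (DynSpace.wt : Module.End Mer V)).comp
      (algebraMap ℂ Mer).injective
  have h1 := h v
  rw [iSup_split_single _ c, Submodule.mem_sup] at h1
  obtain ⟨y, hy, z, hz, hyz⟩ := h1
  have hz1 : z ∈ wtSpace V c := by
    rw [← hyz] at hv
    exact (Submodule.add_mem_iff_right _ hy.1).1 hv
  have hle : (⨆ (j) (_ : j ≠ c), lamSub L f j) ≤ ⨆ (j) (_ : j ≠ c), wtSpace V j :=
    iSup₂_mono fun j _ => inf_le_left
  have hz2 := hle hz
  have hz0 : z = 0 := by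
    have := (disjoint_iff.1 (hind c)).le ⟨hz1, hz2⟩
    simpa using this
  rw [← hyz, hz0, add_zero]
  have := LinearMap.mem_ker.1 hy.2
  rw [LinearMap.sub_apply, sub_eq_zero] at this
  exact this

end DynSpace

/-- A dynamical representation of `F_R(SL(2))` on `V`: an algebra homomorphism to `D_{𝔥,V}` that
preserves the moment maps `μ_l(f) v = T_{-c}(f) v` for `v ∈ V_c`, `μ_r(f) v = f v`, and the
bigrading; the bigrading of `F_R(SL(2))` is the one with `α`, `β`, `γ`, `δ` in degrees
`(1,1)`, `(1,-1)`, `(-1,1)`, `(-1,-1)` and the functions in degree `(0,0)`. -/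
structure DynRep (q : ℝ) (V : Type*) [AddCommGroup V] [Module ℂ V] [Module Mer V]
    [IsScalarTower ℂ Mer V] [DynSpace V] where
  hom : FRSL2 q →ₐ[ℂ] Module.End ℂ V
  lam_apply : ∀ (f : Mer) (c : ℂ) (v : V), v ∈ wtSpace V c →
    hom (FRSL2.lam q f) v = Mer.T (-c) f • v
  mu_apply : ∀ (f : Mer) (v : V), hom (FRSL2.mu q f) v = f • v
  α_mem : hom (FRSL2.gα q) ∈ DOp V 1 1
  β_mem : hom (FRSL2.gβ q) ∈ DOp V 1 (-1)
  γ_mem : hom (FRSL2.gγ q) ∈ DOp V (-1) 1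
  δ_mem : hom (FRSL2.gδ q) ∈ DOp V (-1) (-1)

section

variable {q : ℝ}
  {V : Type*} [AddCommGroup V] [Module ℂ V] [Module Mer V] [IsScalarTower ℂ Mer V] [DynSpace V]
  {W : Type*} [AddCommGroup W] [Module ℂ W] [Module Mer W] [IsScalarTower ℂ Mer W] [DynSpace W]

/-- An intertwiner: a morphism of `𝔥`-spaces (`Mer`-linear and grade-preserving) that commutes with
the action of `F_R(SL(2))`. -/
def IsIntertwiner (π : DynRep q V) (π' : DynRep q W) (φ : V →ₗ[Mer] W) : Prop :=
  (∀ (c : ℂ) (v : V), v ∈ wtSpace V c → φ v ∈ wtSpace W c) ∧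
  ∀ (x : FRSL2 q) (v : V), φ (π.hom x v) = π'.hom x (φ v)

/-! ### Pointwise form of the relations -/

/-- `q⁻¹ / F(λ-1)`. -/
def dynK' (q : ℝ) : Mer := qc q + (qc q)⁻¹ - dynK q

namespace DynRep

variable (π : DynRep q V)

/-- The operators of `α`, `β`, `γ`, `δ`, `f(λ)`. -/
abbrev a : Module.End ℂ V := π.hom (FRSL2.gα q)
abbrev b : Module.End ℂ V := π.hom (FRSL2.gβ q)
abbrev c : Module.End ℂ V := π.hom (FRSL2.gγ q)
abbrev d : Module.End ℂ V := π.hom (FRSL2.gδ q)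
abbrev l (f : Mer) : Module.End ℂ V := π.hom (FRSL2.lam q f)

theorem l_smul (f g : Mer) (v : V) : π.l f (g • v) = g • π.l f v := by
  induction v using DynSpace.induction with
  | h0 => simp
  | hadd v w hv hw => rw [smul_add, map_add, hv, hw, map_add, smul_add]
  | hom c v hv =>
    rw [π.lam_apply f c v hv, π.lam_apply f c _ (Submodule.smul_mem _ g hv), smul_comm]

theorem l_mem (f : Mer) : π.l f ∈ DOp V 0 0 := by
  refine ⟨fun g v => by rw [π.l_smul, neg_zero, Mer.T_zero], fun c v hv => ?_⟩
  rw [π.lam_apply f c v hv, add_zero, sub_zero]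
  exact Submodule.smul_mem _ _ hv

theorem s_smul (f : Mer) (v : V) :
    (((q : ℂ) + (q : ℂ)⁻¹) • (1 : Module.End ℂ V) - π.hom (FRSL2.mu q f)) v =
      (qc q + (qc q)⁻¹ - f) • v := by
  rw [LinearMap.sub_apply, π.mu_apply, sub_smul, ← map_inv₀, ← map_add,
    IsScalarTower.algebraMap_smul]
  rfl

theorem s_l (f : Mer) :
    ((q : ℂ) + (q : ℂ)⁻¹) • (1 : Module.End ℂ V) - π.l f = π.l (qc q + (qc q)⁻¹ - f) := by
  change _ = π.hom (FRSL2.lam q (qc q + (qc q)⁻¹ - f))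
  rw [map_sub, map_sub, ← map_inv₀, ← map_add, AlgHom.commutes, AlgHom.commutes,
    Algebra.algebraMap_eq_smul_one]

theorem p_ab (hq : 0 < q) (hq1 : q < 1) (v : V) : π.a (π.b v) = Mer.T (-1) (dynK q) • π.b (π.a v) := by
  have := congrArg (· v) (FRSL2.core hq hq1 π.hom).ab
  exact this.trans (π.mu_apply _ _)

theorem p_cd (hq : 0 < q) (hq1 : q < 1) (v : V) : π.c (π.d v) = Mer.T (-1) (dynK q) • π.d (π.c v) := by
  have := congrArg (· v) (FRSL2.core hq hq1 π.hom).cd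
  exact this.trans (π.mu_apply _ _)

theorem p_ac (hq : 0 < q) (hq1 : q < 1) (v : V) : π.a (π.c v) = π.l (dynK q) (π.c (π.a v)) :=
  congrArg (· v) (FRSL2.core hq hq1 π.hom).ac

theorem p_bd (hq : 0 < q) (hq1 : q < 1) (v : V) : π.b (π.d v) = π.l (dynK q) (π.d (π.b v)) :=
  congrArg (· v) (FRSL2.core hq hq1 π.hom).bd

theorem p_ad (hq : 0 < q) (hq1 : q < 1) (v : V) : π.a (π.d v) = v + π.l (dynK q) (π.c (π.b v)) :=
  congrArg (· v) (FRSL2.core hq hq1 π.hom).ad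

theorem p_da (hq : 0 < q) (hq1 : q < 1) (v : V) : π.d (π.a v) = v + dynK' q • π.c (π.b v) := by
  have := congrArg (· v) (FRSL2.core hq hq1 π.hom).da
  refine this.trans ?_
  rw [dynK', ← π.s_smul]; rfl

theorem p_bc (hq : 0 < q) (hq1 : q < 1) (v : V) : π.b (π.c v) = dynK' q • π.a (π.d v) - π.l (dynK' q) v := by
  have := congrArg (· v) (FRSL2.core hq hq1 π.hom).bc
  refine this.trans ?_
  rw [dynK', ← π.s_smul, ← π.s_l]; rfl

theorem p_bc' (hq : 0 < q) (hq1 : q < 1) (v : V) : π.b (π.c v) = π.l (dynK q) (π.d (π.a v)) - dynK q • v := by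
  rw [π.p_bc hq hq1, π.p_ad hq hq1, π.p_da hq hq1, map_add, π.l_smul, smul_add, dynK',
    sub_smul _ (dynK q) v, ← π.s_l, LinearMap.sub_apply, ← map_inv₀, ← map_add,
    IsScalarTower.algebraMap_smul Mer _ v]
  simp only [LinearMap.smul_apply, Module.End.one_apply]
  abel

end DynRep

/-! ### The tensor product of `𝔥`-spaces -/

open TensorProduct

variable (V W) in
/-- The relations `f v ⊗ w = v ⊗ T_{-b}(f) w` for `w ∈ W_b`. The tensor product over `ℂ` is written
with its factors exchanged, so that the action of scalars on the factor `W` is the one of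
Mathlib. -/
def dynRel : Submodule Mer (W ⊗[ℂ] V) :=
  Submodule.span Mer {x | ∃ (f : Mer) (v : V) (b : ℂ) (w : W), w ∈ wtSpace W b ∧
    x = w ⊗ₜ[ℂ] (f • v) - (Mer.T (-b) f • w) ⊗ₜ[ℂ] v}

variable (V W) in
/-- The tensor product `V ⊗̄ W` of `𝔥`-spaces, with scalars `f (v ⊗ w) = v ⊗ f w`. -/
def DynTensor : Type _ := (W ⊗[ℂ] V) ⧸ dynRel V W

namespace DynTensor

instance : AddCommGroup (DynTensor V W) := inferInstanceAs (AddCommGroup ((W ⊗[ℂ] V) ⧸ dynRel V W))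
instance : Module Mer (DynTensor V W) := inferInstanceAs (Module Mer ((W ⊗[ℂ] V) ⧸ dynRel V W))
instance : Module ℂ (DynTensor V W) := inferInstanceAs (Module ℂ ((W ⊗[ℂ] V) ⧸ dynRel V W))
instance : IsScalarTower ℂ Mer (DynTensor V W) :=
  inferInstanceAs (IsScalarTower ℂ Mer ((W ⊗[ℂ] V) ⧸ dynRel V W))

variable (V W) in
/-- The quotient map. -/
def mkT : (W ⊗[ℂ] V) →ₗ[Mer] DynTensor V W := (dynRel V W).mkQ

theorem mkT_surjective : Function.Surjective (mkT V W) := Submodule.mkQ_surjective _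

/-- The pure tensor `v ⊗ w`. -/
def tm (v : V) (w : W) : DynTensor V W := mkT V W (w ⊗ₜ[ℂ] v)

theorem tm_add_left (v v' : V) (w : W) : tm (v + v') w = tm v w + tm v' w := by
  rw [tm, tmul_add, map_add]; rfl
theorem tm_add_right (v : V) (w w' : W) : tm v (w + w') = tm v w + tm v w' := by
  rw [tm, add_tmul, map_add]; rfl
theorem tm_neg_left (v : V) (w : W) : tm (-v) w = -tm v w := by
  rw [tm, tmul_neg, map_neg]; rfl
theorem tm_neg_right (v : V) (w : W) : tm v (-w) = -tm v w := by
  rw [tm, neg_tmul, map_neg]; rfl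
theorem tm_sub_left (v v' : V) (w : W) : tm (v - v') w = tm v w - tm v' w := by
  rw [tm, tmul_sub, map_sub]; rfl
theorem tm_sub_right (v : V) (w w' : W) : tm v (w - w') = tm v w - tm v w' := by
  rw [tm, sub_tmul, map_sub]; rfl
theorem tm_zero_left (w : W) : tm (0 : V) w = 0 := by rw [tm, tmul_zero, map_zero]
theorem tm_zero_right (v : V) : tm v (0 : W) = 0 := by rw [tm, zero_tmul, map_zero]

theorem tm_smul_right (f : Mer) (v : V) (w : W) : tm v (f • w) = f • tm v w := by
  rw [tm, tm, ← map_smul, smul_tmul']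

theorem tm_csmul_left (z : ℂ) (v : V) (w : W) : tm (z • v) w = z • tm v w := by
  rw [tm, tmul_smul]; exact ((mkT V W).restrictScalars ℂ).map_smul z _

theorem tm_smul_left (f : Mer) (v : V) (b : ℂ) (w : W) (hw : w ∈ wtSpace W b) :
    tm (f • v) w = Mer.T (-b) f • tm v w := by
  rw [← tm_smul_right, ← sub_eq_zero, tm, tm, ← map_sub]
  exact (Submodule.Quotient.mk_eq_zero _).2 (Submodule.subset_span ⟨f, v, b, w, hw, rfl⟩)

theorem induction {P : DynTensor V W → Prop} (h0 : P 0) (hadd : ∀ x y, P x → P y → P (x + y))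
    (htm : ∀ v w, P (tm v w)) (x : DynTensor V W) : P x := by
  obtain ⟨x, rfl⟩ := mkT_surjective x
  induction x using TensorProduct.induction_on with
  | zero => simpa using h0
  | tmul w v => exact htm v w
  | add x y hx hy => rw [map_add]; exact hadd _ _ hx hy

theorem ext_end {f g : Module.End ℂ (DynTensor V W)} (h : ∀ v w, f (tm v w) = g (tm v w)) :
    f = g := by
  refine LinearMap.ext fun x => ?_
  induction x using DynTensor.induction with
  | h0 => simp
  | hadd x y hx hy => rw [map_add, map_add, hx, hy]
  | htm v w => exact h v w

theorem lift_aux {X : Type*} [AddCommGroup X] [Module ℂ X] (L : (W ⊗[ℂ] V) →ₗ[ℂ] X)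
    (hL : ∀ (f : Mer) (v : V) (b : ℂ) (w : W), w ∈ wtSpace W b →
      L (w ⊗ₜ (f • v)) = L ((Mer.T (-b) f • w) ⊗ₜ v)) :
    (dynRel V W).restrictScalars ℂ ≤ LinearMap.ker L := by
  intro x hx
  have key : ∀ g : Mer, L (g • x) = 0 := by
    have hx' : x ∈ dynRel V W := hx
    unfold dynRel at hx'
    refine Submodule.span_induction (p := fun x _ => ∀ g : Mer, L (g • x) = 0)
      ?_ ?_ ?_ ?_ hx'
    · rintro _ ⟨f, v, b, w, hw, rfl⟩ g
      rw [smul_sub, smul_tmul', smul_tmul', map_sub, sub_eq_zero, smul_comm g,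
        hL f v b _ (Submodule.smul_mem _ g hw)]
    · intro g; simp
    · intro x y _ _ hx hy g; rw [smul_add, map_add, hx, hy, add_zero]
    · intro r x _ hx g; rw [smul_smul]; exact hx _
  simpa using key 1

/-- Linear maps out of `V ⊗̄ W`. -/
def liftT {X : Type*} [AddCommGroup X] [Module ℂ X] (L : (W ⊗[ℂ] V) →ₗ[ℂ] X)
    (hL : ∀ (f : Mer) (v : V) (b : ℂ) (w : W), w ∈ wtSpace W b →
      L (w ⊗ₜ (f • v)) = L ((Mer.T (-b) f • w) ⊗ₜ v)) : DynTensor V W →ₗ[ℂ] X :=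
  (Submodule.liftQ ((dynRel V W).restrictScalars ℂ) L (lift_aux L hL)).comp
    (Submodule.Quotient.restrictScalarsEquiv ℂ (dynRel V W)).symm.toLinearMap

theorem liftT_tm {X : Type*} [AddCommGroup X] [Module ℂ X] (L : (W ⊗[ℂ] V) →ₗ[ℂ] X) (hL)
    (v : V) (w : W) : liftT L hL (tm v w) = L (w ⊗ₜ v) := rfl

/-- The operator `U ⊗ U'` on `V ⊗̄ W` for `U ∈ (D_{𝔥,V})_{ab}` and `U' ∈ (D_{𝔥,W})_{bc}`. -/
def opT {a b c : ℂ} {U : Module.End ℂ V} {U' : Module.End ℂ W} (hU : U ∈ DOp V a b)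
    (hU' : U' ∈ DOp W b c) : Module.End ℂ (DynTensor V W) :=
  liftT (((mkT V W).restrictScalars ℂ).comp (TensorProduct.map U' U)) (by
    intro f v e w hw
    change tm (U (f • v)) (U' w) = tm (U v) (U' (Mer.T (-e) f • w))
    rw [hU.1, hU'.1, tm_smul_left _ _ _ _ (hU'.2 e w hw), tm_smul_right, Mer.T_T, Mer.T_T]
    congr 3; ring)

theorem opT_tm {a b c : ℂ} {U : Module.End ℂ V} {U' : Module.End ℂ W} (hU : U ∈ DOp V a b)
    (hU' : U' ∈ DOp W b c) (v : V) (w : W) : opT hU hU' (tm v w) = tm (U v) (U' w) := rfl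

variable (V W) in
/-- The action of `1 ∈ 𝔥`, `v ⊗ w ↦ h v ⊗ w + v ⊗ h w`. -/
def wtT : Module.End Mer (DynTensor V W) :=
  Submodule.mapQ (dynRel V W) (dynRel V W)
    (AlgebraTensorModule.map (DynSpace.wt : Module.End Mer W) (LinearMap.id : V →ₗ[ℂ] V) +
      AlgebraTensorModule.map (LinearMap.id : W →ₗ[Mer] W)
        ((DynSpace.wt : Module.End Mer V).restrictScalars ℂ)) (by
    rw [dynRel, Submodule.span_le]
    rintro _ ⟨f, v, b, w, hw, rfl⟩
    have hw' := mem_wtSpace.1 hw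
    have h1 : w ⊗ₜ[ℂ] (f • v) - (Mer.T (-b) f • w) ⊗ₜ[ℂ] v ∈ dynRel V W :=
      Submodule.subset_span ⟨f, v, b, w, hw, rfl⟩
    have h2 : w ⊗ₜ[ℂ] (f • (DynSpace.wt : Module.End Mer V) v) -
        (Mer.T (-b) f • w) ⊗ₜ[ℂ] ((DynSpace.wt : Module.End Mer V) v) ∈ dynRel V W :=
      Submodule.subset_span ⟨f, _, b, w, hw, rfl⟩
    have h3 := add_mem (Submodule.smul_mem _ (algebraMap ℂ Mer b) h1) h2
    rw [IsScalarTower.algebraMap_smul] at h3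
    change _ ∈ dynRel V W
    convert h3 using 1
    simp only [LinearMap.add_apply, map_sub, AlgebraTensorModule.map_tmul, LinearMap.id_apply,
      LinearMap.restrictScalars_apply, map_smul, hw', smul_sub]
    rw [smul_comm, ← smul_tmul' b w, ← smul_tmul' b (_ • w)]
    abel)

theorem wtT_tm (v : V) (w : W) : wtT V W (tm v w) =
    tm ((DynSpace.wt : Module.End Mer V) v) w + tm v ((DynSpace.wt : Module.End Mer W) w) := by
  rw [add_comm]; rfl

theorem wtT_tm_of_mem {v : V} {w : W} {c e : ℂ} (hv : v ∈ wtSpace V c) (hw : w ∈ wtSpace W e) :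
    wtT V W (tm v w) = (c + e) • tm v w := by
  rw [wtT_tm, mem_wtSpace.1 hv, mem_wtSpace.1 hw, tm_csmul_left, add_smul,
    ← IsScalarTower.algebraMap_smul Mer e w, tm_smul_right, IsScalarTower.algebraMap_smul]

/-- Induction on homogeneous pure tensors. -/
theorem induction' {P : DynTensor V W → Prop} (h0 : P 0) (hadd : ∀ x y, P x → P y → P (x + y))
    (htm : ∀ c e, ∀ v ∈ wtSpace V c, ∀ w ∈ wtSpace W e, P (tm v w)) (x : DynTensor V W) : P x := by
  induction x using DynTensor.induction with
  | h0 => exact h0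
  | hadd x y hx hy => exact hadd x y hx hy
  | htm v w =>
    induction v using DynSpace.induction with
    | h0 => rw [tm_zero_left]; exact h0
    | hadd v v' hv hv' => rw [tm_add_left]; exact hadd _ _ hv hv'
    | hom c v hv =>
      induction w using DynSpace.induction with
      | h0 => rw [tm_zero_right]; exact h0
      | hadd w w' hw hw' => rw [tm_add_right]; exact hadd _ _ hw hw'
      | hom e w hw => exact htm c e v hv w hw

instance : DynSpace (DynTensor V W) where
  wt := wtT V W
  diag := by
    refine eq_top_iff.2 fun x _ => ?_
    induction x using DynTensor.induction' with
    | h0 => exact zero_mem _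
    | hadd x y hx hy => exact add_mem (hx trivial) (hy trivial)
    | htm c e v hv w hw =>
      refine Submodule.mem_iSup_of_mem (c + e) ?_
      rw [Module.End.mem_eigenspace_iff, IsScalarTower.algebraMap_smul]
      exact wtT_tm_of_mem hv hw

theorem tm_mem {v : V} {w : W} {c e : ℂ} (hv : v ∈ wtSpace V c) (hw : w ∈ wtSpace W e) :
    tm v w ∈ wtSpace (DynTensor V W) (c + e) :=
  mem_wtSpace.2 (wtT_tm_of_mem hv hw)

/-- A weight space of `V ⊗̄ W` is spanned by the homogeneous pure tensors of that weight. -/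
theorem mem_of_tm {U : Module.End ℂ (DynTensor V W)} {s : ℂ}
    (h : ∀ c e, ∀ v ∈ wtSpace V c, ∀ w ∈ wtSpace W e,
      U (tm v w) ∈ wtSpace (DynTensor V W) (c + e + s)) (c : ℂ) (x : DynTensor V W)
    (hx : x ∈ wtSpace (DynTensor V W) c) : U x ∈ wtSpace (DynTensor V W) (c + s) := by
  have key : ∀ x : DynTensor V W, wtT V W (U x) = U (wtT V W x) + s • U x := by
    intro x
    induction x using DynTensor.induction' with
    | h0 => simp
    | hadd x y hx hy => rw [map_add, map_add, hx, hy, map_add, map_add, smul_add]; abel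
    | htm c e v hv w hw =>
      rw [wtT_tm_of_mem hv hw, map_smul, ← add_smul]
      exact mem_wtSpace.1 (h c e v hv w hw)
  refine mem_wtSpace.2 ?_
  have h1 : wtT V W x = c • x := mem_wtSpace.1 hx
  change wtT V W (U x) = _
  rw [key, h1, map_smul, add_smul]

theorem opT_mem {a b c : ℂ} {U : Module.End ℂ V} {U' : Module.End ℂ W} (hU : U ∈ DOp V a b)
    (hU' : U' ∈ DOp W b c) : opT hU hU' ∈ DOp (DynTensor V W) a c := by
  constructor
  · intro g x
    induction x using DynTensor.induction with
    | h0 => simp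
    | hadd x y hx hy => rw [smul_add, map_add, hx, hy, map_add, smul_add]
    | htm v w => rw [← tm_smul_right, opT_tm, opT_tm, hU'.1, tm_smul_right]
  · intro e x hx
    rw [add_sub_assoc]
    refine mem_of_tm (fun s t v hv w hw => ?_) e x hx
    rw [opT_tm]
    convert tm_mem (hU.2 s v hv) (hU'.2 t w hw) using 2
    ring

/-! ### The tensor product of dynamical representations -/

variable (π : DynRep q V) (π' : DynRep q W)

/-- `f v ⊗ w = v ⊗ μ_l(f) w`. -/
theorem tm_mid (f : Mer) (v : V) (w : W) : tm (f • v) w = tm v (π'.l f w) := by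
  induction w using DynSpace.induction with
  | h0 => rw [map_zero, tm_zero_right, tm_zero_right]
  | hadd w w' hw hw' => rw [tm_add_right, hw, hw', map_add, tm_add_right]
  | hom c w hw => rw [tm_smul_left f v c w hw, π'.lam_apply f c w hw, tm_smul_right]

theorem one_mem_DOp : (1 : Module.End ℂ W) ∈ DOp W 0 0 :=
  ⟨fun g v => by simp, fun c v hv => by simpa using hv⟩

/-- The left moment map of the tensor product, `f(λ) ⊗ 1`. -/
def lT : Mer →ₐ[ℂ] Module.End ℂ (DynTensor V W) :=
  AlgHom.ofLinearMap
    { toFun := fun f => opT (π.l_mem f) (one_mem_DOp (W := W))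
      map_add' := fun f g => ext_end fun v w => by
        rw [LinearMap.add_apply, opT_tm, opT_tm, opT_tm, DynRep.l, map_add, map_add]
        exact tm_add_left _ _ _
      map_smul' := fun z f => ext_end fun v w => by
        rw [LinearMap.smul_apply, opT_tm, opT_tm, DynRep.l, map_smul, map_smul]
        exact tm_csmul_left _ _ _ }
    (ext_end fun v w => by
      change opT (π.l_mem 1) one_mem_DOp (tm v w) = tm v w
      rw [opT_tm, DynRep.l, map_one, map_one]; rfl)
    (fun f g => ext_end fun v w => by
      change opT (π.l_mem (f * g)) one_mem_DOp (tm v w) =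
        opT (π.l_mem f) one_mem_DOp (opT (π.l_mem g) one_mem_DOp (tm v w))
      rw [opT_tm, opT_tm, opT_tm, DynRep.l, map_mul, map_mul]; rfl)

theorem lT_tm (f : Mer) (v : V) (w : W) : lT (W := W) π f (tm v w) = tm (π.l f v) w := rfl

/-- The right moment map of the tensor product. -/
def mT : Mer →ₐ[ℂ] Module.End ℂ (DynTensor V W) := Algebra.lsmul ℂ ℂ (DynTensor V W)

theorem mT_apply (f : Mer) (x : DynTensor V W) : mT f x = f • x := rfl

/-- `Δ(α) = α ⊗ α + β ⊗ γ`. -/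
def aT : Module.End ℂ (DynTensor V W) := opT π.α_mem π'.α_mem + opT π.β_mem π'.γ_mem
/-- `Δ(β) = α ⊗ β + β ⊗ δ`. -/
def bT : Module.End ℂ (DynTensor V W) := opT π.α_mem π'.β_mem + opT π.β_mem π'.δ_mem
/-- `Δ(γ) = γ ⊗ α + δ ⊗ γ`. -/
def cT : Module.End ℂ (DynTensor V W) := opT π.γ_mem π'.α_mem + opT π.δ_mem π'.γ_mem
/-- `Δ(δ) = γ ⊗ β + δ ⊗ δ`. -/
def dT : Module.End ℂ (DynTensor V W) := opT π.γ_mem π'.β_mem + opT π.δ_mem π'.δ_mem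

theorem aT_tm (v : V) (w : W) :
    aT π π' (tm v w) = tm (π.a v) (π'.a w) + tm (π.b v) (π'.c w) := rfl
theorem bT_tm (v : V) (w : W) :
    bT π π' (tm v w) = tm (π.a v) (π'.b w) + tm (π.b v) (π'.d w) := rfl
theorem cT_tm (v : V) (w : W) :
    cT π π' (tm v w) = tm (π.c v) (π'.a w) + tm (π.d v) (π'.c w) := rfl
theorem dT_tm (v : V) (w : W) :
    dT π π' (tm v w) = tm (π.c v) (π'.b w) + tm (π.d v) (π'.d w) := rfl

theorem core (hq : 0 < q) (hq1 : q < 1) :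
    FCore q (aT π π') (bT π π') (cT π π') (dT π π') (lT π) mT := by
  have H := FRSL2.core hq hq1 π.hom
  have H' := FRSL2.core hq hq1 π'.hom
  have kk : dynK' q * Mer.T (-1) (dynK q) = 1 := dynK_mul hq hq1
  have kk' : Mer.T (-1) (dynK q) * dynK' q = 1 := by rw [mul_comm, kk]
  have cmp : ∀ {X Y Z Y' : Module.End ℂ V}, X * Y = Y' * Z → ∀ v, X (Y v) = Y' (Z v) :=
    fun h v => congrArg (· v) h
  have lsm : ∀ (g : Mer) (x : DynTensor V W),
      (((q : ℂ) + (q : ℂ)⁻¹) • (1 : Module.End ℂ (DynTensor V W)) - mT (V := V) (W := W) g) x =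
        (qc q + (qc q)⁻¹ - g) • x := by
    intro g x
    rw [LinearMap.sub_apply, mT_apply, sub_smul, ← map_inv₀, ← map_add,
      IsScalarTower.algebraMap_smul]
    rfl
  have lsl : ((q : ℂ) + (q : ℂ)⁻¹) • (1 : Module.End ℂ (DynTensor V W)) - lT π (dynK q) =
      lT π (dynK' q) := by
    rw [dynK', map_sub, ← map_inv₀, ← map_add, AlgHom.commutes, Algebra.algebraMap_eq_smul_one]
  have ll : ∀ w, π'.l (Mer.T (-1) (dynK q)) (π'.l (dynK' q) w) = w := by
    intro w
    rw [← Module.End.mul_apply, ← map_mul, ← map_mul, kk', map_one, map_one]; rfl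
  have key : ∀ w, π'.l (Mer.T (-1) (dynK q)) (π'.a (π'.d w)) + π'.c (π'.b w) =
        Mer.T (-1) (dynK q) • π'.l (Mer.T (-1) (dynK q)) (π'.b (π'.c w)) +
        Mer.T (-1) (dynK q) • π'.d (π'.a w) := by
    intro w
    rw [π'.p_bc hq hq1, π'.p_da hq hq1, map_sub, ll, π'.l_smul, smul_sub, smul_smul,
      kk', one_smul, smul_add, smul_smul, kk', one_smul]
    abel
  refine ⟨?_, ?_, ?_, ?_, ?_, ?_, ?_, ?_, ?_, ?_, ?_, ?_, ?_, ?_, ?_, ?_⟩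
  · intro f g
    refine ext_end fun v w => ?_
    simp only [Module.End.mul_apply, mT_apply, lT_tm, ← tm_smul_right]
  · intro f
    refine ext_end fun v w => ?_
    simp only [Module.End.mul_apply, lT_tm, aT_tm, map_add]
    rw [show π.l f (π.a v) = _ from congrArg (· v) (H.la f),
      show π.l f (π.b v) = _ from congrArg (· v) (H.lb f)]; rfl
  · intro f
    refine ext_end fun v w => ?_
    simp only [Module.End.mul_apply, mT_apply, aT_tm, smul_add, ← tm_smul_right]
    rw [π'.α_mem.1, π'.γ_mem.1]; simp
  · intro f
    refine ext_end fun v w => ?_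
    simp only [Module.End.mul_apply, lT_tm, bT_tm, map_add]
    rw [show π.l f (π.a v) = _ from congrArg (· v) (H.la f),
      show π.l f (π.b v) = _ from congrArg (· v) (H.lb f)]; rfl
  · intro f
    refine ext_end fun v w => ?_
    simp only [Module.End.mul_apply, mT_apply, bT_tm, smul_add, ← tm_smul_right]
    rw [π'.β_mem.1, π'.δ_mem.1]; simp
  · intro f
    refine ext_end fun v w => ?_
    simp only [Module.End.mul_apply, lT_tm, cT_tm, map_add]
    rw [show π.l f (π.c v) = _ from congrArg (· v) (H.lc f),
      show π.l f (π.d v) = _ from congrArg (· v) (H.ld f)]; rfl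
  · intro f
    refine ext_end fun v w => ?_
    simp only [Module.End.mul_apply, mT_apply, cT_tm, smul_add, ← tm_smul_right]
    rw [π'.α_mem.1, π'.γ_mem.1]; simp
  · intro f
    refine ext_end fun v w => ?_
    simp only [Module.End.mul_apply, lT_tm, dT_tm, map_add]
    rw [show π.l f (π.c v) = _ from congrArg (· v) (H.lc f),
      show π.l f (π.d v) = _ from congrArg (· v) (H.ld f)]; rfl
  · intro f
    refine ext_end fun v w => ?_
    simp only [Module.End.mul_apply, mT_apply, dT_tm, smul_add, ← tm_smul_right]
    rw [π'.β_mem.1, π'.δ_mem.1]; simp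

  · refine ext_end fun v w => ?_
    simp only [Module.End.mul_apply, mT_apply, aT_tm, bT_tm, map_add, smul_add]
    have key2 := congrArg (tm (π.b (π.a v))) (key w)
    simp only [tm_add_right, tm_smul_right] at key2
    simp only [π.p_ab hq hq1, π'.p_ab hq hq1, π'.p_cd hq hq1, tm_mid π', tm_smul_right]
    linear_combination (norm := module) key2
  · refine ext_end fun v w => ?_
    simp only [Module.End.mul_apply, aT_tm, cT_tm, map_add, lT_tm]
    simp only [π.p_ac hq hq1, π.p_bd hq hq1, π.p_ad hq hq1, π.p_bc' hq hq1, tm_add_left,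
      tm_sub_left, tm_mid π', π'.p_ac hq hq1]
    module
  · refine ext_end fun v w => ?_
    simp only [Module.End.mul_apply, bT_tm, dT_tm, map_add, lT_tm]
    simp only [π.p_ac hq hq1, π.p_bd hq hq1, π.p_ad hq hq1, π.p_bc' hq hq1, tm_add_left,
      tm_sub_left, tm_mid π', π'.p_bd hq hq1]
    module
  · refine ext_end fun v w => ?_
    simp only [Module.End.mul_apply, mT_apply, cT_tm, dT_tm, map_add, smul_add]
    have key2 := congrArg (tm (π.d (π.c v))) (key w)
    simp only [tm_add_right, tm_smul_right] at key2
    simp only [π.p_cd hq hq1, π'.p_ab hq hq1, π'.p_cd hq hq1, tm_mid π', tm_smul_right]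
    linear_combination (norm := module) key2
  · refine ext_end fun v w => ?_
    rw [LinearMap.add_apply]
    simp only [Module.End.mul_apply, Module.End.one_apply, aT_tm, bT_tm, cT_tm, dT_tm, map_add,
      lT_tm]
    simp only [π.p_ac hq hq1, π.p_bd hq hq1, π.p_ad hq hq1, π.p_bc' hq hq1, tm_add_left,
      tm_sub_left, tm_mid π', π'.p_ad hq hq1, tm_add_right]
    module
  · refine ext_end fun v w => ?_
    rw [LinearMap.add_apply, Module.End.mul_apply (_ - _), lsm]
    change _ = _ + dynK' q • _
    simp only [Module.End.mul_apply, Module.End.one_apply, aT_tm, bT_tm, cT_tm, dT_tm, map_add,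
      smul_add]
    have e1 := congrArg (tm · w) (π.p_da hq hq1 v)
    simp only [tm_add_left, tm_mid π'] at e1
    simp only [π'.p_ab hq hq1, π'.p_cd hq hq1, tm_smul_right, smul_smul, kk, one_smul,
      π'.p_bc hq hq1, π'.p_da hq hq1, tm_add_right, tm_sub_right]
    linear_combination (norm := module) e1
  · refine ext_end fun v w => ?_
    rw [lsl, LinearMap.sub_apply, Module.End.mul_apply (_ - _), lsm]
    change _ = dynK' q • _ - _
    simp only [Module.End.mul_apply, aT_tm, bT_tm, cT_tm, dT_tm, map_add, smul_add, lT_tm]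
    have e1 := congrArg (tm · w) (π.p_bc hq hq1 v)
    simp only [tm_sub_left, tm_mid π'] at e1
    simp only [π'.p_ab hq hq1, π'.p_cd hq hq1, tm_smul_right, smul_smul, kk, one_smul,
      π'.p_bc hq hq1, π'.p_da hq hq1, tm_add_right, tm_sub_right]
    linear_combination (norm := module) e1

end DynTensor

/-- The tensor product of two dynamical representations, obtained from the coproduct. -/
def DynRep.tensor (hq : 0 < q) (hq1 : q < 1) (π : DynRep q V) (π' : DynRep q W) :
    DynRep q (DynTensor V W) where
  hom := (DynTensor.core π π' hq hq1).lift hq hq1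
  lam_apply f c x hx := by
    rw [FCore.lift_lam]
    let L : DynTensor V W →ₗ[Mer] DynTensor V W :=
      { toFun := DynTensor.lT π f
        map_add' := map_add _
        map_smul' := fun g x => by
          have := (DynTensor.opT_mem (π.l_mem f) (DynTensor.one_mem_DOp (W := W))).1 g x
          rw [neg_zero, Mer.T_zero] at this
          exact this }
    refine lam_of_iSup (L := L) (fun x => ?_) c x hx
    induction x using DynTensor.induction' with
    | h0 => exact zero_mem _
    | hadd x y h1 h2 => exact add_mem h1 h2
    | htm c e v hv w hw =>
      refine Submodule.mem_iSup_of_mem (c + e) (mem_lamSub (DynTensor.tm_mem hv hw) ?_)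
      change DynTensor.lT π f (DynTensor.tm v w) = _
      rw [DynTensor.lT_tm, π.lam_apply f c v hv, DynTensor.tm_smul_left _ _ e w hw, Mer.T_T,
        neg_add_rev]
  mu_apply f x := by rw [FCore.lift_mu]; rfl
  α_mem := by
    rw [FCore.lift_α]; exact add_mem (DynTensor.opT_mem _ _) (DynTensor.opT_mem _ _)
  β_mem := by
    rw [FCore.lift_β]; exact add_mem (DynTensor.opT_mem _ _) (DynTensor.opT_mem _ _)
  γ_mem := by
    rw [FCore.lift_γ]; exact add_mem (DynTensor.opT_mem _ _) (DynTensor.opT_mem _ _)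
  δ_mem := by
    rw [FCore.lift_δ]; exact add_mem (DynTensor.opT_mem _ _) (DynTensor.opT_mem _ _)

end

/-! # The representations `π^ω` -/

/-- The underlying space of `H^ω`, with basis `e_k`, `k = 0, 1, 2, …` over the meromorphic
functions. -/
def HRep (_ω : ℂ) : Type := ℕ →₀ Mer

namespace HRep

variable {q : ℝ} {ω : ℂ}

instance : AddCommGroup (HRep ω) := inferInstanceAs (AddCommGroup (ℕ →₀ Mer))
instance : Module Mer (HRep ω) := inferInstanceAs (Module Mer (ℕ →₀ Mer))
instance : Module ℂ (HRep ω) := inferInstanceAs (Module ℂ (ℕ →₀ Mer))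
instance : IsScalarTower ℂ Mer (HRep ω) := inferInstanceAs (IsScalarTower ℂ Mer (ℕ →₀ Mer))

/-- `g e_k`. -/
def ge (ω : ℂ) (k : ℕ) (g : Mer) : HRep ω := (Finsupp.single k g : ℕ →₀ Mer)

/-- The basis vector `e_k`. -/
def e (ω : ℂ) (k : ℕ) : HRep ω := ge ω k 1

theorem ge_add (k : ℕ) (g h : Mer) : ge ω k (g + h) = ge ω k g + ge ω k h :=
  Finsupp.single_add k g h
theorem smul_ge (k : ℕ) (f g : Mer) : f • ge ω k g = ge ω k (f * g) :=
  Finsupp.smul_single' f k g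
theorem csmul_ge (k : ℕ) (z : ℂ) (g : Mer) : z • ge ω k g = ge ω k (z • g) :=
  Finsupp.smul_single z k g
theorem ge_zero (k : ℕ) : ge ω k 0 = 0 := Finsupp.single_zero k

theorem induction {P : HRep ω → Prop} (h0 : P 0) (hadd : ∀ x y, P x → P y → P (x + y))
    (hge : ∀ k g, P (ge ω k g)) (x : HRep ω) : P x :=
  Finsupp.induction_linear (motive := P) x h0 hadd hge

theorem ext_end {f g : Module.End ℂ (HRep ω)} (h : ∀ k r, f (ge ω k r) = g (ge ω k r)) :
    f = g := by
  refine LinearMap.ext fun x => ?_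
  induction x using HRep.induction with
  | h0 => simp
  | hadd x y hx hy => rw [map_add, map_add, hx, hy]
  | hge k g => exact h k g

/-- The operator `g e_k ↦ C_k (T_s g) e_{t k}`. -/
def op (ω : ℂ) (C : ℕ → Mer) (s : ℂ) (t : ℕ → ℕ) : Module.End ℂ (HRep ω) :=
  Finsupp.lsum ℂ (M := Mer) (N := HRep ω) fun k =>
    (Finsupp.lsingle (R := ℂ) (M := Mer) (t k) : Mer →ₗ[ℂ] (ℕ →₀ Mer)).comp
      ((LinearMap.mulLeft ℂ (C k)).comp (Mer.T s).toLinearMap)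

theorem op_ge (C : ℕ → Mer) (s : ℂ) (t : ℕ → ℕ) (k : ℕ) (g : Mer) :
    op ω C s t (ge ω k g) = ge ω (t k) (C k * Mer.T s g) := by
  refine (Finsupp.lsum_single ℂ _ _ _).trans ?_
  rfl

theorem op_smul (C : ℕ → Mer) (s : ℂ) (t : ℕ → ℕ) (f : Mer) (x : HRep ω) :
    op ω C s t (f • x) = Mer.T s f • op ω C s t x := by
  induction x using HRep.induction with
  | h0 => simp
  | hadd x y hx hy => rw [smul_add, map_add, hx, hy, map_add, smul_add]
  | hge k g =>
    rw [smul_ge, op_ge, op_ge, smul_ge, map_mul]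
    congr 1; ring

/-- The action of `1 ∈ 𝔥`: `e_k` has weight `ω + 2 k`. -/
def wtH (ω : ℂ) : Module.End Mer (HRep ω) :=
  { op ω (fun k => algebraMap ℂ Mer (ω + 2 * k)) 0 id with
    map_smul' := fun f x => by
      have := op_smul (ω := ω) (fun k => algebraMap ℂ Mer (ω + 2 * k)) 0 id f x
      rw [Mer.T_zero] at this
      exact this }

theorem wtH_ge (k : ℕ) (g : Mer) : wtH ω (ge ω k g) = (ω + 2 * k) • ge ω k g := by
  refine (op_ge (ω := ω) _ 0 id k g).trans ?_
  rw [Mer.T_zero, ← smul_ge, IsScalarTower.algebraMap_smul]; rfl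

instance : DynSpace (HRep ω) where
  wt := wtH ω
  diag := by
    refine eq_top_iff.2 fun x _ => ?_
    induction x using HRep.induction with
    | h0 => exact zero_mem _
    | hadd x y hx hy => exact add_mem (hx trivial) (hy trivial)
    | hge k g =>
      refine Submodule.mem_iSup_of_mem (ω + 2 * k) ?_
      rw [Module.End.mem_eigenspace_iff, IsScalarTower.algebraMap_smul]
      exact wtH_ge k g

theorem ge_mem (k : ℕ) (g : Mer) : ge ω k g ∈ wtSpace (HRep ω) (ω + 2 * k) :=
  mem_wtSpace.2 (wtH_ge k g)

theorem op_mem (C : ℕ → Mer) (s : ℂ) (t : ℕ → ℕ) (a b : ℂ) (hb : s = -b)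
    (ht : ∀ k, C k = 0 ∨ (2 * (t k) : ℂ) = 2 * k + b - a) : op ω C s t ∈ DOp (HRep ω) a b := by
  subst hb
  refine ⟨op_smul C _ t, fun c x hx => mem_wtSpace.2 ?_⟩
  have key : ∀ x : HRep ω, wtH ω (op ω C (-b) t x) =
      op ω C (-b) t (wtH ω x) + (b - a) • op ω C (-b) t x := by
    intro x
    induction x using HRep.induction with
    | h0 => simp
    | hadd x y hx hy => simp only [map_add, hx, hy, smul_add]; abel
    | hge k g =>
      rw [op_ge, wtH_ge, wtH_ge, map_smul, op_ge, ← add_smul]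
      rcases ht k with h | h
      · rw [h, zero_mul, ge_zero, smul_zero, smul_zero]
      · rw [h]; congr 1; ring
  have h1 : wtH ω x = c • x := mem_wtSpace.1 hx
  refine (key x).trans ?_
  rw [h1, map_smul, ← add_smul, add_sub_assoc]

open Mer in
/-- `A_k(λ) = q^(-k) (1 - q^(2(λ-ω-k+1))) / (1 - q^(2(λ-ω-2k+1)))`. -/
def cA (q : ℝ) (ω : ℂ) (k : ℕ) : Mer :=
  (qc q)⁻¹ ^ k * (1 - qexp q 2 (2 * (-ω - k + 1))) / (1 - qexp q 2 (2 * (-ω - 2 * k + 1)))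

open Mer in
/-- `B_k(λ) = (1 - q^(2k)) (1 - q^(2(ω+k-1))) / ((1 - q^(2(λ+1))) (1 - q^(2(ω+2k-λ-3))))`. -/
def cB (q : ℝ) (ω : ℂ) (k : ℕ) : Mer :=
  (1 - qc q ^ (2 * k)) * (1 - qexp q 0 (2 * (ω + k - 1))) /
    ((1 - qexp q 2 2) * (1 - qexp q (-2) (2 * (ω + 2 * k - 3))))

open Mer in
/-- `D_k(λ) = q^k (1 - q^(2(λ+1-k))) / (1 - q^(2(λ+1)))`. -/
def cD (q : ℝ) (k : ℕ) : Mer :=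
  qc q ^ k * (1 - qexp q 2 (2 * (1 - k))) / (1 - qexp q 2 2)

/-- `π^ω(α)`: `g e_k ↦ A_k (T_{-1} g) e_k`. -/
def opA (q : ℝ) (ω : ℂ) : Module.End ℂ (HRep ω) := op ω (cA q ω) (-1) id
/-- `π^ω(β)`: `g e_k ↦ B_k (T_1 g) e_{k-1}`, where `B_0 = 0`. -/
def opB (q : ℝ) (ω : ℂ) : Module.End ℂ (HRep ω) := op ω (cB q ω) 1 Nat.pred
/-- `π^ω(γ)`: `g e_k ↦ -q⁻¹ (T_{-1} g) e_{k+1}`. -/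
def opC (q : ℝ) (ω : ℂ) : Module.End ℂ (HRep ω) := op ω (fun _ => -(qc q)⁻¹) (-1) Nat.succ
/-- `π^ω(δ)`: `g e_k ↦ D_k (T_1 g) e_k`. -/
def opD (q : ℝ) (ω : ℂ) : Module.End ℂ (HRep ω) := op ω (cD q) 1 id

/-- `π^ω(μ_l(f))`: `g e_k ↦ (T_{-ω-2k} f) g e_k`. -/
def opL (ω : ℂ) : Mer →ₐ[ℂ] Module.End ℂ (HRep ω) :=
  AlgHom.ofLinearMap
    { toFun := fun f => op ω (fun k => Mer.T (-(ω + 2 * k)) f) 0 id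
      map_add' := fun f g => ext_end fun k r => by
        rw [LinearMap.add_apply, op_ge, op_ge, op_ge, map_add, add_mul, ge_add]
      map_smul' := fun z f => ext_end fun k r => by
        rw [LinearMap.smul_apply, op_ge, op_ge, map_smul, smul_mul_assoc, csmul_ge]; rfl }
    (ext_end fun k r => by
      change op ω (fun k => Mer.T (-(ω + 2 * k)) 1) 0 id (ge ω k r) = ge ω k r
      rw [op_ge, map_one, one_mul, Mer.T_zero]; rfl)
    (fun f g => ext_end fun k r => by
      change op ω (fun k => Mer.T (-(ω + 2 * k)) (f * g)) 0 id (ge ω k r) =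
        op ω _ 0 id (op ω _ 0 id (ge ω k r))
      rw [op_ge, op_ge, op_ge, map_mul, Mer.T_zero, Mer.T_zero, mul_assoc]; rfl)

/-- `π^ω(μ_r(f))`: `g e_k ↦ f g e_k`. -/
def opM (ω : ℂ) : Mer →ₐ[ℂ] Module.End ℂ (HRep ω) := Algebra.lsmul ℂ ℂ (HRep ω)

theorem opL_ge (f : Mer) (k : ℕ) (g : Mer) :
    opL ω f (ge ω k g) = ge ω k (Mer.T (-(ω + 2 * k)) f * g) := by
  refine (op_ge _ _ _ _ _).trans ?_
  rw [Mer.T_zero]; rfl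
theorem opM_ge (f : Mer) (k : ℕ) (g : Mer) : opM ω f (ge ω k g) = ge ω k (f * g) := smul_ge k f g
theorem opA_ge (k : ℕ) (g : Mer) : opA q ω (ge ω k g) = ge ω k (cA q ω k * Mer.T (-1) g) :=
  op_ge _ _ _ _ _
theorem opB_ge (k : ℕ) (g : Mer) :
    opB q ω (ge ω (k + 1) g) = ge ω k (cB q ω (k + 1) * Mer.T 1 g) := op_ge _ _ _ _ _
theorem cB_zero : cB q ω 0 = 0 := by simp [cB]
theorem opB_ge_zero (g : Mer) : opB q ω (ge ω 0 g) = 0 := by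
  rw [opB, op_ge, cB_zero, zero_mul, ge_zero]
theorem opC_ge (k : ℕ) (g : Mer) :
    opC q ω (ge ω k g) = ge ω (k + 1) (-(qc q)⁻¹ * Mer.T (-1) g) := op_ge _ _ _ _ _
theorem opD_ge (k : ℕ) (g : Mer) : opD q ω (ge ω k g) = ge ω k (cD q k * Mer.T 1 g) :=
  op_ge _ _ _ _ _

/-! ### Identities between the coefficients of the operators -/

section fieldid
variable {F : Type*} [Field F]
def fA (x u t Q : F) : F := t⁻¹ * (1 - x * Q ^ 2 / (u * t ^ 2)) / (1 - x * Q ^ 2 / (u * t ^ 4))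
def fD (x t Q : F) : F := t * (1 - x * Q ^ 2 / t ^ 2) / (1 - x * Q ^ 2)
def fB (x u t Q : F) : F := (1 - t ^ 2) * (1 - u * t ^ 2 / Q ^ 2) /
      ((1 - x * Q ^ 2) * (1 - u * t ^ 4 / (Q ^ 6 * x)))
def fK (x Q : F) : F := Q * ((x * Q ^ 2 - Q⁻¹ ^ 2) / (x * Q ^ 2 - 1))
variable {x u t Q : F}
theorem fA_eq (hu : u ≠ 0) (ht : t ≠ 0) {d : F} (hd : u * t ^ 4 - x * Q ^ 2 = d) :
    fA x u t Q = t * (u * t ^ 2 - x * Q ^ 2) / d := by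
  rw [fA, show 1 - x * Q ^ 2 / (u * t ^ 4) = d / (u * t ^ 4) by rw [← hd]; field_simp]
  field_simp
theorem fD_eq (ht : t ≠ 0) {d : F} (hd : 1 - x * Q ^ 2 = d) :
    fD x t Q = (t ^ 2 - x * Q ^ 2) / (t * d) := by
  rw [fD, hd]; field_simp
theorem fB_eq (hx : x ≠ 0) (hQ : Q ≠ 0) {d d' : F} (hd : 1 - x * Q ^ 2 = d)
    (hd' : x * Q ^ 6 - u * t ^ 4 = d') : fB x u t Q =
    (1 - t ^ 2) * (Q ^ 2 - u * t ^ 2) * x * Q ^ 4 / (d * d') := by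
  rw [fB, show 1 - u * t ^ 4 / (Q ^ 6 * x) = d' / (Q ^ 6 * x) by rw [← hd']; field_simp, hd]
  field_simp
theorem fK_eq (hQ : Q ≠ 0) {d : F} (hd : x * Q ^ 2 - 1 = d) :
    fK x Q = (x * Q ^ 4 - 1) / (Q * d) := by
  rw [fK, hd]; field_simp

/-- All denominators that occur are nonzero. -/
abbrev NonDeg (x u t Q : F) : Prop :=
  x ≠ 0 ∧ u ≠ 0 ∧ Q ≠ 0 ∧ t ≠ 0 ∧ 1 - x ≠ 0 ∧ 1 - x * Q ^ 2 ≠ 0 ∧ 1 - x * Q ^ 4 ≠ 0 ∧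
    u * t ^ 4 - x ≠ 0 ∧ u * t ^ 4 - x * Q ^ 2 ≠ 0 ∧ u * t ^ 4 - x * Q ^ 4 ≠ 0 ∧
    u * t ^ 4 * Q ^ 2 - x ≠ 0


theorem r_ab (h : NonDeg x u t Q) : fA x u t Q * fB (x / Q ^ 2) u (t * Q) Q =
    fK (x / Q ^ 2) Q * (fB x u (t * Q) Q * fA (x * Q ^ 2) u (t * Q) Q) := by
  obtain ⟨n0, n1, n2, n3, n4, n5, n6, n7, n8, n9, n10⟩ := h
  have m1 : x / Q ^ 2 ≠ 0 := div_ne_zero n0 (pow_ne_zero _ n2)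
  have m2 : t * Q ≠ 0 := mul_ne_zero n3 n2
  obtain ⟨d4, h4⟩ : ∃ d, 1 - x = d := ⟨_, rfl⟩
  obtain ⟨d5, h5⟩ : ∃ d, 1 - x * Q ^ 2 = d := ⟨_, rfl⟩
  obtain ⟨d7, h7⟩ : ∃ d, u * t ^ 4 - x = d := ⟨_, rfl⟩
  obtain ⟨d8, h8⟩ : ∃ d, u * t ^ 4 - x * Q ^ 2 = d := ⟨_, rfl⟩
  rw [h4] at n4; rw [h5] at n5; rw [h7] at n7; rw [h8] at n8
  rw [fA_eq n1 n3 h8, fA_eq (d := Q ^ 4 * d7) n1 m2 (by rw [← h7]; ring),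
    fB_eq (d := d4) (d' := - Q ^ 4 * d7) m1 n2 (by rw [← h4]; field_simp)
      (by rw [← h7]; field_simp; ring),
    fB_eq (d' := - Q ^ 4 * d8) n0 n2 h5 (by rw [← h8]; ring),
    fK_eq (d := -d4) n2 (by rw [← h4]; field_simp; ring)]
  field_simp
  rw [← h5]
  ring

theorem r_ac (h : NonDeg x u t Q) : fA x u (t * Q) Q = fK (x / (u * (t * Q) ^ 4)) Q * fA (x / Q ^ 2) u t Q := by
  obtain ⟨n0, n1, n2, n3, n4, n5, n6, n7, n8, n9, n10⟩ := h
  have m2 : t * Q ≠ 0 := mul_ne_zero n3 n2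
  obtain ⟨d7, h7⟩ : ∃ d, u * t ^ 4 - x = d := ⟨_, rfl⟩
  obtain ⟨d10, h10⟩ : ∃ d, u * t ^ 4 * Q ^ 2 - x = d := ⟨_, rfl⟩
  rw [h7] at n7; rw [h10] at n10
  rw [fA_eq (d := d7) n1 n3 (by rw [← h7]; field_simp),
    fA_eq (d := Q ^ 2 * d10) n1 m2 (by rw [← h10]; ring),
    fK_eq (d := -d10 / (u * t ^ 4 * Q ^ 2)) n2 (by rw [← h10]; field_simp; ring)]
  field_simp
  rw [← h7]
  ring

theorem r_bd (h : NonDeg x u t Q) : fB x u (t * Q) Q * fD (x * Q ^ 2) (t * Q) Q =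
    fK (x / (u * t ^ 4)) Q * (fD x t Q * fB (x * Q ^ 2) u (t * Q) Q) := by
  obtain ⟨n0, n1, n2, n3, n4, n5, n6, n7, n8, n9, n10⟩ := h
  have m1 : x * Q ^ 2 ≠ 0 := mul_ne_zero n0 (pow_ne_zero _ n2)
  have m2 : t * Q ≠ 0 := mul_ne_zero n3 n2
  obtain ⟨d5, h5⟩ : ∃ d, 1 - x * Q ^ 2 = d := ⟨_, rfl⟩
  obtain ⟨d6, h6⟩ : ∃ d, 1 - x * Q ^ 4 = d := ⟨_, rfl⟩
  obtain ⟨d8, h8⟩ : ∃ d, u * t ^ 4 - x * Q ^ 2 = d := ⟨_, rfl⟩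
  obtain ⟨d9, h9⟩ : ∃ d, u * t ^ 4 - x * Q ^ 4 = d := ⟨_, rfl⟩
  rw [h5] at n5; rw [h6] at n6; rw [h8] at n8; rw [h9] at n9
  rw [fD_eq n3 h5, fD_eq (d := d6) m2 (by rw [← h6]; ring),
    fB_eq (d' := - Q ^ 4 * d8) n0 n2 h5 (by rw [← h8]; ring),
    fB_eq (d := d6) (d' := - Q ^ 4 * d9) m1 n2 (by rw [← h6]; ring) (by rw [← h9]; ring),
    fK_eq (d := -d8 / (u * t ^ 4)) n2 (by rw [← h8]; field_simp; ring)]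
  field_simp
  rw [← h9]
  ring

theorem r_cd (h : NonDeg x u t Q) : fD (x / Q ^ 2) t Q = fK (x / Q ^ 2) Q * fD x (t * Q) Q := by
  obtain ⟨n0, n1, n2, n3, n4, n5, n6, n7, n8, n9, n10⟩ := h
  have m2 : t * Q ≠ 0 := mul_ne_zero n3 n2
  obtain ⟨d4, h4⟩ : ∃ d, 1 - x = d := ⟨_, rfl⟩
  obtain ⟨d5, h5⟩ : ∃ d, 1 - x * Q ^ 2 = d := ⟨_, rfl⟩
  rw [h4] at n4; rw [h5] at n5
  rw [fD_eq (d := d4) n3 (by rw [← h4]; field_simp), fD_eq m2 h5,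
    fK_eq (d := -d4) n2 (by rw [← h4]; field_simp; ring)]
  field_simp
  rw [← h5]
  ring

theorem r_ad (h : NonDeg x u t Q) : fA x u t Q * fD (x / Q ^ 2) t Q =
    1 - Q⁻¹ * fK (x / (u * t ^ 4)) Q * fB (x / Q ^ 2) u t Q := by
  obtain ⟨n0, n1, n2, n3, n4, n5, n6, n7, n8, n9, n10⟩ := h
  have m1 : x / Q ^ 2 ≠ 0 := div_ne_zero n0 (pow_ne_zero _ n2)
  obtain ⟨d4, h4⟩ : ∃ d, 1 - x = d := ⟨_, rfl⟩
  obtain ⟨d8, h8⟩ : ∃ d, u * t ^ 4 - x * Q ^ 2 = d := ⟨_, rfl⟩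
  obtain ⟨d9, h9⟩ : ∃ d, u * t ^ 4 - x * Q ^ 4 = d := ⟨_, rfl⟩
  rw [h4] at n4; rw [h8] at n8; rw [h9] at n9
  rw [fA_eq n1 n3 h8, fD_eq (d := d4) n3 (by rw [← h4]; field_simp),
    fB_eq (d := d4) (d' := - d9) m1 n2 (by rw [← h4]; field_simp)
      (by rw [← h9]; field_simp; ring),
    fK_eq (d := -d8 / (u * t ^ 4)) n2 (by rw [← h8]; field_simp; ring)]
  field_simp
  rw [← h8, ← h9, ← h4]
  ring

theorem r_da (h : NonDeg x u t Q) : fD x t Q * fA (x * Q ^ 2) u t Q =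
    1 - Q⁻¹ * (Q + Q⁻¹ - fK x Q) * fB (x / Q ^ 2) u t Q := by
  obtain ⟨n0, n1, n2, n3, n4, n5, n6, n7, n8, n9, n10⟩ := h
  have m1 : x / Q ^ 2 ≠ 0 := div_ne_zero n0 (pow_ne_zero _ n2)
  obtain ⟨d4, h4⟩ : ∃ d, 1 - x = d := ⟨_, rfl⟩
  obtain ⟨d5, h5⟩ : ∃ d, 1 - x * Q ^ 2 = d := ⟨_, rfl⟩
  obtain ⟨d9, h9⟩ : ∃ d, u * t ^ 4 - x * Q ^ 4 = d := ⟨_, rfl⟩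
  rw [h4] at n4; rw [h5] at n5; rw [h9] at n9
  rw [fA_eq (d := d9) n1 n3 (by rw [← h9]; ring), fD_eq n3 h5,
    fB_eq (d := d4) (d' := - d9) m1 n2 (by rw [← h4]; field_simp)
      (by rw [← h9]; field_simp; ring),
    fK_eq (d := -d5) n2 (by rw [← h5]; ring)]
  field_simp
  rw [← h5, ← h9, ← h4]
  ring

theorem r_bc (h : NonDeg x u t Q) : -Q⁻¹ * fB x u (t * Q) Q =
    (Q + Q⁻¹ - fK x Q) * (fA x u t Q * fD (x / Q ^ 2) t Q) -
      (Q + Q⁻¹ - fK (x / (u * t ^ 4)) Q) := by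
  obtain ⟨n0, n1, n2, n3, n4, n5, n6, n7, n8, n9, n10⟩ := h
  obtain ⟨d4, h4⟩ : ∃ d, 1 - x = d := ⟨_, rfl⟩
  obtain ⟨d5, h5⟩ : ∃ d, 1 - x * Q ^ 2 = d := ⟨_, rfl⟩
  obtain ⟨d8, h8⟩ : ∃ d, u * t ^ 4 - x * Q ^ 2 = d := ⟨_, rfl⟩
  rw [h4] at n4; rw [h5] at n5; rw [h8] at n8
  rw [fA_eq n1 n3 h8, fD_eq (d := d4) n3 (by rw [← h4]; field_simp),
    fB_eq (d' := - Q ^ 4 * d8) n0 n2 h5 (by rw [← h8]; ring),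
    fK_eq (d := -d5) n2 (by rw [← h5]; ring),
    fK_eq (d := -d8 / (u * t ^ 4)) n2 (by rw [← h8]; field_simp; ring)]
  field_simp
  rw [← h5, ← h8, ← h4]
  ring
end fieldid

/-! ### Verification of the relations -/

/-- `q^(2λ)`. -/
def xq (q : ℝ) : Mer := Mer.qexp q 2 0

/-- The constant `q^(2ω)`. -/
def uq (q : ℝ) (ω : ℂ) : Mer := algebraMap ℂ Mer ((q : ℂ) ^ (2 * ω))

theorem cpow_shift (hq : 0 < q) (n k : ℕ) (a b c d : ℤ) :
    algebraMap ℂ Mer ((q : ℂ) ^ (a * (2 * ω) + b * k + c + d * n)) =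
      uq q ω ^ a * (qc q ^ k) ^ b * qc q ^ c * (qc q ^ n) ^ d := by
  have h : (q : ℂ) ≠ 0 := by exact_mod_cast hq.ne'
  rw [Complex.cpow_add _ _ h, Complex.cpow_add _ _ h, Complex.cpow_add _ _ h,
    Complex.cpow_int_mul, Complex.cpow_int_mul, Complex.cpow_int_mul, Complex.cpow_natCast,
    Complex.cpow_natCast, Complex.cpow_intCast]
  simp [uq]

theorem qexp_two (hq : 0 < q) (k : ℕ) (a b c : ℤ) (z : ℂ) (hz : z = a * (2 * ω) + b * k + c) :
    Mer.qexp q 2 z = uq q ω ^ a * (qc q ^ k) ^ b * qc q ^ c * xq q := by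
  have := cpow_shift (ω := ω) hq 0 k a b c 0
  rw [Mer.qexp_split hq, hz, xq]
  simp only [Int.cast_zero, zero_mul, add_zero, zpow_zero, mul_one] at this
  rw [this]

theorem T_xq (hq : 0 < q) (k : ℕ) (a b c : ℤ) (z : ℂ) (hz : 2 * z = a * (2 * ω) + b * k + c) :
    Mer.T z (xq q) = uq q ω ^ a * (qc q ^ k) ^ b * qc q ^ c * xq q := by
  rw [xq, Mer.T_qexp, zero_add, qexp_two hq k a b c _ hz]; rfl

theorem xq_ne (hq : 0 < q) : xq q ≠ 0 := Mer.qexp_ne_zero hq _ _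

theorem uq_ne (hq : 0 < q) : uq q ω ≠ 0 := by
  rw [uq, ← Mer.qexp_zero_left]; exact Mer.qexp_ne_zero hq _ _

theorem cA_eq (hq : 0 < q) (k : ℕ) : cA q ω k =
    (qc q ^ k)⁻¹ * (1 - xq q * qc q ^ 2 / (uq q ω * (qc q ^ k) ^ 2)) /
      (1 - xq q * qc q ^ 2 / (uq q ω * (qc q ^ k) ^ 4)) := by
  rw [cA, qexp_two (ω := ω) hq k (-1) (-2) 2 (2 * (-ω - k + 1)) (by push_cast; ring),
    qexp_two (ω := ω) hq k (-1) (-4) 2 (2 * (-ω - 2 * k + 1)) (by push_cast; ring)]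
  have h1 := uq_ne (ω := ω) hq
  have h2 := qc_ne hq
  congr 2
  · rw [inv_pow]
  · field_simp
  · field_simp

theorem cD_eq (hq : 0 < q) (k : ℕ) : cD q k =
    qc q ^ k * (1 - xq q * qc q ^ 2 / (qc q ^ k) ^ 2) / (1 - xq q * qc q ^ 2) := by
  rw [cD, qexp_two (ω := 0) hq k 0 (-2) 2 (2 * (1 - k)) (by push_cast; ring),
    qexp_two (ω := 0) hq k 0 0 2 2 (by push_cast; ring)]
  have h2 := qc_ne hq
  congr 2
  · congr 1; field_simp
  · field_simp

theorem cB_eq (hq : 0 < q) (k : ℕ) : cB q ω k =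
    (1 - (qc q ^ k) ^ 2) * (1 - uq q ω * (qc q ^ k) ^ 2 / qc q ^ 2) /
      ((1 - xq q * qc q ^ 2) * (1 - uq q ω * (qc q ^ k) ^ 4 / (qc q ^ 6 * xq q))) := by
  have h1 : Mer.qexp q (-2) 0 = (xq q)⁻¹ := by
    apply eq_inv_of_mul_eq_one_left; rw [xq, Mer.qexp_mul hq]
    norm_num [Mer.qexp_zero_left]
  have h2 := cpow_shift (ω := ω) hq 0 k 1 4 (-6) 0
  have h3 := cpow_shift (ω := ω) hq 0 k 1 2 (-2) 0
  simp only [Int.cast_zero, zero_mul, add_zero, zpow_zero, mul_one] at h2 h3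
  rw [cB, Mer.qexp_split hq (-2), h1, Mer.qexp_zero_left,
    show (2 * (ω + 2 * k - 3)) = ((1 : ℤ) : ℂ) * (2 * ω) + ((4 : ℤ) : ℂ) * k + ((-6 : ℤ) : ℂ) by
      push_cast; ring,
    show (2 * (ω + k - 1)) = ((1 : ℤ) : ℂ) * (2 * ω) + ((2 : ℤ) : ℂ) * k + ((-2 : ℤ) : ℂ) by
      push_cast; ring, h2, h3, qexp_two (ω := 0) hq k 0 0 2 2 (by push_cast; ring)]
  have h4 := uq_ne (ω := ω) hq
  have h5 := qc_ne hq
  have h6 := xq_ne hq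
  congr 2
  · ring
  · field_simp
  · field_simp
  · field_simp

theorem dynK_xq (hq : 0 < q) : dynK q = qc q * ((xq q * qc q ^ 2 - (qc q)⁻¹ ^ 2) / (xq q * qc q ^ 2 - 1)) := by
  rw [dynK, dynF, qexp_two (ω := 0) hq 0 0 0 2 2 (by push_cast; ring)]
  congr 2 <;> simp [mul_comm]


theorem xq_ne_uq (hq : 0 < q) (hq1 : q < 1) (i j : ℤ) (k : ℕ) (a : ℤ) :
    xq q ≠ uq q ω ^ a * (qc q ^ k) ^ i * qc q ^ j := by
  have := cpow_shift (ω := ω) hq 0 k a i j 0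
  simp only [Int.cast_zero, zero_mul, add_zero, zpow_zero, mul_one] at this
  rw [← this]
  exact Mer.qexp_ne_const hq hq1 two_ne_zero _ _

theorem T_one_xq (hq : 0 < q) : Mer.T 1 (xq q) = xq q * qc q ^ 2 := by
  rw [T_xq (ω := 0) hq 0 0 0 2 1 (by push_cast; ring)]; simp [zpow_ofNat, mul_comm]

theorem T_neg_xq (hq : 0 < q) : Mer.T (-1) (xq q) = xq q / qc q ^ 2 := by
  have h2 := qc_ne hq
  rw [T_xq (ω := 0) hq 0 0 0 (-2) (-1) (by push_cast; ring)]; field_simp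

theorem T_wt_xq (hq : 0 < q) (k : ℕ) :
    Mer.T (-(ω + 2 * k)) (xq q) = xq q / (uq q ω * (qc q ^ k) ^ 4) := by
  have h2 := qc_ne hq
  have h1 := uq_ne (ω := ω) hq
  rw [T_xq (ω := ω) hq k (-1) (-4) 0 _ (by push_cast; ring)]; field_simp

theorem ne_aux (hq : 0 < q) (hq1 : q < 1) (k : ℕ) :
    NonDeg (xq q) (uq q ω) (qc q ^ k) (qc q) := by
  have h2 := qc_ne hq
  have h1 := uq_ne (ω := ω) hq
  have h3 := pow_ne_zero k h2
  refine ⟨xq_ne hq, h1, h2, h3, ?_, ?_, ?_, ?_, ?_, ?_, ?_⟩ <;> intro h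
  · refine xq_ne_uq (ω := ω) hq hq1 0 0 k 0 ?_; simp; linear_combination -h
  · refine xq_ne_uq (ω := ω) hq hq1 0 (-2) k 0 ?_; field_simp; linear_combination -h
  · refine xq_ne_uq (ω := ω) hq hq1 0 (-4) k 0 ?_; field_simp; linear_combination -h
  · refine xq_ne_uq (ω := ω) hq hq1 4 0 k 1 ?_; simp only [zpow_ofNat, zpow_zero, zpow_one]; linear_combination -h
  · refine xq_ne_uq (ω := ω) hq hq1 4 (-2) k 1 ?_; field_simp; linear_combination -h
  · refine xq_ne_uq (ω := ω) hq hq1 4 (-4) k 1 ?_; field_simp; linear_combination -h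
  · refine xq_ne_uq (ω := ω) hq hq1 4 2 k 1 ?_; simp only [zpow_ofNat, zpow_one]; linear_combination -h

theorem T_A (hq : 0 < q) (s : ℂ) (k : ℕ) :
    Mer.T s (cA q ω k) = fA (Mer.T s (xq q)) (uq q ω) (qc q ^ k) (qc q) := by
  rw [cA_eq hq, uq, fA]
  simp only [map_mul, map_div₀, map_sub, map_pow, map_inv₀, map_one, AlgHom.commutes]

theorem T_B (hq : 0 < q) (s : ℂ) (k : ℕ) :
    Mer.T s (cB q ω k) = fB (Mer.T s (xq q)) (uq q ω) (qc q ^ k) (qc q) := by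
  rw [cB_eq hq, uq, fB]
  simp only [map_mul, map_div₀, map_sub, map_pow, map_one, AlgHom.commutes]

theorem T_D (hq : 0 < q) (s : ℂ) (k : ℕ) :
    Mer.T s (cD q k) = fD (Mer.T s (xq q)) (qc q ^ k) (qc q) := by
  rw [cD_eq hq, fD]
  simp only [map_mul, map_div₀, map_sub, map_pow, map_one, AlgHom.commutes]

theorem T_K (hq : 0 < q) (s : ℂ) : Mer.T s (dynK q) = fK (Mer.T s (xq q)) (qc q) := by
  rw [dynK_xq hq, fK]
  simp only [map_mul, map_div₀, map_sub, map_pow, map_inv₀, map_one, AlgHom.commutes]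

theorem eA (hq : 0 < q) (k : ℕ) : cA q ω k = fA (xq q) (uq q ω) (qc q ^ k) (qc q) := cA_eq hq k
theorem eB (hq : 0 < q) (k : ℕ) : cB q ω k = fB (xq q) (uq q ω) (qc q ^ k) (qc q) := cB_eq hq k
theorem eD (hq : 0 < q) (k : ℕ) : cD q k = fD (xq q) (qc q ^ k) (qc q) := cD_eq hq k
theorem eK (hq : 0 < q) : dynK q = fK (xq q) (qc q) := dynK_xq hq

theorem core (hq : 0 < q) (hq1 : q < 1) (ω : ℂ) :
    FCore q (opA q ω) (opB q ω) (opC q ω) (opD q ω) (opL ω) (opM ω) := by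
  have h1m : ∀ f : Mer, Mer.T 1 (Mer.T (-1) f) = f := fun f => by rw [Mer.T_T]; norm_num
  have hm1 : ∀ f : Mer, Mer.T (-1) (Mer.T 1 f) = f := fun f => by rw [Mer.T_T]; norm_num
  have hm : ∀ f : Mer, ((((q : ℂ) + (q : ℂ)⁻¹) • (1 : Module.End ℂ (HRep ω)) - opM ω f)) =
      opM ω (qc q + (qc q)⁻¹ - f) := fun f => by
    rw [map_sub, ← map_inv₀, ← map_add, AlgHom.commutes, Algebra.algebraMap_eq_smul_one]
  have hl : ∀ f : Mer, ((((q : ℂ) + (q : ℂ)⁻¹) • (1 : Module.End ℂ (HRep ω)) - opL ω f)) =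
      opL ω (qc q + (qc q)⁻¹ - f) := fun f => by
    rw [map_sub, ← map_inv₀, ← map_add, AlgHom.commutes, Algebra.algebraMap_eq_smul_one]
  have hTq : ∀ s, Mer.T s (qc q) = qc q := fun s => AlgHom.commutes _ _
  refine ⟨?_, ?_, ?_, ?_, ?_, ?_, ?_, ?_, ?_, ?_, ?_, ?_, ?_, ?_, ?_, ?_⟩
  · intro f g
    refine ext_end fun k r => ?_
    simp only [Module.End.mul_apply, opL_ge, opM_ge]
    congr 1; ring
  · intro f
    refine ext_end fun k r => ?_
    simp only [Module.End.mul_apply, opL_ge, opA_ge, map_mul, Mer.T_T]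
    rw [show (-1 + (-(ω + 2 * k) + 1) : ℂ) = -(ω + 2 * k) by ring]
    congr 1; ring
  · intro f
    refine ext_end fun k r => ?_
    simp only [Module.End.mul_apply, opM_ge, opA_ge, map_mul, hm1]
    congr 1; ring
  · intro f
    refine ext_end fun k r => ?_
    rcases k with _ | k
    · simp only [Module.End.mul_apply, opL_ge, opB_ge_zero, map_zero]
    · simp only [Module.End.mul_apply, opL_ge, opB_ge, map_mul, Mer.T_T]
      rw [show (1 + (-(ω + 2 * (k + 1 : ℕ)) + 1) : ℂ) = -(ω + 2 * k) by push_cast; ring]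
      congr 1; ring
  · intro f
    refine ext_end fun k r => ?_
    rcases k with _ | k
    · simp only [Module.End.mul_apply, opM_ge, opB_ge_zero, map_zero]
    · simp only [Module.End.mul_apply, opM_ge, opB_ge, map_mul, h1m]
      congr 1; ring
  · intro f
    refine ext_end fun k r => ?_
    simp only [Module.End.mul_apply, opL_ge, opC_ge, map_mul, Mer.T_T]
    rw [show (-1 + (-(ω + 2 * k) + -1) : ℂ) = -(ω + 2 * (k + 1 : ℕ)) by push_cast; ring]
    congr 1; ring
  · intro f
    refine ext_end fun k r => ?_
    simp only [Module.End.mul_apply, opM_ge, opC_ge, map_mul, hm1]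
    congr 1; ring
  · intro f
    refine ext_end fun k r => ?_
    simp only [Module.End.mul_apply, opL_ge, opD_ge, map_mul, Mer.T_T]
    rw [show (1 + (-(ω + 2 * k) + -1) : ℂ) = -(ω + 2 * k) by ring]
    congr 1; ring
  · intro f
    refine ext_end fun k r => ?_
    simp only [Module.End.mul_apply, opM_ge, opD_ge, map_mul, h1m]
    congr 1; ring
  · refine ext_end fun k r => ?_
    rcases k with _ | k
    · simp only [Module.End.mul_apply, opA_ge, opB_ge_zero, opM_ge, map_zero]
    · simp only [Module.End.mul_apply, opA_ge, opB_ge, opM_ge, map_mul, h1m, hm1]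
      have := r_ab (ne_aux (ω := ω) hq hq1 k)
      simp only [T_A hq, T_B hq, T_D hq, T_K hq]
      simp only [eA hq, eB hq, eD hq, eK hq, T_wt_xq hq, T_one_xq hq, T_neg_xq hq, pow_succ _ k]
      congr 1
      linear_combination r * this
  · refine ext_end fun k r => ?_
    simp only [Module.End.mul_apply, opA_ge, opC_ge, opL_ge, map_mul, map_neg, map_inv₀, hTq]
    have := r_ac (ne_aux (ω := ω) hq hq1 k)
    simp only [T_A hq, T_B hq, T_D hq, T_K hq]
    simp only [eA hq, eB hq, eD hq, eK hq, T_wt_xq hq, T_one_xq hq, T_neg_xq hq, pow_succ _ k]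
    congr 1
    linear_combination (-(qc q)⁻¹ * Mer.T (-1) (Mer.T (-1) r)) * this
  · refine ext_end fun k r => ?_
    rcases k with _ | k
    · simp only [Module.End.mul_apply, opB_ge_zero, opD_ge, map_zero]
    · simp only [Module.End.mul_apply, opD_ge, opB_ge, opL_ge, map_mul]
      have := r_bd (ne_aux (ω := ω) hq hq1 k)
      simp only [T_A hq, T_B hq, T_D hq, T_K hq]
      simp only [eA hq, eB hq, eD hq, eK hq, T_wt_xq hq, T_one_xq hq, T_neg_xq hq, pow_succ _ k]
      congr 1
      linear_combination (Mer.T 1 (Mer.T 1 r)) * this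
  · refine ext_end fun k r => ?_
    simp only [Module.End.mul_apply, opD_ge, opC_ge, opM_ge, map_mul, map_neg, map_inv₀, hTq,
      h1m, hm1]
    have := r_cd (ne_aux (ω := ω) hq hq1 k)
    simp only [T_A hq, T_B hq, T_D hq, T_K hq]
    simp only [eA hq, eB hq, eD hq, eK hq, T_wt_xq hq, T_one_xq hq, T_neg_xq hq, pow_succ _ k]
    congr 1
    linear_combination (-(qc q)⁻¹ * r) * this
  · refine ext_end fun k r => ?_
    have := r_ad (ne_aux (ω := ω) hq hq1 k)
    rcases k with _ | k
    · simp only [Module.End.mul_apply, LinearMap.add_apply, Module.End.one_apply, opB_ge_zero,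
        map_zero, add_zero, opA_ge, opD_ge, map_mul, hm1]
      simp only [T_D hq, T_neg_xq hq, eA hq]
      simp only [fB, pow_zero, one_pow, sub_self, zero_mul, zero_div, mul_zero, sub_zero] at this
      congr 1
      simp only [pow_zero]
      linear_combination r * this
    · simp only [Module.End.mul_apply, LinearMap.add_apply, Module.End.one_apply, opA_ge, opB_ge,
        opC_ge, opL_ge, opD_ge, map_mul, map_neg, map_inv₀, hTq, hm1]
      simp only [T_A hq, T_B hq, T_D hq, T_K hq]
      simp only [eA hq, eB hq, eD hq, eK hq, T_wt_xq hq, T_one_xq hq, T_neg_xq hq, pow_succ _ k]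
      simp only [pow_succ _ k] at this
      rw [← ge_add]
      congr 1
      linear_combination r * this
  · rw [hm]
    refine ext_end fun k r => ?_
    have := r_da (ne_aux (ω := ω) hq hq1 k)
    rcases k with _ | k
    · simp only [Module.End.mul_apply, LinearMap.add_apply, Module.End.one_apply, opB_ge_zero,
        map_zero, add_zero, opA_ge, opD_ge, map_mul, h1m]
      simp only [T_A hq, T_one_xq hq, eD hq]
      simp only [fB, pow_zero, one_pow, sub_self, zero_mul, zero_div, mul_zero, sub_zero] at this
      congr 1
      simp only [pow_zero]
      linear_combination r * this
    · simp only [Module.End.mul_apply, LinearMap.add_apply, Module.End.one_apply, opA_ge, opB_ge,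
        opC_ge, opM_ge, opD_ge, map_mul, map_neg, map_inv₀, hTq, hm1, h1m]
      simp only [T_A hq, T_B hq, T_D hq, T_K hq]
      simp only [eA hq, eB hq, eD hq, eK hq, T_wt_xq hq, T_one_xq hq, T_neg_xq hq]
      rw [← ge_add]
      congr 1
      linear_combination r * this
  · rw [hm, hl]
    refine ext_end fun k r => ?_
    have := r_bc (ne_aux (ω := ω) hq hq1 k)
    have e2 : ∀ s, Mer.T s (dynK' q) = qc q + (qc q)⁻¹ - Mer.T s (dynK q) := fun s => by
      rw [dynK', map_sub, map_add, map_inv₀, hTq]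
    rw [show qc q + (qc q)⁻¹ - dynK q = dynK' q from rfl]
    simp only [Module.End.mul_apply, LinearMap.sub_apply, opA_ge, opB_ge, opL_ge,
      opC_ge, opM_ge, opD_ge, map_mul, map_neg, map_inv₀, hTq, hm1, h1m]
    rw [e2, dynK']
    simp only [T_A hq, T_B hq, T_D hq, T_K hq]
    simp only [eA hq, eB hq, eD hq, eK hq, T_wt_xq hq, T_one_xq hq, T_neg_xq hq, pow_succ _ k]
    have e1 : ∀ a b : Mer, ge ω k a - ge ω k b = ge ω k (a - b) := fun a b => by
      rw [eq_comm, eq_sub_iff_add_eq, ← ge_add, sub_add_cancel]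
    rw [e1]
    congr 1
    linear_combination r * this

end HRep

/-- The dynamical representation `π^ω` on `H^ω`. -/
def piRep {q : ℝ} (hq : 0 < q) (hq1 : q < 1) (ω : ℂ) : DynRep q (HRep ω) where
  hom := (HRep.core hq hq1 ω).lift hq hq1
  lam_apply f c v hv := by
    rw [FCore.lift_lam]
    let L : HRep ω →ₗ[Mer] HRep ω :=
      { toFun := HRep.opL ω f
        map_add' := map_add _
        map_smul' := fun g x => by
          have := HRep.op_smul (ω := ω) (fun k => Mer.T (-(ω + 2 * k)) f) 0 id g x
          rw [Mer.T_zero] at this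
          exact this }
    refine lam_of_iSup (L := L) (fun x => ?_) c v hv
    induction x using HRep.induction with
    | h0 => exact zero_mem _
    | hadd x y h1 h2 => exact add_mem h1 h2
    | hge k g =>
      refine Submodule.mem_iSup_of_mem (ω + 2 * k) (mem_lamSub (HRep.ge_mem k g) ?_)
      exact (HRep.opL_ge f k g).trans (HRep.smul_ge k _ g).symm
  mu_apply f v := by rw [FCore.lift_mu]; rfl
  α_mem := by
    rw [FCore.lift_α]
    exact HRep.op_mem _ _ _ _ _ rfl fun k => Or.inr (by simp)
  β_mem := by
    rw [FCore.lift_β]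
    refine HRep.op_mem _ _ _ _ _ (neg_neg 1).symm fun k => ?_
    rcases k with _ | k
    · exact Or.inl HRep.cB_zero
    · exact Or.inr (by simp; ring)
  γ_mem := by
    rw [FCore.lift_γ]
    exact HRep.op_mem _ _ _ _ _ rfl fun k => Or.inr (by simp; ring)
  δ_mem := by
    rw [FCore.lift_δ]
    exact HRep.op_mem _ _ _ _ _ (neg_neg 1).symm fun k => Or.inr (by simp)

/-! ### Direct sums -/

section

open DirectSum

variable {q : ℝ} {ι : Type*} [DecidableEq ι] {V : ι → Type*} [∀ i, AddCommGroup (V i)]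
  [∀ i, Module ℂ (V i)] [∀ i, Module Mer (V i)] [∀ i, IsScalarTower ℂ Mer (V i)]
  [∀ i, DynSpace (V i)]

instance DynSpace.instDirectSum : DynSpace (⨁ i, V i) where
  wt := DirectSum.lmap fun i => (DynSpace.wt : Module.End Mer (V i))
  diag := by
    refine eq_top_iff.2 fun x _ => ?_
    induction x using DirectSum.induction_on with
    | zero => exact zero_mem _
    | add x y hx hy => exact add_mem (hx trivial) (hy trivial)
    | of i v =>
      have key : ∀ v : V i, DirectSum.of V i v ∈ ⨆ c : ℂ, Module.End.eigenspace
          (DirectSum.lmap fun i => (DynSpace.wt : Module.End Mer (V i)))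
          (algebraMap ℂ Mer c) := by
        intro v
        induction v using DynSpace.induction with
        | h0 => rw [map_zero]; exact zero_mem _
        | hadd v w hv hw => rw [map_add]; exact add_mem hv hw
        | hom c v hv =>
          refine Submodule.mem_iSup_of_mem c ?_
          rw [Module.End.mem_eigenspace_iff, IsScalarTower.algebraMap_smul]
          have h := mem_wtSpace.1 hv
          change DirectSum.lmap _ (DirectSum.lof Mer ι V i v) = _
          rw [DirectSum.lmap_lof, h]
          exact (DirectSum.lof ℂ ι V i).map_smul c v
      exact key v

theorem mem_wtSpace_directSum {c : ℂ} {x : ⨁ i, V i} :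
    x ∈ wtSpace (⨁ i, V i) c ↔ ∀ i, x i ∈ wtSpace (V i) c := by
  simp only [mem_wtSpace]
  exact DFinsupp.ext_iff

theorem directSum_lmap_mem {a b : ℂ} {U : ∀ i, Module.End ℂ (V i)} (hU : ∀ i, U i ∈ DOp (V i) a b) :
    (DirectSum.lmap U : Module.End ℂ (⨁ i, V i)) ∈ DOp (⨁ i, V i) a b :=
  ⟨fun g x => DFinsupp.ext fun i => (hU i).1 g (x i), fun c _ hx =>
    mem_wtSpace_directSum.2 fun i => (hU i).2 c _ (mem_wtSpace_directSum.1 hx i)⟩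

/-- The direct sum of dynamical representations. -/
def DynRep.directSum (π : ∀ i, DynRep q (V i)) : DynRep q (⨁ i, V i) where
  hom := AlgHom.ofLinearMap
    { toFun := fun x => DirectSum.lmap fun i => (π i).hom x
      map_add' := fun x y => LinearMap.ext fun v => DFinsupp.ext fun i => by
        change (π i).hom (x + y) (v i) = (π i).hom x (v i) + (π i).hom y (v i)
        rw [map_add]; rfl
      map_smul' := fun z x => LinearMap.ext fun v => DFinsupp.ext fun i => by
        change (π i).hom (z • x) (v i) = z • (π i).hom x (v i)
        rw [map_smul]; rfl }
    (LinearMap.ext fun v => DFinsupp.ext fun i => by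
      change (π i).hom 1 (v i) = v i
      rw [map_one]; rfl)
    (fun x y => LinearMap.ext fun v => DFinsupp.ext fun i => by
      change (π i).hom (x * y) (v i) = (π i).hom x ((π i).hom y (v i))
      rw [map_mul]; rfl)
  lam_apply f c v hv := DFinsupp.ext fun i =>
    (π i).lam_apply f c (v i) (mem_wtSpace_directSum.1 hv i)
  mu_apply f v := DFinsupp.ext fun i => (π i).mu_apply f (v i)
  α_mem := directSum_lmap_mem fun i => (π i).α_mem
  β_mem := directSum_lmap_mem fun i => (π i).β_mem
  γ_mem := directSum_lmap_mem fun i => (π i).γ_mem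
  δ_mem := directSum_lmap_mem fun i => (π i).δ_mem

end

/-! # The `q`-Racah polynomials and the eigenvectors of `Ξ` -/

section

variable {F : Type*} [Field F]

/-- The shifted factorial `(a; q)_n = ∏_{j < n} (1 - a q^j)`. -/
def qPoch (a q : F) (n : ℕ) : F := ∏ j ∈ Finset.range n, (1 - a * q ^ j)

/-- The `q`-Racah polynomial `R_n(μ(x); a, b, c, d; q)`, that is, the terminating series
`₄φ₃(q^(-n), a b q^(n+1), q^(-x), c d q^(x+1); a q, b d q, c q; q, q)`, for `x` a natural number. -/
def qRacah (n x : ℕ) (a b c d q : F) : F :=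
  ∑ j ∈ Finset.range (n + 1),
    (qPoch (q⁻¹ ^ n) q j * qPoch (a * b * q ^ (n + 1)) q j * qPoch (q⁻¹ ^ x) q j *
        qPoch (c * d * q ^ (x + 1)) q j) /
      (qPoch q q j * qPoch (a * q) q j * qPoch (b * d * q) q j * qPoch (c * q) q j) * q ^ j

end

open Mer in
/-- The coefficient `v_k` of `e_{p-k} ⊗ e_k` in the vector `v(y; p)`, where `e = qexp q a b` stands
for the function `q^(aλ+b)`. -/
def eigCoeff (q : ℝ) (ω₁ ω₂ : ℂ) (y p k : ℕ) : Mer :=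
  (-1) ^ k * qexp q 0 (2 * k * (ω₁ + ω₂) + k * (3 * p - 1)) *
    (qPoch (qexp q (-2) 0) (qc q ^ 2) k *
        qPoch (qexp q 0 (-2 * (ω₁ + p - 1))) (qc q ^ 2) k *
        qPoch (qexp q 0 (-2 * p)) (qc q ^ 2) k) /
      (qPoch (qc q ^ 2) (qc q ^ 2) k * qPoch (qexp q 0 (2 * ω₂)) (qc q ^ 2) k *
        qPoch (qexp q (-2) (2 * (ω₁ + ω₂ + p - 1))) (qc q ^ 2) k) *
    qRacah k (p - y) (qexp q (-2) (-2)) (qexp q 0 (2 * (ω₂ - 1))) (qexp q 0 (-2 * (p + 1)))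
      (qexp q 0 (-2 * (ω₁ + ω₂ + p - 1))) (qc q ^ 2)

/-- The vector `v(y; p) = ∑_{k=0}^p v_k (e_{p-k} ⊗ e_k)` in `H^{ω₁} ⊗̄ H^{ω₂}`. -/
def eigVec (q : ℝ) (ω₁ ω₂ : ℂ) (y p : ℕ) : DynTensor (HRep ω₁) (HRep ω₂) :=
  ∑ k ∈ Finset.range (p + 1),
    eigCoeff q ω₁ ω₂ y p k • DynTensor.tm (HRep.e ω₁ (p - k)) (HRep.e ω₂ k)

open Mer in
/-- `φ_k(λ) = q^(s(k-λ)) (q^(2(λ+2-ω₁-ω₂-2s-k)); q²)_s`. -/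
def intCoeff (q : ℝ) (ω₁ ω₂ : ℂ) (s k : ℕ) : Mer :=
  qexp q (-s) (s * k) * qPoch (qexp q 2 (2 * (2 - ω₁ - ω₂ - 2 * s - k))) (qc q ^ 2) s

end

/-! # Intertwiners out of `H^ω` and the action of the Casimir element -/

section General

variable {q : ℝ}
  {V : Type*} [AddCommGroup V] [Module ℂ V] [Module Mer V] [IsScalarTower ℂ Mer V] [DynSpace V]
  {W : Type*} [AddCommGroup W] [Module ℂ W] [Module Mer W] [IsScalarTower ℂ Mer W] [DynSpace W]

/-! On vectors of weight `w` the first two terms of `Ξ` collapse to the constant `q^(1-w) +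
q^(w-1)`. Finding eigenvectors of `Ξ` with constant eigenvalue in a weight space therefore amounts
to finding eigenvectors of the `Mer`-linear operator `γβ` (`DynRep.Xi_eq_iff`).

The weight space of `H^{ω₁} ⊗̄ H^{ω₂}` of weight `ω₁+ω₂+2p` has basis `e_{p-k} ⊗ e_k`, and `γβ` is
tridiagonal there (`co_cb`). After multiplication by a common factor its diagonal entries are `A_k +
C_k`, and conjugation by the factors in front of the polynomials in `v_k` turns the other entries
into `-A_k` and `-C_k`. Here `A_k` and `C_k` are the coefficients of the three-term recurrence of
the `q`-Racah polynomials in base `q²`. Hence the eigenvector equation is that recurrence at `x = p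
- y` (`qRacah_rec`, `eigCoeff_rec`). The recurrence itself is proved by comparing coefficients in
the basis `(q^(-x), c d q^(x+1); q)_j`.

For the decomposition, `H^ω` has a universal property: a vector of weight `ω` killed by `β` and
fixed by `α` is the image of `e_0` under an intertwiner (`DynRep.exists_intertwiner`). A nonzero
such vector exists in each weight `ω₁+ω₂+2s`: `β v = 0` is a first-order recurrence for the
coordinates, and `α v = v` is then achieved by an explicit rescaling (`exists_lowest`). `Ξ` is a
scalar on each `H^{ω₁+ω₂+2s}`. The condition on `ω₁+ω₂` makes these scalars distinct
(`casEig_injective`) and keeps the images of all `e_k` nonzero. The images then lie in different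
joint eigenspaces of `Ξ` and the weight operator, so they are independent; weight `ω₁+ω₂+2p`
contains `p+1` of them, which is its dimension, so they form a basis.

For generic `ω₁`, `ω₂` the entries of `γβ` on one side of the diagonal do not vanish, so an
eigenvector is determined by its coordinate at `e_p ⊗ e_0` (`eq_zero_of_cb`). This coordinate is `1`
for `v(y;p)` and is computed recursively for `C e_k`, which identifies `C e_k` with the stated
multiple of `v(s;s+k)` (`IsIntertwiner.eq_smul_eigVec`). -/

theorem wtSpace_map {φ : V →ₗ[Mer] W}
    (h : ∀ v, (DynSpace.wt : Module.End Mer W) (φ v) = φ ((DynSpace.wt : Module.End Mer V) v))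
    (c : ℂ) (v : V) (hv : v ∈ wtSpace V c) : φ v ∈ wtSpace W c := by
  rw [mem_wtSpace] at hv ⊢
  rw [h, hv, ← IsScalarTower.algebraMap_smul Mer, map_smul, IsScalarTower.algebraMap_smul]

theorem wt_comm_of_wtSpace_map {φ : V →ₗ[Mer] W}
    (h : ∀ (c : ℂ) (v : V), v ∈ wtSpace V c → φ v ∈ wtSpace W c) (v : V) :
    (DynSpace.wt : Module.End Mer W) (φ v) = φ ((DynSpace.wt : Module.End Mer V) v) := by
  induction v using DynSpace.induction with
  | h0 => simp
  | hadd v w hv hw => simp only [map_add, hv, hw]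
  | hom c v hv =>
    rw [mem_wtSpace.1 hv, mem_wtSpace.1 (h c v hv), ← IsScalarTower.algebraMap_smul Mer c v,
      map_smul, IsScalarTower.algebraMap_smul]

/-- The weights determine the left moment map, since `f(λ)` is multiplication by `T_{-c} f` on
`V_c`. An intertwiner therefore needs to be tested on `α`, `β`, `γ`, `δ` only. -/
theorem lam_comm (π : DynRep q V) (π' : DynRep q W) {φ : V →ₗ[Mer] W}
    (h : ∀ (c : ℂ) (v : V), v ∈ wtSpace V c → φ v ∈ wtSpace W c) (f : Mer) (v : V) :
    φ (π.l f v) = π'.l f (φ v) := by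
  induction v using DynSpace.induction with
  | h0 => simp
  | hadd v w hv hw => simp only [map_add, hv, hw]
  | hom c v hv =>
    rw [π.lam_apply f c v hv, π'.lam_apply f c _ (h c v hv), map_smul]

theorem FRSL2.proj_surjective : Function.Surjective (FRSL2.proj q) :=
  RingQuot.mkAlgHom_surjective ℂ (FRel q)

/-- A morphism of `𝔥`-spaces that commutes with the generators is an intertwiner. -/
theorem isIntertwiner_of_generators (π : DynRep q V) (π' : DynRep q W) {φ : V →ₗ[Mer] W}
    (h : ∀ (c : ℂ) (v : V), v ∈ wtSpace V c → φ v ∈ wtSpace W c)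
    (ha : ∀ v, φ (π.a v) = π'.a (φ v)) (hb : ∀ v, φ (π.b v) = π'.b (φ v))
    (hc : ∀ v, φ (π.c v) = π'.c (φ v)) (hd : ∀ v, φ (π.d v) = π'.d (φ v)) :
    IsIntertwiner π π' φ := by
  refine ⟨h, fun x => ?_⟩
  obtain ⟨y, rfl⟩ := FRSL2.proj_surjective x
  induction y using FreeAlgebra.induction with
  | grade0 r =>
    intro v
    simp only [AlgHom.commutes, Module.algebraMap_end_apply]
    rw [← IsScalarTower.algebraMap_smul Mer, map_smul, IsScalarTower.algebraMap_smul]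
  | grade1 g =>
    intro v
    cases g with
    | α => exact ha v
    | β => exact hb v
    | γ => exact hc v
    | δ => exact hd v
    | lam f => exact lam_comm π π' h f v
    | mu f =>
      change φ (π.hom (FRSL2.mu q f) v) = π'.hom (FRSL2.mu q f) (φ v)
      rw [π.mu_apply, π'.mu_apply, map_smul]
  | mul x y hx hy =>
    intro v
    simp only [map_mul, Module.End.mul_apply, hx, hy]
  | add x y hx hy =>
    intro v
    simp only [map_add, LinearMap.add_apply, hx, hy]

/-! ### Semilinearity and weights of the generators, and the action of `Ξ` on a weight space -/

namespace DynRep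

variable (π : DynRep q V)

theorem a_smul (g : Mer) (v : V) : π.a (g • v) = Mer.T (-1) g • π.a v := π.α_mem.1 g v
theorem b_smul (g : Mer) (v : V) : π.b (g • v) = Mer.T 1 g • π.b v := by
  have := π.β_mem.1 g v; rwa [neg_neg] at this
theorem c_smul (g : Mer) (v : V) : π.c (g • v) = Mer.T (-1) g • π.c v := π.γ_mem.1 g v
theorem d_smul (g : Mer) (v : V) : π.d (g • v) = Mer.T 1 g • π.d v := by
  have := π.δ_mem.1 g v; rwa [neg_neg] at this

theorem a_wt {w : ℂ} {v : V} (hv : v ∈ wtSpace V w) : π.a v ∈ wtSpace V w := by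
  have := π.α_mem.2 w v hv; rwa [show w + 1 - 1 = w by ring] at this
theorem b_wt {w : ℂ} {v : V} (hv : v ∈ wtSpace V w) : π.b v ∈ wtSpace V (w - 2) := by
  have := π.β_mem.2 w v hv; rwa [show w + -1 - 1 = w - 2 by ring] at this
theorem c_wt {w : ℂ} {v : V} (hv : v ∈ wtSpace V w) : π.c v ∈ wtSpace V (w + 2) := by
  have := π.γ_mem.2 w v hv; rwa [show w + 1 - -1 = w + 2 by ring] at this

theorem cb_wt {w : ℂ} {v : V} (hv : v ∈ wtSpace V w) : π.c (π.b v) ∈ wtSpace V w := by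
  have := π.c_wt (π.b_wt hv); rwa [sub_add_cancel] at this

theorem d_c (hq : 0 < q) (hq1 : q < 1) (v : V) : π.d (π.c v) = dynK' q • π.c (π.d v) := by
  rw [π.p_cd hq hq1, smul_smul, dynK', dynK_mul hq hq1, one_smul]

/-- The coefficient of `γ β` in the Casimir element, on the vectors of weight `w`. -/
noncomputable def _root_.casCoeff (q : ℝ) (w : ℂ) : Mer :=
  Mer.T (-w) (Mer.qexp q (-1) (-2) * (1 - Mer.qexp q 2 4)) *
    (Mer.qexp q (-1) 0 * (1 - Mer.qexp q 2 0))

/-- In weight `w` the function `q^(λ-μ+1)` acts as `q^((λ-w)-λ+1)`, which is constant, and likewise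
for the second term. Only the coefficient of `γβ` still depends on `λ`. -/
theorem Xi_apply (hq : 0 < q) {w : ℂ} {v : V} (hv : v ∈ wtSpace V w) :
    π.hom (FRSL2.Xi q) v = ((q : ℂ) ^ (1 - w) + (q : ℂ) ^ (w - 1)) • v -
      casCoeff q w • π.c (π.b v) := by
  -- Arbitrary functions stand for the exponentials, which separates the operator computation from
  -- the arithmetic of exponents. `γβ` preserves the weight, so all left moment maps are shifted by
  -- the same `-w`.
  have hX : ∀ f₁ f₂ f₃ f₄ f₅ f₆ : Mer, π.hom (FRSL2.lam q f₁ * FRSL2.mu q f₂ +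
      FRSL2.lam q f₃ * FRSL2.mu q f₄ - FRSL2.lam q f₅ * FRSL2.mu q f₆ * FRSL2.gγ q * FRSL2.gβ q) v =
      (Mer.T (-w) f₁ * f₂ + Mer.T (-w) f₃ * f₄) • v - (Mer.T (-w) f₅ * f₆) • π.c (π.b v) := by
    intro f₁ f₂ f₃ f₄ f₅ f₆
    simp only [map_sub, map_add, map_mul, LinearMap.sub_apply, LinearMap.add_apply,
      Module.End.mul_apply, π.mu_apply]
    rw [π.lam_apply _ w _ (Submodule.smul_mem _ _ hv), π.lam_apply _ w _ (Submodule.smul_mem _ _ hv),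
      π.lam_apply _ w _ (Submodule.smul_mem _ _ (π.cb_wt hv))]
    simp only [smul_smul, add_smul]
  rw [FRSL2.Xi, hX, Mer.T_qexp, Mer.T_qexp, Mer.qexp_mul hq, Mer.qexp_mul hq,
    show (1 : ℂ) + -1 = 0 by ring, show (-1 : ℂ) + 1 = 0 by ring,
    Mer.qexp_zero_left, Mer.qexp_zero_left, ← map_add, IsScalarTower.algebraMap_smul, casCoeff,
    show 1 + 1 * -w + 0 = 1 - w by ring, show -1 + -1 * -w + 0 = w - 1 by ring]

/-- The Casimir element acts by `Mer`-linear operators. -/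
theorem Xi_smul (g : Mer) (v : V) :
    π.hom (FRSL2.Xi q) (g • v) = g • π.hom (FRSL2.Xi q) v := by
  have hl : ∀ (f : Mer) (v : V), π.hom (FRSL2.lam q f) (g • v) = g • π.hom (FRSL2.lam q f) v :=
    fun f v => π.l_smul f g v
  -- The shift by `1` from `β` cancels the shift by `-1` from `γ`.
  have hcb : π.c (π.b (g • v)) = g • π.c (π.b v) := by
    rw [π.b_smul, π.c_smul, Mer.T_T, neg_add_cancel, Mer.T_zero]
  simp only [FRSL2.Xi, map_sub, map_add, map_mul, LinearMap.sub_apply, LinearMap.add_apply,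
    Module.End.mul_apply, π.mu_apply, hcb, smul_comm _ g, hl, smul_sub, smul_add]

end DynRep

/-! ### The universal property of `H^ω` -/

section piRep

variable (hq : 0 < q) (hq1 : q < 1) (ω : ℂ)

theorem piRep_a (x : HRep ω) : (piRep hq hq1 ω).a x = HRep.opA q ω x := by
  change (HRep.core hq hq1 ω).lift hq hq1 _ x = _; rw [FCore.lift_α]
theorem piRep_b (x : HRep ω) : (piRep hq hq1 ω).b x = HRep.opB q ω x := by
  change (HRep.core hq hq1 ω).lift hq hq1 _ x = _; rw [FCore.lift_β]
theorem piRep_c (x : HRep ω) : (piRep hq hq1 ω).c x = HRep.opC q ω x := by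
  change (HRep.core hq hq1 ω).lift hq hq1 _ x = _; rw [FCore.lift_γ]
theorem piRep_d (x : HRep ω) : (piRep hq hq1 ω).d x = HRep.opD q ω x := by
  change (HRep.core hq hq1 ω).lift hq hq1 _ x = _; rw [FCore.lift_δ]

theorem HRep.cA_zero (hq : 0 < q) (hq1 : q < 1) (ω : ℂ) : HRep.cA q ω 0 = 1 := by
  have := (HRep.ne_aux (ω := ω) hq hq1 0)
  have h1 : 1 - Mer.qexp q 2 (2 * (-ω + 1)) ≠ 0 := by
    rw [sub_ne_zero, ← map_one (algebraMap ℂ Mer)]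
    exact (Mer.qexp_ne_const hq hq1 two_ne_zero _ _).symm
  simp [HRep.cA, h1]

theorem HRep.cD_zero (hq : 0 < q) (hq1 : q < 1) : HRep.cD q 0 = 1 := by
  have h1 : 1 - Mer.qexp q 2 2 ≠ 0 := by
    rw [sub_ne_zero, ← map_one (algebraMap ℂ Mer)]
    exact (Mer.qexp_ne_const hq hq1 two_ne_zero _ _).symm
  simp [HRep.cD, h1]

/-- Linear maps out of `H^ω` are given by the images of the basis vectors. -/
noncomputable def HRep.lift (u : ℕ → V) : HRep ω →ₗ[Mer] V := Finsupp.linearCombination Mer u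

theorem HRep.lift_ge (u : ℕ → V) (k : ℕ) (g : Mer) :
    HRep.lift ω u (HRep.ge ω k g) = g • u k :=
  Finsupp.linearCombination_single Mer g k

theorem HRep.lift_e (u : ℕ → V) (k : ℕ) : HRep.lift ω u (HRep.e ω k) = u k := by
  rw [HRep.e, HRep.lift_ge, one_smul]

theorem HRep.ge_eq_smul_e (k : ℕ) (g : Mer) : HRep.ge ω k g = g • HRep.e ω k := by
  rw [HRep.e, HRep.smul_ge, mul_one]

theorem piRep_c_e (k : ℕ) :
    (piRep hq hq1 ω).c (HRep.e ω k) = -(qc q)⁻¹ • HRep.e ω (k + 1) := by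
  rw [piRep_c, HRep.e, HRep.opC_ge, map_one, mul_one, HRep.ge_eq_smul_e]

theorem e_succ (k : ℕ) :
    HRep.e ω (k + 1) = -qc q • (piRep hq hq1 ω).c (HRep.e ω k) := by
  rw [piRep_c_e, smul_smul, neg_mul_neg, mul_inv_cancel₀ (qc_ne hq), one_smul]

/-- Since `e_{k+1} = -q γ e_k`, the map has to send `e_k` to `(-q γ)^k v`, and with this choice it
commutes with `γ`. The quadratic relations express `αγ`, `βγ` and `δγ` through `γα`, `γβ` and `γδ`,
which carries compatibility with `α`, `β`, `δ` from `e_k` to `e_{k+1}`. -/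
theorem DynRep.exists_intertwiner (π : DynRep q V) {v : V} (hv : v ∈ wtSpace V ω)
    (hb : π.b v = 0) (ha : π.a v = v) :
    ∃ C : HRep ω →ₗ[Mer] V, IsIntertwiner (piRep hq hq1 ω) π C ∧ C (HRep.e ω 0) = v := by
  let u : ℕ → V := fun k => Nat.rec v (fun _ x => -qc q • π.c x) k
  have hu0 : u 0 = v := rfl
  have hus : ∀ k, u (k + 1) = -qc q • π.c (u k) := fun _ => rfl
  have huw : ∀ k : ℕ, u k ∈ wtSpace V (ω + 2 * k) := by
    intro k
    induction k with
    | zero => simpa [hu0] using hv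
    | succ k ih =>
      rw [hus]
      have := Submodule.smul_mem _ (-qc q) (π.c_wt ih)
      convert this using 2
      push_cast; ring
  set C : HRep ω →ₗ[Mer] V := HRep.lift ω u with hC
  have hw : ∀ (c : ℂ) (x : HRep ω), x ∈ wtSpace _ c → C x ∈ wtSpace V c := by
    refine wtSpace_map fun x => ?_
    induction x using HRep.induction with
    | h0 => simp
    | hadd x y hx hy => simp only [map_add, hx, hy]
    | hge k g =>
      rw [mem_wtSpace.1 (HRep.ge_mem k g), ← IsScalarTower.algebraMap_smul Mer, map_smul,
        IsScalarTower.algebraMap_smul, hC, HRep.lift_ge,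
        mem_wtSpace.1 (Submodule.smul_mem _ g (huw k))]
  set ρ := piRep hq hq1 ω with hρ
  have hl := lam_comm ρ π hw
  have hc : ∀ x, C (ρ.c x) = π.c (C x) := by
    intro x
    induction x using HRep.induction with
    | h0 => simp
    | hadd x y hx hy => simp only [map_add, hx, hy]
    | hge k g =>
      rw [piRep_c, HRep.opC_ge, hC, HRep.lift_ge, HRep.lift_ge, hus, π.c_smul, smul_smul]
      congr 1
      have := qc_ne hq
      field_simp
  have key : ∀ k, C (ρ.a (HRep.e ω k)) = π.a (C (HRep.e ω k)) ∧
      C (ρ.b (HRep.e ω k)) = π.b (C (HRep.e ω k)) ∧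
      C (ρ.d (HRep.e ω k)) = π.d (C (HRep.e ω k)) := by
    intro k
    induction k with
    | zero =>
      -- The relation for `δα` gives `δ α v = v` plus a multiple of `γ β v`, and here `β v = 0` and
      -- `α v = v`.
      have hd : π.d v = v := by
        have := π.p_da hq hq1 v
        rwa [ha, hb, map_zero, smul_zero, add_zero] at this
      rw [piRep_a, piRep_b, piRep_d, HRep.e, HRep.opA_ge, HRep.opB_ge_zero, HRep.opD_ge,
        HRep.cA_zero hq hq1, HRep.cD_zero hq hq1, map_one, map_one, mul_one, hC, HRep.lift_ge,
        one_smul, hu0, ha, hd, hb, map_zero]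
      exact ⟨rfl, rfl, rfl⟩
    | succ k ih =>
      obtain ⟨i1, i2, i3⟩ := ih
      rw [e_succ hq hq1, ← hρ]
      simp only [map_smul, DynRep.a_smul, DynRep.b_smul, DynRep.d_smul, hc]
      refine ⟨congrArg _ ?_, congrArg _ ?_, congrArg _ ?_⟩
      · rw [ρ.p_ac hq hq1, hl, hc, i1, π.p_ac hq hq1]
      -- Eliminating `αδ` from the expression for `βγ` leaves only `γβ` and functions, so the
      -- induction hypothesis for `β` suffices.
      · rw [ρ.p_bc hq hq1, ρ.p_ad hq hq1, map_sub, map_smul, map_add, hl, hl, hc, i2,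
          π.p_bc hq hq1, π.p_ad hq hq1]
      · rw [ρ.d_c hq hq1, map_smul, hc, i3, π.d_c hq hq1]
  refine ⟨C, isIntertwiner_of_generators ρ π hw ?_ ?_ hc ?_, by rw [hC, HRep.lift_e, hu0]⟩ <;>
  · intro x
    induction x using HRep.induction with
    | h0 => simp
    | hadd x y hx hy => simp only [map_add, hx, hy]
    | hge k g =>
      rw [HRep.ge_eq_smul_e]
      simp only [map_smul, DynRep.a_smul, DynRep.b_smul, DynRep.d_smul, key k]

end piRep

end General

/-! # Coordinates on `H^{ω₁} ⊗̄ H^{ω₂}` -/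

section Coordinates

variable {q : ℝ} {ω₁ ω₂ : ℂ}

theorem map_csmul {X Y : Type*} [AddCommGroup X] [Module ℂ X] [Module Mer X] [IsScalarTower ℂ Mer X]
    [AddCommGroup Y] [Module ℂ Y] [Module Mer Y] [IsScalarTower ℂ Mer Y] (φ : X →ₗ[Mer] Y) (c : ℂ)
    (x : X) : φ (c • x) = c • φ x := by
  rw [← IsScalarTower.algebraMap_smul Mer, map_smul, IsScalarTower.algebraMap_smul]

/-- The coefficient of `e_k`. -/
noncomputable def HRep.coef (ω : ℂ) (k : ℕ) : HRep ω →ₗ[Mer] Mer := Finsupp.lapply k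

theorem HRep.coef_ge {ω : ℂ} (k l : ℕ) (g : Mer) :
    HRep.coef ω k (HRep.ge ω l g) = if l = k then g else 0 :=
  Finsupp.single_apply

theorem HRep.coef_wt {ω : ℂ} (k : ℕ) (x : HRep ω) :
    HRep.coef ω k (HRep.wtH ω x) = (ω + 2 * k) • HRep.coef ω k x := by
  induction x using HRep.induction with
  | h0 => simp
  | hadd x y hx hy => simp only [map_add, smul_add, hx, hy]
  | hge l g =>
    rw [HRep.wtH_ge, map_csmul, HRep.coef_ge]
    split_ifs with h
    · rw [h]
    · simp

/-- The basis vectors have pairwise different weights `ω + 2k`, so a nonzero coefficient reveals the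
weight of a homogeneous vector. This makes the coordinates on the tensor product well defined. -/
theorem HRep.coef_mem {ω : ℂ} {c : ℂ} {x : HRep ω} (hx : x ∈ wtSpace (HRep ω) c) (k : ℕ)
    (hk : HRep.coef ω k x ≠ 0) : c = ω + 2 * k := by
  have h1 : HRep.wtH ω x = c • x := mem_wtSpace.1 hx
  have h2 := HRep.coef_wt k x
  rw [h1, map_csmul] at h2
  exact smul_left_injective ℂ hk h2

namespace DynTensor

variable (ω₁ ω₂) in
/-- The basis vector `e_i ⊗ e_j`. -/
noncomputable def E (i j : ℕ) : DynTensor (HRep ω₁) (HRep ω₂) := tm (HRep.e ω₁ i) (HRep.e ω₂ j)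

variable (ω₁ ω₂) in
/-- The coefficient of `e_i ⊗ e_j`. -/
noncomputable def co (i j : ℕ) : DynTensor (HRep ω₁) (HRep ω₂) →ₗ[Mer] Mer :=
  { liftT (V := HRep ω₁) (W := HRep ω₂) (TensorProduct.lift (LinearMap.mk₂ ℂ
      (fun (w : HRep ω₂) (v : HRep ω₁) =>
        Mer.T (-(ω₂ + 2 * j)) (HRep.coef ω₁ i v) * HRep.coef ω₂ j w)
      (fun w w' v => by rw [map_add, mul_add])
      (fun c w v => by
        rw [← IsScalarTower.algebraMap_smul Mer c w, map_smul, IsScalarTower.algebraMap_smul,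
          mul_smul_comm])
      (fun w v v' => by rw [map_add, map_add, add_mul])
      (fun c w v => by
        rw [← IsScalarTower.algebraMap_smul Mer c v, map_smul, IsScalarTower.algebraMap_smul,
          map_smul, smul_mul_assoc])))
      (by
        intro f v b w hw
        simp only [TensorProduct.lift.tmul, LinearMap.mk₂_apply, map_smul, smul_eq_mul, map_mul]
        -- If `e_j` occurs in `w`, the weight of `w` is `ω₂ + 2j`. The shift in the tensor relation
        -- is then the shift built into the coordinate.
        by_cases h : HRep.coef ω₂ j w = 0
        · rw [h]; simp
        · rw [HRep.coef_mem hw j h]; ring) with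
    map_smul' := by
      intro g x
      induction x using DynTensor.induction with
      | h0 => simp
      | hadd x y hx hy =>
        simp only [AddHom.toFun_eq_coe, LinearMap.coe_toAddHom, RingHom.id_apply, smul_add,
          map_add] at hx hy ⊢
        rw [hx, hy]
      | htm v w =>
        simp only [AddHom.toFun_eq_coe, LinearMap.coe_toAddHom, RingHom.id_apply]
        rw [← tm_smul_right, liftT_tm, liftT_tm]
        simp only [TensorProduct.lift.tmul, LinearMap.mk₂_apply, map_smul, smul_eq_mul]
        ring }

theorem co_tm (i j : ℕ) (v : HRep ω₁) (w : HRep ω₂) : co ω₁ ω₂ i j (tm v w) =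
    Mer.T (-(ω₂ + 2 * j)) (HRep.coef ω₁ i v) * HRep.coef ω₂ j w := rfl

theorem co_E (i j k l : ℕ) : co ω₁ ω₂ i j (E ω₁ ω₂ k l) = if k = i ∧ l = j then 1 else 0 := by
  rw [E, co_tm, HRep.e, HRep.e, HRep.coef_ge, HRep.coef_ge]
  by_cases h : k = i <;> by_cases h' : l = j <;> simp [h, h']

theorem tm_ge (k l : ℕ) (f g : Mer) : tm (HRep.ge ω₁ k f) (HRep.ge ω₂ l g) =
    (Mer.T (-(ω₂ + 2 * l)) f * g) • E ω₁ ω₂ k l := by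
  rw [HRep.ge_eq_smul_e, HRep.ge_eq_smul_e, tm_smul_right,
    show tm (f • HRep.e ω₁ k) (HRep.e ω₂ l) = _ from tm_smul_left _ _ _ _ (HRep.ge_mem l 1),
    smul_smul, mul_comm]; rfl

theorem E_mem (i j : ℕ) :
    E ω₁ ω₂ i j ∈ wtSpace (DynTensor (HRep ω₁) (HRep ω₂)) (ω₁ + ω₂ + 2 * (i + j)) := by
  have := tm_mem (HRep.ge_mem (ω := ω₁) i 1) (HRep.ge_mem (ω := ω₂) j 1)
  rw [show ω₁ + 2 * (i : ℂ) + (ω₂ + 2 * j) = ω₁ + ω₂ + 2 * (i + j) by ring] at this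
  exact this

theorem induction_E {P : DynTensor (HRep ω₁) (HRep ω₂) → Prop} (h0 : P 0)
    (hadd : ∀ x y, P x → P y → P (x + y)) (hE : ∀ i j (g : Mer), P (g • E ω₁ ω₂ i j))
    (x : DynTensor (HRep ω₁) (HRep ω₂)) : P x := by
  induction x using DynTensor.induction with
  | h0 => exact h0
  | hadd x y hx hy => exact hadd x y hx hy
  | htm v w =>
    induction v using HRep.induction with
    | h0 => rw [tm_zero_left]; exact h0
    | hadd v v' hv hv' => rw [tm_add_left]; exact hadd _ _ hv hv'
    | hge k f =>
      induction w using HRep.induction with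
      | h0 => rw [tm_zero_right]; exact h0
      | hadd w w' hw hw' => rw [tm_add_right]; exact hadd _ _ hw hw'
      | hge l g => rw [tm_ge]; exact hE _ _ _

variable (ω₁ ω₂) in
/-- The linear combination of the vectors `e_i ⊗ e_j` with given coefficients. -/
noncomputable def lc : (ℕ × ℕ →₀ Mer) →ₗ[Mer] DynTensor (HRep ω₁) (HRep ω₂) :=
  Finsupp.linearCombination Mer fun n : ℕ × ℕ => E ω₁ ω₂ n.1 n.2

theorem co_lc (i j : ℕ) (f : ℕ × ℕ →₀ Mer) : co ω₁ ω₂ i j (lc ω₁ ω₂ f) = f (i, j) := by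
  induction f using Finsupp.induction_linear with
  | zero => simp
  | add f g hf hg => rw [map_add, map_add, hf, hg, Finsupp.add_apply]
  | single n g =>
    obtain ⟨k, l⟩ := n
    rw [lc, Finsupp.linearCombination_single, map_smul, co_E, Finsupp.single_apply]
    simp

theorem lc_surjective : Function.Surjective (lc ω₁ ω₂) := by
  intro x
  induction x using induction_E with
  | h0 => exact ⟨0, map_zero _⟩
  | hadd x y hx hy =>
    obtain ⟨f, rfl⟩ := hx
    obtain ⟨g, rfl⟩ := hy
    exact ⟨f + g, map_add _ _ _⟩
  | hE i j g => exact ⟨Finsupp.single (i, j) g, Finsupp.linearCombination_single _ _ _⟩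

/-- The `e_i ⊗ e_j` span the tensor product and the functionals `co` recover the coefficients, so
these vectors are a `Mer`-basis. -/
theorem ext_co {x y : DynTensor (HRep ω₁) (HRep ω₂)}
    (h : ∀ i j, co ω₁ ω₂ i j x = co ω₁ ω₂ i j y) : x = y := by
  obtain ⟨f, rfl⟩ := lc_surjective x
  obtain ⟨g, rfl⟩ := lc_surjective y
  congr 1
  ext ⟨i, j⟩
  have := h i j
  rwa [co_lc, co_lc] at this

theorem co_wt (i j : ℕ) (x : DynTensor (HRep ω₁) (HRep ω₂)) :
    co ω₁ ω₂ i j (wtT _ _ x) = (ω₁ + ω₂ + 2 * (i + j)) • co ω₁ ω₂ i j x := by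
  induction x using induction_E with
  | h0 => simp
  | hadd x y hx hy => simp only [map_add, smul_add, hx, hy]
  | hE k l g =>
    have h : wtT _ _ (E ω₁ ω₂ k l) = _ := mem_wtSpace.1 (E_mem (ω₁ := ω₁) (ω₂ := ω₂) k l)
    rw [map_smul, h, map_smul, map_csmul, map_smul, co_E, smul_comm g]
    split_ifs with h
    · rw [h.1, h.2]
    · simp

theorem mem_wtSpace_co {c : ℂ} {x : DynTensor (HRep ω₁) (HRep ω₂)} : x ∈ wtSpace _ c ↔
    ∀ i j, co ω₁ ω₂ i j x ≠ 0 → c = ω₁ + ω₂ + 2 * (i + j) := by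
  constructor
  · intro hx i j hij
    have h1 : wtT _ _ x = c • x := mem_wtSpace.1 hx
    have h2 := co_wt i j x
    rw [h1, map_csmul] at h2
    exact smul_left_injective ℂ hij h2
  · intro h
    refine mem_wtSpace.2 (ext_co fun i j => ?_)
    change co ω₁ ω₂ i j (wtT _ _ x) = _
    rw [co_wt, map_csmul]
    by_cases hij : co ω₁ ω₂ i j x = 0
    · rw [hij, smul_zero, smul_zero]
    · rw [h i j hij]

theorem co_eq_zero {p i j : ℕ} {x : DynTensor (HRep ω₁) (HRep ω₂)}
    (hx : x ∈ wtSpace _ (ω₁ + ω₂ + 2 * p)) (hij : i + j ≠ p) : co ω₁ ω₂ i j x = 0 := by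
  by_contra h
  have := mem_wtSpace_co.1 hx i j h
  refine hij ?_
  have h2 : (p : ℂ) = (i + j : ℕ) := by
    push_cast; linear_combination this / 2
  exact_mod_cast h2.symm

end DynTensor

open DynTensor

/-! ### The operators in coordinates -/

variable (hq : 0 < q) (hq1 : q < 1) (ω₁ ω₂)

/-- The tensor product representation on `H^{ω₁} ⊗̄ H^{ω₂}`. -/
noncomputable abbrev tRep : DynRep q (DynTensor (HRep ω₁) (HRep ω₂)) :=
  DynRep.tensor hq hq1 (piRep hq hq1 ω₁) (piRep hq hq1 ω₂)

/-- A scalar on the left factor crosses the tensor sign with a shift by the weight of the right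
factor after the operator has acted, hence `l + 1` in the second shift. The truncated index `k - 1`
at `k = 0` is harmless because `B_0 = 0`. -/
theorem tRep_a_E (k l : ℕ) : (tRep ω₁ ω₂ hq hq1).a (E ω₁ ω₂ k l) =
    (Mer.T (-(ω₂ + 2 * l)) (HRep.cA q ω₁ k) * HRep.cA q ω₂ l) • E ω₁ ω₂ k l +
    (Mer.T (-(ω₂ + 2 * (l + 1 : ℕ))) (HRep.cB q ω₁ k) * -(qc q)⁻¹) • E ω₁ ω₂ (k - 1) (l + 1) := by
  change (DynTensor.core _ _ hq hq1).lift hq hq1 _ _ = _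
  rw [FCore.lift_α, E, aT_tm, piRep_a, piRep_a, piRep_b, piRep_c, HRep.e, HRep.e, HRep.opA_ge,
    HRep.opA_ge, HRep.opC_ge, HRep.opB, HRep.op_ge, tm_ge, tm_ge]
  simp only [map_one, mul_one]; rfl

theorem tRep_b_E (k l : ℕ) : (tRep ω₁ ω₂ hq hq1).b (E ω₁ ω₂ k l) =
    (Mer.T (-(ω₂ + 2 * (l - 1 : ℕ))) (HRep.cA q ω₁ k) * HRep.cB q ω₂ l) • E ω₁ ω₂ k (l - 1) +
    (Mer.T (-(ω₂ + 2 * l)) (HRep.cB q ω₁ k) * HRep.cD q l) • E ω₁ ω₂ (k - 1) l := by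
  change (DynTensor.core _ _ hq hq1).lift hq hq1 _ _ = _
  rw [FCore.lift_β, E, bT_tm, piRep_a, piRep_b, piRep_b, piRep_d, HRep.e, HRep.e, HRep.opA_ge,
    HRep.opD_ge, HRep.opB, HRep.opB, HRep.op_ge, HRep.op_ge, tm_ge, tm_ge]
  simp only [map_one, mul_one]; rfl

theorem tRep_c_E (k l : ℕ) : (tRep ω₁ ω₂ hq hq1).c (E ω₁ ω₂ k l) =
    (-(qc q)⁻¹ * HRep.cA q ω₂ l) • E ω₁ ω₂ (k + 1) l +
    (Mer.T (-(ω₂ + 2 * (l + 1 : ℕ))) (HRep.cD q k) * -(qc q)⁻¹) • E ω₁ ω₂ k (l + 1) := by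
  change (DynTensor.core _ _ hq hq1).lift hq hq1 _ _ = _
  rw [FCore.lift_γ, E, cT_tm, piRep_a, piRep_c, piRep_c, piRep_d, HRep.e, HRep.e, HRep.opA_ge,
    HRep.opD_ge, HRep.opC_ge, HRep.opC_ge, tm_ge, tm_ge]
  simp only [map_one, mul_one, map_neg, map_inv₀, AlgHom.commutes]

variable {ω₁ ω₂}

/-- This is the transpose of `tRep_a_E`. The case distinction at `j = 0` removes a term whose index
`j - 1` would be truncated while its coefficient need not vanish. -/
theorem co_a (i j : ℕ) (x : DynTensor (HRep ω₁) (HRep ω₂)) :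
    co ω₁ ω₂ i j ((tRep ω₁ ω₂ hq hq1).a x) =
      Mer.T (-(ω₂ + 2 * j)) (HRep.cA q ω₁ i) * HRep.cA q ω₂ j * Mer.T (-1) (co ω₁ ω₂ i j x) +
      (if j = 0 then 0 else Mer.T (-(ω₂ + 2 * j)) (HRep.cB q ω₁ (i + 1)) * -(qc q)⁻¹) *
        Mer.T (-1) (co ω₁ ω₂ (i + 1) (j - 1) x) := by
  induction x using induction_E with
  | h0 => simp
  | hadd x y hx hy => simp only [map_add, hx, hy]; ring
  | hE k l g =>
    rw [DynRep.a_smul, tRep_a_E]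
    simp only [map_smul, map_add, co_E, smul_eq_mul, map_mul, mul_add]
    congr 1
    · by_cases h : k = i ∧ l = j
      · obtain ⟨rfl, rfl⟩ := h; simp; ring
      · simp [h]
    · rcases j with _ | j
      · simp
      · rcases k with _ | k
        · simp [HRep.cB_zero]
        · by_cases h : k = i ∧ l = j
          · obtain ⟨rfl, rfl⟩ := h; simp; ring
          · simp [h]

theorem co_b (i j : ℕ) (x : DynTensor (HRep ω₁) (HRep ω₂)) :
    co ω₁ ω₂ i j ((tRep ω₁ ω₂ hq hq1).b x) =
      Mer.T (-(ω₂ + 2 * j)) (HRep.cA q ω₁ i) * HRep.cB q ω₂ (j + 1) *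
        Mer.T 1 (co ω₁ ω₂ i (j + 1) x) +
      Mer.T (-(ω₂ + 2 * j)) (HRep.cB q ω₁ (i + 1)) * HRep.cD q j *
        Mer.T 1 (co ω₁ ω₂ (i + 1) j x) := by
  induction x using induction_E with
  | h0 => simp
  | hadd x y hx hy => simp only [map_add, hx, hy]; ring
  | hE k l g =>
    rw [DynRep.b_smul, tRep_b_E]
    simp only [map_smul, map_add, co_E, smul_eq_mul, map_mul, mul_add]
    congr 1
    · rcases l with _ | l
      · simp [HRep.cB_zero]
      · by_cases h : k = i ∧ l = j
        · obtain ⟨rfl, rfl⟩ := h; simp; ring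
        · simp [h]
    · rcases k with _ | k
      · simp [HRep.cB_zero]
      · by_cases h : k = i ∧ l = j
        · obtain ⟨rfl, rfl⟩ := h; simp; ring
        · simp [h]

theorem co_c (i j : ℕ) (x : DynTensor (HRep ω₁) (HRep ω₂)) :
    co ω₁ ω₂ i j ((tRep ω₁ ω₂ hq hq1).c x) =
      (if i = 0 then 0 else -(qc q)⁻¹ * HRep.cA q ω₂ j) * Mer.T (-1) (co ω₁ ω₂ (i - 1) j x) +
      (if j = 0 then 0 else Mer.T (-(ω₂ + 2 * j)) (HRep.cD q i) * -(qc q)⁻¹) *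
        Mer.T (-1) (co ω₁ ω₂ i (j - 1) x) := by
  induction x using induction_E with
  | h0 => simp
  | hadd x y hx hy => simp only [map_add, hx, hy]; ring
  | hE k l g =>
    rw [DynRep.c_smul, tRep_c_E]
    simp only [map_smul, map_add, co_E, smul_eq_mul, map_mul, mul_add]
    congr 1
    · rcases i with _ | i
      · simp
      · by_cases h : k = i ∧ l = j
        · obtain ⟨rfl, rfl⟩ := h; simp; ring
        · simp [h]
    · rcases j with _ | j
      · simp
      · by_cases h : k = i ∧ l = j
        · obtain ⟨rfl, rfl⟩ := h; simp; ring
        · simp [h]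

end Coordinates

/-! # The three-term recurrence of the `q`-Racah polynomials -/

section Racah

variable {F : Type*} [Field F]

theorem qPoch_zero (a q : F) : qPoch a q 0 = 1 := by simp [qPoch]

theorem qPoch_succ (a q : F) (n : ℕ) : qPoch a q (n + 1) = qPoch a q n * (1 - a * q ^ n) := by
  rw [qPoch, Finset.prod_range_succ]; rfl

theorem qPoch_succ' (a q : F) (n : ℕ) : qPoch a q (n + 1) = (1 - a) * qPoch (a * q) q n := by
  rw [qPoch, Finset.prod_range_succ', mul_comm, pow_zero, mul_one, qPoch]
  congr 1
  refine Finset.prod_congr rfl fun j _ => ?_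
  rw [pow_succ']; ring

theorem qPoch_eq_zero {a q : F} {n j : ℕ} (hj : j < n) (h : a * q ^ j = 1) : qPoch a q n = 0 :=
  Finset.prod_eq_zero (Finset.mem_range.2 hj) (by rw [h, sub_self])

theorem qPoch_ne_zero {a q : F} {n : ℕ} (h : ∀ j < n, a * q ^ j ≠ 1) : qPoch a q n ≠ 0 :=
  Finset.prod_ne_zero_iff.2 fun j hj => sub_ne_zero.2 (h j (Finset.mem_range.1 hj)).symm

theorem qPoch_inv_pow {q : F} (hq : q ≠ 0) {n N : ℕ} (h : n < N) : qPoch (q⁻¹ ^ n) q N = 0 :=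
  qPoch_eq_zero h (by rw [← mul_pow, inv_mul_cancel₀ hq, one_pow])

/-- The coefficient of `(q^(-x), c d q^(x+1); q)_j` in `R_n(μ(x); a, b, c, d; q)`. -/
def racCoeff (a b c d q : F) (n j : ℕ) : F :=
  qPoch (q⁻¹ ^ n) q j * qPoch (a * b * q ^ (n + 1)) q j /
    (qPoch q q j * qPoch (a * q) q j * qPoch (b * d * q) q j * qPoch (c * q) q j) * q ^ j

/-- The basis `(q^(-x), c d q^(x+1); q)_j`. -/
def racBasis (c d q : F) (x j : ℕ) : F := qPoch (q⁻¹ ^ x) q j * qPoch (c * d * q ^ (x + 1)) q j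

/-- The coefficient of `R_{n+1}` in the recurrence, with `z = q^(-n)` and `m = a b q^(n+1)`. -/
def racA (a b c d q z m : F) : F :=
  (1 - a * q / z) * (1 - m) * (1 - b * d * q / z) * (1 - c * q / z) /
    ((1 - m / z) * (1 - m * q / z))

/-- The coefficient of `R_{n-1}` in the recurrence, with `z = q^(-n)` and `m = a b q^(n+1)`. -/
def racC (a b c d q z m : F) : F :=
  q * (1 - 1 / z) * (1 - b / z) * (c - m / q) * (d - a / z) / ((1 - m / (q * z)) * (1 - m / z))

variable {a b c d q : F}

theorem racBasis_succ (x j : ℕ) : racBasis c d q x (j + 1) =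
    (1 - q⁻¹ ^ x * q ^ j) * (1 - c * d * q ^ (x + 1) * q ^ j) * racBasis c d q x j := by
  rw [racBasis, racBasis, qPoch_succ, qPoch_succ]; ring

/-- `φ_{j+1}` in terms of multiplication by the eigenvalue. -/
theorem racBasis_mul (hq : q ≠ 0) (x j : ℕ) :
    (1 - q⁻¹ ^ x) * (1 - c * d * q ^ (x + 1)) * racBasis c d q x j =
      (1 - (q ^ j)⁻¹) * (1 - c * d * q * q ^ j) * racBasis c d q x j +
        (q ^ j)⁻¹ * racBasis c d q x (j + 1) := by
  rw [racBasis_succ]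
  have h1 : q ^ j ≠ 0 := pow_ne_zero _ hq
  have h2 : q ^ x ≠ 0 := pow_ne_zero _ hq
  rw [inv_pow, pow_succ]
  field_simp
  ring

/-- The factor `(q^(-n); q)_j` is zero for `j > n`, even where a denominator is zero too, so
consecutive polynomials can be summed over one common range. -/
theorem qRacah_eq (hq : q ≠ 0) {n N : ℕ} (x : ℕ) (hN : n ≤ N) : qRacah n x a b c d q =
    ∑ j ∈ Finset.range (N + 1), racCoeff a b c d q n j * racBasis c d q x j := by
  have h1 : ∀ j, racCoeff a b c d q n j * racBasis c d q x j =
      (qPoch (q⁻¹ ^ n) q j * qPoch (a * b * q ^ (n + 1)) q j * qPoch (q⁻¹ ^ x) q j *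
        qPoch (c * d * q ^ (x + 1)) q j) /
      (qPoch q q j * qPoch (a * q) q j * qPoch (b * d * q) q j * qPoch (c * q) q j) * q ^ j := by
    intro j; rw [racCoeff, racBasis]; ring
  simp only [h1]
  rw [qRacah]
  refine Finset.sum_subset (by simpa using hN) fun j _ hj => ?_
  rw [Finset.mem_range, not_lt] at hj
  rw [qPoch_inv_pow hq (by omega)]
  simp

/-- This is the recurrence for the coefficient of the basis element with index `j + 1`, with a
common factor removed. It is a rational identity in `z = q^(-n)`, `m = a b q^(n+1)` and `y =
q^(j+1)`, in which `b` and `d` have been replaced through `m z = a b q` and `d = e a`. -/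
theorem rac_poly {z y m e : F} (hq : q ≠ 0) (hy : y ≠ 0)
    (h1 : z - m ≠ 0) (h2 : z - m * q ≠ 0) (h3 : q * z - m ≠ 0) :
    (z - a * q) * (1 - m * e) * (z - c * q) / ((z - m) * (z - m * q)) *
        ((1 - z / q) * (1 - m * y / q) * (1 - m * y)) -
      ((z - a * q) * (1 - m * e) * (z - c * q) / ((z - m) * (z - m * q)) * (1 - m) +
        (q * a - m) * (q * c - m) * (e * z - 1) / ((q * z - m) * (z - m)) * (z - 1)) *
        ((1 - z * y / q) * (1 - m * y / q)) -
      (q * a - m) * (q * c - m) * (e * z - 1) / ((q * z - m) * (z - m)) *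
        ((1 - m / q) * (1 - z * y / q) * (1 - z * y)) =
      -((1 - y⁻¹) * (1 - c * (e * a) * q * y)) * ((1 - z * y / q) * (1 - m * y / q)) -
        y⁻¹ * ((1 - y) * (1 - a * y) * (1 - m * z * e / q * y) * (1 - c * y)) := by
  obtain ⟨d1, e1⟩ : ∃ d, z - m = d := ⟨_, rfl⟩
  obtain ⟨d2, e2⟩ : ∃ d, z - m * q = d := ⟨_, rfl⟩
  obtain ⟨d3, e3⟩ : ∃ d, q * z - m = d := ⟨_, rfl⟩
  rw [e1] at h1; rw [e2] at h2; rw [e3] at h3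
  rw [e1, e2, e3]
  -- With all denominators cleared the identity is polynomial. The two quotients are afterwards
  -- treated as unknowns `t₁`, `t₂`, which lets the product `d1 * d2 * d3` be cancelled without
  -- expanding it.
  have key : (z - a * q) * (1 - m * e) * (z - c * q) * d3 *
        ((q - z) * (q - m * y) * (1 - m * y)) * y -
      ((z - a * q) * (1 - m * e) * (z - c * q) * (1 - m) * d3 +
        (q * a - m) * (q * c - m) * (e * z - 1) * d2 * (z - 1)) *
        ((q - z * y) * (q - m * y)) * y -
      (q * a - m) * (q * c - m) * (e * z - 1) * d2 *
        ((q - m) * (q - z * y) * (1 - z * y)) * y =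
      d1 * d2 * d3 * (-((y - 1) * (1 - c * (e * a) * q * y)) * ((q - z * y) * (q - m * y)) -
         ((1 - y) * (1 - a * y) * (q - m * z * e * y) * (1 - c * y)) * q) := by
    rw [← e1, ← e2, ← e3]; ring
  obtain ⟨t₁, f1⟩ : ∃ t, (z - a * q) * (1 - m * e) * (z - c * q) / (d1 * d2) = t := ⟨_, rfl⟩
  obtain ⟨t₂, f2⟩ : ∃ t, (q * a - m) * (q * c - m) * (e * z - 1) / (d3 * d1) = t := ⟨_, rfl⟩
  rw [f1, f2]
  rw [div_eq_iff (mul_ne_zero h1 h2)] at f1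
  rw [div_eq_iff (mul_ne_zero h3 h1)] at f2
  rw [f1, f2] at key
  have key2 : t₁ * ((q - z) * (q - m * y) * (1 - m * y)) * y -
      (t₁ * (1 - m) + t₂ * (z - 1)) * ((q - z * y) * (q - m * y)) * y -
      t₂ * ((q - m) * (q - z * y) * (1 - z * y)) * y =
      -((y - 1) * (1 - c * (e * a) * q * y)) * ((q - z * y) * (q - m * y)) -
         ((1 - y) * (1 - a * y) * (q - m * z * e * y) * (1 - c * y)) * q := by
    refine mul_left_cancel₀ (mul_ne_zero (mul_ne_zero h1 h2) h3) ?_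
    linear_combination key
  have hD : q ^ 2 * y ≠ 0 := mul_ne_zero (pow_ne_zero _ hq) hy
  refine mul_left_cancel₀ hD ?_
  have r1 : q * (1 - z / q) = q - z := by field_simp
  have r2 : q * (1 - m * y / q) = q - m * y := by field_simp
  have r3 : q * (1 - z * y / q) = q - z * y := by field_simp
  have r4 : q * (1 - m / q) = q - m := by field_simp
  have r5 : q * (1 - m * z * e / q * y) = q - m * z * e * y := by field_simp
  have r6 : y * (1 - y⁻¹) = y - 1 := by field_simp
  have r7 : y * y⁻¹ = 1 := mul_inv_cancel₀ hy
  rw [← r1, ← r2, ← r3, ← r4, ← r5, ← r6] at key2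
  linear_combination key2 + q ^ 2 * ((1 - y) * (1 - a * y) * (1 - m * z * e / q * y) * (1 - c * y)) * r7

/-- The factor `1 - m` is isolated because it absorbs the shift of `m` to `m q` between the
coefficients of `R_n` and `R_{n+1}`; no division by it is needed, and it may vanish. In `racC_eq`
the factor `z - 1` plays this role for `R_{n-1}`. -/
theorem racA_eq {z m e : F} (hz : z ≠ 0) (hb : m * z = a * b * q)
    (he : d = e * a) (h1 : z - m ≠ 0) (h2 : z - m * q ≠ 0) : racA a b c d q z m =
      (z - a * q) * (1 - m * e) * (z - c * q) / ((z - m) * (z - m * q)) * (1 - m) := by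
  have hb' : b * d * q / z = m * e := by
    rw [he]; field_simp; linear_combination -e * hb
  rw [racA, hb', show 1 - m / z = (z - m) / z by field_simp,
    show 1 - m * q / z = (z - m * q) / z by field_simp]
  field_simp

theorem racC_eq {z m e : F} (hq : q ≠ 0) (ha : a ≠ 0) (hz : z ≠ 0) (hb : m * z = a * b * q)
    (he : d = e * a) (h1 : z - m ≠ 0) (h3 : q * z - m ≠ 0) : racC a b c d q z m =
      (q * a - m) * (q * c - m) * (e * z - 1) / ((q * z - m) * (z - m)) * (z - 1) := by
  have hb' : b / z = m / (q * a) := by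
    field_simp; linear_combination -hb
  rw [racC, hb', he, show 1 - m / z = (z - m) / z by field_simp,
    show 1 - m / (q * z) = (q * z - m) / (q * z) by field_simp]
  field_simp

/-- The three-term recurrence, coefficientwise. -/
theorem racCoeff_rec {n j : ℕ} (hq : q ≠ 0)
    (hden : q * q ^ j ≠ 1 ∧ a * q * q ^ j ≠ 1 ∧ b * d * q * q ^ j ≠ 1 ∧ c * q * q ^ j ≠ 1)
    {z m : F} (hz : z = q⁻¹ ^ n) (hm : m = a * b * q ^ (n + 1)) (ha : a ≠ 0)
    (h1 : z - m ≠ 0) (h2 : z - m * q ≠ 0) (h3 : q * z - m ≠ 0) :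
    racA a b c d q z m * racCoeff a b c d q (n + 1) (j + 1) -
      (racA a b c d q z m + racC a b c d q z m) * racCoeff a b c d q n (j + 1) +
      racC a b c d q z m * racCoeff a b c d q (n - 1) (j + 1) =
    -((1 - (q ^ (j + 1))⁻¹) * (1 - c * d * q * q ^ (j + 1))) * racCoeff a b c d q n (j + 1) -
      (q ^ j)⁻¹ * racCoeff a b c d q n j := by
  -- In the variables `z`, `m`, `e` the product `b d` is `m z e / q`, so neither `b` nor `d` remains
  -- in the identity to be checked.
  obtain ⟨e, he⟩ : ∃ e, d = e * a := ⟨d / a, by field_simp⟩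
  have hqn : q ^ n ≠ 0 := pow_ne_zero _ hq
  have hz0 : z ≠ 0 := by rw [hz]; exact pow_ne_zero _ (inv_ne_zero hq)
  have hb : m * z = a * b * q := by
    rw [hm, hz, inv_pow, pow_succ]; field_simp
  have hbd : b * d = m * z * e / q := by
    rw [hb, he]; field_simp
  obtain ⟨y, hy⟩ : ∃ y, y = q ^ (j + 1) := ⟨_, rfl⟩
  have hy0 : y ≠ 0 := by rw [hy]; exact pow_ne_zero _ hq
  have hqj : q ^ j = y / q := by rw [hy, pow_succ]; field_simp
  obtain ⟨g1, g2, g3, g4⟩ := hden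
  have e1 : q * q ^ j = y := by rw [hqj]; field_simp
  have e2 : a * q * q ^ j = a * y := by rw [hqj]; field_simp
  have e3 : b * d * q * q ^ j = b * d * y := by rw [hqj]; field_simp
  have e4 : c * q * q ^ j = c * y := by rw [hqj]; field_simp
  rw [e1] at g1; rw [e2] at g2; rw [e3] at g3; rw [e4] at g4
  obtain ⟨K, hK⟩ : ∃ K, K = racCoeff a b c d q n j := ⟨_, rfl⟩
  obtain ⟨D, hD⟩ : ∃ D, D = (1 - y) * (1 - a * y) * (1 - b * d * y) * (1 - c * y) := ⟨_, rfl⟩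
  have hD0 : D ≠ 0 := by
    rw [hD]
    exact mul_ne_zero (mul_ne_zero (mul_ne_zero (sub_ne_zero.2 g1.symm) (sub_ne_zero.2 g2.symm))
      (sub_ne_zero.2 g3.symm)) (sub_ne_zero.2 g4.symm)
  obtain ⟨P, hP⟩ : ∃ P, P = qPoch q q j * qPoch (a * q) q j * qPoch (b * d * q) q j *
    qPoch (c * q) q j := ⟨_, rfl⟩
  have hK' : K = qPoch z q j * qPoch m q j / P * (y / q) := by
    rw [hK, racCoeff, ← hz, ← hm, ← hP, hqj]
  have hs : ∀ n', racCoeff a b c d q n' (j + 1) =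
      qPoch (q⁻¹ ^ n') q (j + 1) * qPoch (a * b * q ^ (n' + 1)) q (j + 1) / (P * D) * y := by
    intro n'
    rw [racCoeff, ← hy]
    congr 2
    rw [qPoch_succ q, qPoch_succ (a * q), qPoch_succ (b * d * q), qPoch_succ (c * q), e1, e2, e3,
      e4, hP, hD]
    ring
  have c0 : racCoeff a b c d q n (j + 1) =
      K * q / D * ((1 - z * y / q) * (1 - m * y / q)) := by
    rw [hs, hK', ← hz, ← hm, qPoch_succ, qPoch_succ, hqj]
    field_simp
  -- Passing from `n` to `n + 1` replaces `z` by `z / q` and `m` by `m q`. The two shifted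
  -- factorials then share all but boundary factors with those of `K`, once `1 - m` supplies the
  -- missing first factor.
  have c1 : (1 - m) * racCoeff a b c d q (n + 1) (j + 1) =
      K * q / D * ((1 - z / q) * (1 - m * y / q) * (1 - m * y)) := by
    have p1 : qPoch (q⁻¹ ^ (n + 1)) q (j + 1) = (1 - z / q) * qPoch z q j := by
      rw [qPoch_succ', pow_succ, ← hz, mul_assoc, inv_mul_cancel₀ hq, mul_one, div_eq_mul_inv]
    have p2 : (1 - m) * qPoch (a * b * q ^ (n + 1 + 1)) q (j + 1) =
        qPoch m q j * (1 - m * y / q) * (1 - m * y) := by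
      rw [show a * b * q ^ (n + 1 + 1) = m * q by rw [hm]; ring, ← qPoch_succ', qPoch_succ,
        qPoch_succ, ← hy, hqj, mul_div_assoc]
    rw [hs, p1, show (1 - m) * ((1 - z / q) * qPoch z q j *
      qPoch (a * b * q ^ (n + 1 + 1)) q (j + 1) / (P * D) * y) = (1 - z / q) * qPoch z q j *
      ((1 - m) * qPoch (a * b * q ^ (n + 1 + 1)) q (j + 1)) / (P * D) * y by ring, p2, hK']
    field_simp
  -- At `n = 0`, where `n - 1` is truncated, `z = 1` kills the left side. The right side vanishes as
  -- well: for `j = 0` because `y = q`, and for `j > 0` because `K = 0`.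
  have c2 : (z - 1) * racCoeff a b c d q (n - 1) (j + 1) =
      -(K * q / D * ((1 - m / q) * (1 - z * y / q) * (1 - z * y))) := by
    rcases n with _ | n
    · have hz1 : z = 1 := by rw [hz, pow_zero]
      rcases j with _ | j
      · have : y = q := by rw [hy]; simp
        rw [hz1, this]; simp [hq]
      · have : K = 0 := by
          rw [hK, racCoeff, qPoch_inv_pow hq (by omega)]; simp
        rw [this, hz1]; simp
    · have p1 : (z - 1) * qPoch (q⁻¹ ^ n) q (j + 1) =
          -(qPoch z q j * (1 - z * y / q) * (1 - z * y)) := by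
        rw [show q⁻¹ ^ n = z * q by rw [hz, pow_succ]; field_simp,
          show (z - 1) * qPoch (z * q) q (j + 1) = -((1 - z) * qPoch (z * q) q (j + 1)) by ring,
          ← qPoch_succ', qPoch_succ, qPoch_succ, ← hy, hqj, mul_div_assoc]
      have p2 : qPoch (a * b * q ^ (n + 1)) q (j + 1) = (1 - m / q) * qPoch m q j := by
        rw [show a * b * q ^ (n + 1) = m / q by rw [hm, pow_succ _ (n + 1)]; field_simp,
          qPoch_succ', div_mul_cancel₀ _ hq]
      rw [Nat.add_sub_cancel, hs, p2, show (z - 1) * (qPoch (q⁻¹ ^ n) q (j + 1) *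
        ((1 - m / q) * qPoch m q j) / (P * D) * y) = ((z - 1) * qPoch (q⁻¹ ^ n) q (j + 1)) *
        ((1 - m / q) * qPoch m q j) / (P * D) * y by ring, p1, hK']
      field_simp
  have main := rac_poly (a := a) (c := c) (e := e) hq hy0 h1 h2 h3
  rw [← hbd, ← hD, ← he] at main
  have hlast : (q ^ j)⁻¹ * K = K * q / D * (y⁻¹ * D) := by
    rw [hqj]; field_simp
  rw [racA_eq hz0 hb he h1 h2, racC_eq hq ha hz0 hb he h1 h3, ← hK, hlast, c0, ← hy]
  linear_combination K * q / D * main +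
    (z - a * q) * (1 - m * e) * (z - c * q) / ((z - m) * (z - m * q)) * c1 +
    (q * a - m) * (q * c - m) * (e * z - 1) / ((q * z - m) * (z - m)) * c2

theorem racCoeff_zero (n : ℕ) : racCoeff a b c d q n 0 = 1 := by simp [racCoeff, qPoch_zero]

/-- The three-term recurrence for partial sums. -/
theorem racCoeff_rec_sum {n x : ℕ} (hq : q ≠ 0) (N : ℕ)
    (hden : ∀ j < N, q * q ^ j ≠ 1 ∧ a * q * q ^ j ≠ 1 ∧ b * d * q * q ^ j ≠ 1 ∧
      c * q * q ^ j ≠ 1)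
    {z m : F} (hz : z = q⁻¹ ^ n) (hm : m = a * b * q ^ (n + 1)) (ha : a ≠ 0)
    (h1 : z - m ≠ 0) (h2 : z - m * q ≠ 0) (h3 : q * z - m ≠ 0) :
    racA a b c d q z m * ∑ j ∈ Finset.range (N + 1),
        racCoeff a b c d q (n + 1) j * racBasis c d q x j -
      (racA a b c d q z m + racC a b c d q z m) * ∑ j ∈ Finset.range (N + 1),
        racCoeff a b c d q n j * racBasis c d q x j +
      racC a b c d q z m * ∑ j ∈ Finset.range (N + 1),
        racCoeff a b c d q (n - 1) j * racBasis c d q x j =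
    -((1 - q⁻¹ ^ x) * (1 - c * d * q ^ (x + 1))) * ∑ j ∈ Finset.range (N + 1),
        racCoeff a b c d q n j * racBasis c d q x j +
      (q ^ N)⁻¹ * racCoeff a b c d q n N * racBasis c d q x (N + 1) := by
  induction N with
  | zero =>
    -- All constant coefficients are `1`, so the left side of the recurrence is zero and only the
    -- expansion of the eigenvalue times the first basis element remains.
    have := racBasis_mul (c := c) (d := d) hq x 0
    simp only [pow_zero, inv_one, sub_self, zero_mul, zero_add, one_mul] at this
    simp only [zero_add, Finset.sum_range_one, racCoeff_zero, one_mul, pow_zero, inv_one]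
    linear_combination this
  | succ N ih =>
    have ih := ih fun j hj => hden j (by omega)
    have h := racCoeff_rec hq (hden N (by omega)) hz hm ha h1 h2 h3
    have hb := racBasis_mul (c := c) (d := d) hq x (N + 1)
    simp only [Finset.sum_range_succ _ (N + 1)]
    linear_combination ih + racBasis c d q x (N + 1) * h + racCoeff a b c d q n (N + 1) * hb

/-- The three-term recurrence of the `q`-Racah polynomials. The last hypothesis covers the case in
which `R_{n+1}` is not defined. -/
theorem qRacah_rec {n x : ℕ} (hq : q ≠ 0)
    (hden : ∀ j < n, q * q ^ j ≠ 1 ∧ a * q * q ^ j ≠ 1 ∧ b * d * q * q ^ j ≠ 1 ∧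
      c * q * q ^ j ≠ 1)
    {z m : F} (hz : z = q⁻¹ ^ n) (hm : m = a * b * q ^ (n + 1)) (ha : a ≠ 0)
    (h1 : z - m ≠ 0) (h2 : z - m * q ≠ 0) (h3 : q * z - m ≠ 0)
    (hlast : (q * q ^ n ≠ 1 ∧ a * q * q ^ n ≠ 1 ∧ b * d * q * q ^ n ≠ 1 ∧ c * q * q ^ n ≠ 1) ∨
      (racA a b c d q z m = 0 ∧ x ≤ n)) :
    racA a b c d q z m * qRacah (n + 1) x a b c d q -
      (racA a b c d q z m + racC a b c d q z m) * qRacah n x a b c d q +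
      racC a b c d q z m * qRacah (n - 1) x a b c d q =
    -((1 - q⁻¹ ^ x) * (1 - c * d * q ^ (x + 1))) * qRacah n x a b c d q := by
  rcases hlast with h | ⟨hA, hx⟩
  -- Summing up to `n + 1` includes all of `R_{n+1}`, and the boundary term contains the coefficient
  -- of `R_n` of index `n + 1`, which is zero.
  · have := racCoeff_rec_sum (x := x) hq (n + 1) (fun j hj => by
      rcases Nat.lt_succ_iff_lt_or_eq.1 hj with h' | rfl
      · exact hden j h'
      · exact h) hz hm ha h1 h2 h3
    rw [qRacah_eq hq x (le_refl (n + 1)), qRacah_eq hq x (Nat.le_succ n),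
      qRacah_eq hq x (show n - 1 ≤ n + 1 by omega)]
    rw [this, racCoeff, qPoch_inv_pow hq (Nat.lt_succ_self n)]
    simp
  -- Here the sum stops at `n`, so no denominator of index `n + 1` is needed. The boundary term
  -- contains `(q^(-x); q)_{n+1}`, which vanishes for `x ≤ n`, and the truncated `R_{n+1}` is
  -- multiplied by zero.
  · have := racCoeff_rec_sum (x := x) hq n hden hz hm ha h1 h2 h3
    rw [qRacah_eq hq x (le_refl n), qRacah_eq hq x (Nat.sub_le n 1)]
    rw [racBasis, qPoch_inv_pow hq (Nat.lt_succ_of_le hx)] at this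
    rw [hA] at this ⊢
    linear_combination this

end Racah

/-! # The matrix of the Casimir element -/

section MatrixIdentities

open HRep

variable {F : Type*} [Field F]

/-- The denominators that occur in the matrix of the Casimir element are nonzero. -/
structure CasNonDeg (x u₁ u₂ s t Q : F) : Prop where
  x0 : x ≠ 0
  u₁0 : u₁ ≠ 0
  u₂0 : u₂ ≠ 0
  s0 : s ≠ 0
  t0 : t ≠ 0
  Q0 : Q ≠ 0
  x1 : 1 - x ≠ 0
  e0 : u₂ * t ^ 4 - x ≠ 0
  e2 : u₂ * t ^ 4 - x * Q ^ 2 ≠ 0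
  e4 : u₂ * t ^ 4 - x * Q ^ 4 ≠ 0
  f4 : u₁ * u₂ * s ^ 4 * t ^ 4 - x * Q ^ 4 ≠ 0
  f2 : u₁ * u₂ * s ^ 2 * t ^ 4 - x * Q ^ 2 ≠ 0

/-- The coefficient of `γ β` in the Casimir element up to a constant. -/
def casFactor (x u₁ u₂ s t Q : F) : F :=
  Q⁻¹ * x⁻¹ * (1 - x * Q ^ 4 / (u₁ * u₂ * s ^ 4 * t ^ 4)) * (1 - x)

/-- `A_k` for the parameters of the eigenvectors, with `s = q^(p-k)` and `t = q^k`. -/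
def casA (x u₁ u₂ s t Q : F) : F :=
  racA (1 / (x * Q ^ 2)) (u₂ / Q ^ 2) (1 / (s ^ 2 * t ^ 2 * Q ^ 2))
    (Q ^ 2 / (u₁ * u₂ * s ^ 2 * t ^ 2)) (Q ^ 2) (1 / t ^ 2) (u₂ * t ^ 2 / (x * Q ^ 2))

/-- `C_k` for the parameters of the eigenvectors, with `s = q^(p-k)` and `t = q^k`. -/
def casC (x u₁ u₂ s t Q : F) : F :=
  racC (1 / (x * Q ^ 2)) (u₂ / Q ^ 2) (1 / (s ^ 2 * t ^ 2 * Q ^ 2))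
    (Q ^ 2 / (u₁ * u₂ * s ^ 2 * t ^ 2)) (Q ^ 2) (1 / t ^ 2) (u₂ * t ^ 2 / (x * Q ^ 2))

/-- The quotient of two consecutive weights. -/
def casRatio (x u₁ u₂ s t Q : F) : F :=
  -(u₁ * u₂ * (s * t) ^ 3 / Q) * ((1 - t ^ 2 / x) * (1 - Q ^ 2 / (u₁ * s ^ 2)) * (1 - 1 / s ^ 2)) /
    ((1 - t ^ 2 * Q ^ 2) * (1 - u₂ * t ^ 2) * (1 - u₁ * u₂ * s ^ 2 * t ^ 4 / (x * Q ^ 2)))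

variable {x u₁ u₂ s t Q : F}

/-- The factored form displays the zero at `s = 1`, that is at `k = p`, where the recurrence must
stop. Likewise `casC_eq` displays the zero at `t = 1`, that is at `k = 0`. -/
theorem casA_eq (h : CasNonDeg x u₁ u₂ s t Q) : casA x u₁ u₂ s t Q =
    (x - t ^ 2) * (x * Q ^ 2 - u₂ * t ^ 2) * (u₁ * s ^ 2 - Q ^ 2) * (s ^ 2 - 1) /
      (u₁ * s ^ 4 * ((u₂ * t ^ 4 - x * Q ^ 2) * (u₂ * t ^ 4 - x))) := by
  obtain ⟨n1, n2, n3, n4, n5, n6, n7, n8, n9, n10, n11, n12⟩ := h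
  rw [casA, racA]
  have h1 : 1 - u₂ * t ^ 2 / (x * Q ^ 2) / (1 / t ^ 2) =
    -(u₂ * t ^ 4 - x * Q ^ 2) / (x * Q ^ 2) := by field_simp; ring
  have h2 : 1 - u₂ * t ^ 2 / (x * Q ^ 2) * Q ^ 2 / (1 / t ^ 2) =
    -(u₂ * t ^ 4 - x) / x := by field_simp; ring
  have h3 : 1 - 1 / (x * Q ^ 2) * Q ^ 2 / (1 / t ^ 2) = (x - t ^ 2) / x := by field_simp
  have h4 : 1 - u₂ * t ^ 2 / (x * Q ^ 2) = (x * Q ^ 2 - u₂ * t ^ 2) / (x * Q ^ 2) := by field_simp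
  have h5 : 1 - u₂ / Q ^ 2 * (Q ^ 2 / (u₁ * u₂ * s ^ 2 * t ^ 2)) * Q ^ 2 / (1 / t ^ 2) =
    (u₁ * s ^ 2 - Q ^ 2) / (u₁ * s ^ 2) := by field_simp
  have h6 : 1 - 1 / (s ^ 2 * t ^ 2 * Q ^ 2) * Q ^ 2 / (1 / t ^ 2) = (s ^ 2 - 1) / s ^ 2 := by
    field_simp
  rw [h1, h2, h3, h4, h5, h6]
  -- Turning the denominators into atoms keeps their nonvanishing available to `field_simp` and
  -- prevents their expansion.
  generalize u₂ * t ^ 4 - x * Q ^ 2 = d1 at *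
  generalize u₂ * t ^ 4 - x = d2 at *
  field_simp

theorem casC_eq (h : CasNonDeg x u₁ u₂ s t Q) : casC x u₁ u₂ s t Q =
    (1 - t ^ 2) * (Q ^ 2 - u₂ * t ^ 2) * (x * Q ^ 2 - u₂ * s ^ 2 * t ^ 4) *
      (x * Q ^ 4 - u₁ * u₂ * s ^ 2 * t ^ 4) /
      (u₁ * u₂ * s ^ 4 * t ^ 4 * ((u₂ * t ^ 4 - x * Q ^ 2) * (u₂ * t ^ 4 - x * Q ^ 4))) := by
  obtain ⟨n1, n2, n3, n4, n5, n6, n7, n8, n9, n10, n11, n12⟩ := h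
  rw [casC, racC]
  have h1 : 1 - u₂ * t ^ 2 / (x * Q ^ 2) / (1 / t ^ 2) =
    -(u₂ * t ^ 4 - x * Q ^ 2) / (x * Q ^ 2) := by field_simp; ring
  have h2 : 1 - u₂ * t ^ 2 / (x * Q ^ 2) / (Q ^ 2 * (1 / t ^ 2)) =
    -(u₂ * t ^ 4 - x * Q ^ 4) / (x * Q ^ 4) := by field_simp; ring
  have h3 : 1 - 1 / (1 / t ^ 2) = 1 - t ^ 2 := by field_simp
  have h4 : 1 - u₂ / Q ^ 2 / (1 / t ^ 2) = (Q ^ 2 - u₂ * t ^ 2) / Q ^ 2 := by field_simp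
  have h5 : 1 / (s ^ 2 * t ^ 2 * Q ^ 2) - u₂ * t ^ 2 / (x * Q ^ 2) / Q ^ 2 =
    (x * Q ^ 2 - u₂ * s ^ 2 * t ^ 4) / (s ^ 2 * t ^ 2 * x * Q ^ 4) := by field_simp
  have h6 : Q ^ 2 / (u₁ * u₂ * s ^ 2 * t ^ 2) - 1 / (x * Q ^ 2) / (1 / t ^ 2) =
    (x * Q ^ 4 - u₁ * u₂ * s ^ 2 * t ^ 4) / (u₁ * u₂ * s ^ 2 * t ^ 2 * x * Q ^ 2) := by
    field_simp
  rw [h1, h2, h3, h4, h5, h6]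
  generalize u₂ * t ^ 4 - x * Q ^ 2 = d1 at *
  generalize u₂ * t ^ 4 - x * Q ^ 4 = d2 at *
  field_simp

theorem casFactor_eq (h : CasNonDeg x u₁ u₂ s t Q) : casFactor x u₁ u₂ s t Q =
    (u₁ * u₂ * s ^ 4 * t ^ 4 - x * Q ^ 4) * (1 - x) / (Q * x * (u₁ * u₂ * s ^ 4 * t ^ 4)) := by
  obtain ⟨n1, n2, n3, n4, n5, n6, n7, n8, n9, n10, n11, n12⟩ := h
  rw [casFactor]
  field_simp

/-- The contribution of `γβ ⊗ αδ`. -/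
theorem cas_diag₁ (h : CasNonDeg x u₁ u₂ s t Q) : casFactor x u₁ u₂ s t Q *
    (-Q⁻¹ * fA x u₂ t Q * (fB (x / Q ^ 2 / (u₂ * t ^ 4)) u₁ s Q * fD (x / Q ^ 2) t Q)) =
      casA x u₁ u₂ s t Q := by
  rw [casA_eq h, casFactor_eq h]
  obtain ⟨n1, n2, n3, n4, n5, n6, n7, n8, n9, n10, n11, n12⟩ := h
  rw [fA_eq n3 n5 rfl,
    fB_eq (d := (u₂ * t ^ 4 - x) / (u₂ * t ^ 4))
      (d' := -(u₁ * u₂ * s ^ 4 * t ^ 4 - x * Q ^ 4) / (u₂ * t ^ 4))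
      (by positivity) n6 (by field_simp) (by field_simp; ring),
    fD_eq (d := 1 - x) n5 (by field_simp)]
  generalize u₂ * t ^ 4 - x * Q ^ 2 = d1 at *
  generalize u₂ * t ^ 4 - x = d2 at *
  generalize u₁ * u₂ * s ^ 4 * t ^ 4 - x * Q ^ 4 = d3 at *
  generalize 1 - x = d4 at *
  field_simp
  ring

/-- The contribution of `δα ⊗ γβ`. -/
theorem cas_diag₂ (h : CasNonDeg x u₁ u₂ s t Q) : casFactor x u₁ u₂ s t Q *
    (-Q⁻¹ * fD (x / (u₂ * t ^ 4)) s Q *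
      (fA (x / Q ^ 2 / (u₂ * (t / Q) ^ 4)) u₁ s Q * fB (x / Q ^ 2) u₂ t Q)) =
      casC x u₁ u₂ s t Q := by
  rw [casC_eq h, casFactor_eq h]
  obtain ⟨n1, n2, n3, n4, n5, n6, n7, n8, n9, n10, n11, n12⟩ := h
  rw [fD_eq (d := (u₂ * t ^ 4 - x * Q ^ 2) / (u₂ * t ^ 4)) n4 (by field_simp),
    fA_eq (d := (u₁ * u₂ * s ^ 4 * t ^ 4 - x * Q ^ 4) / (u₂ * t ^ 4)) n2 n4 (by field_simp),
    fB_eq (d := 1 - x) (d' := -(u₂ * t ^ 4 - x * Q ^ 4)) (by positivity) n6 (by field_simp)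
      (by field_simp; ring)]
  generalize u₂ * t ^ 4 - x * Q ^ 2 = d1 at *
  generalize u₂ * t ^ 4 - x * Q ^ 4 = d2 at *
  generalize u₁ * u₂ * s ^ 4 * t ^ 4 - x * Q ^ 4 = d3 at *
  generalize 1 - x = d4 at *
  field_simp
  ring

/-- The contribution of `γα ⊗ αβ`. -/
theorem cas_upper (h : CasNonDeg x u₁ u₂ s t Q) (ht : 1 - t ^ 2 * Q ^ 2 ≠ 0)
    (hu : 1 - u₂ * t ^ 2 ≠ 0) : casFactor x u₁ u₂ s t Q *
    (-Q⁻¹ * fA x u₂ t Q * (fA (x / Q ^ 2 / (u₂ * t ^ 4)) u₁ (s / Q) Q * fB (x / Q ^ 2) u₂ (t * Q) Q)) *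
      casRatio x u₁ u₂ s t Q = - casA x u₁ u₂ s t Q := by
  rw [casA_eq h, casFactor_eq h, casRatio]
  obtain ⟨n1, n2, n3, n4, n5, n6, n7, n8, n9, n10, n11, n12⟩ := h
  rw [fA_eq n3 n5 rfl,
    fA_eq (d := (u₁ * u₂ * s ^ 4 * t ^ 4 - x * Q ^ 4) / (u₂ * t ^ 4 * Q ^ 4)) n2 (by positivity)
      (by field_simp),
    fB_eq (d := 1 - x) (d' := -Q ^ 4 * (u₂ * t ^ 4 - x)) (by positivity) n6 (by field_simp)
      (by field_simp; ring),
    show 1 - u₁ * u₂ * s ^ 2 * t ^ 4 / (x * Q ^ 2) =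
      -(u₁ * u₂ * s ^ 2 * t ^ 4 - x * Q ^ 2) / (x * Q ^ 2) by field_simp; ring,
    show u₁ * (s / Q) ^ 2 - x / Q ^ 2 / (u₂ * t ^ 4) * Q ^ 2 =
      (u₁ * u₂ * s ^ 2 * t ^ 4 - x * Q ^ 2) / (u₂ * t ^ 4 * Q ^ 2) by field_simp,
    show 1 - (t * Q) ^ 2 = 1 - t ^ 2 * Q ^ 2 by ring,
    show Q ^ 2 - u₂ * (t * Q) ^ 2 = Q ^ 2 * (1 - u₂ * t ^ 2) by ring]
  generalize u₂ * t ^ 4 - x * Q ^ 2 = d1 at *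
  generalize u₂ * t ^ 4 - x = d2 at *
  generalize u₁ * u₂ * s ^ 4 * t ^ 4 - x * Q ^ 4 = d3 at *
  generalize 1 - x = d4 at *
  generalize u₁ * u₂ * s ^ 2 * t ^ 4 - x * Q ^ 2 = d5 at *
  generalize 1 - t ^ 2 * Q ^ 2 = d6 at *
  generalize 1 - u₂ * t ^ 2 = d7 at *
  field_simp
  ring

/-- The contribution of `δβ ⊗ γδ`. -/
theorem cas_lower (h : CasNonDeg x u₁ u₂ s t Q) (hs : u₁ * u₂ * s ^ 2 * t ^ 4 - x * Q ^ 4 ≠ 0)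
    (ht : 1 - t ^ 2 ≠ 0) (hu : Q ^ 2 - u₂ * t ^ 2 ≠ 0) : casFactor x u₁ u₂ s t Q *
    (-Q⁻¹ * fD (x / (u₂ * t ^ 4)) s Q *
      (fB (x / Q ^ 2 / (u₂ * (t / Q) ^ 4)) u₁ (s * Q) Q * fD (x / Q ^ 2) (t / Q) Q)) =
      - casC x u₁ u₂ s t Q * casRatio x u₁ u₂ (s * Q) (t / Q) Q := by
  rw [casC_eq h, casFactor_eq h, casRatio]
  obtain ⟨n1, n2, n3, n4, n5, n6, n7, n8, n9, n10, n11, n12⟩ := h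
  rw [fD_eq (d := (u₂ * t ^ 4 - x * Q ^ 2) / (u₂ * t ^ 4)) n4 (by field_simp),
    fD_eq (d := 1 - x) (by positivity) (by field_simp),
    fB_eq (d := (u₂ * t ^ 4 - x * Q ^ 4) / (u₂ * t ^ 4))
      (d' := - Q ^ 4 * (u₁ * u₂ * s ^ 4 * t ^ 4 - x * Q ^ 4) / (u₂ * t ^ 4))
      (by positivity) n6 (by field_simp) (by field_simp; ring),
    show 1 - u₁ * u₂ * (s * Q) ^ 2 * (t / Q) ^ 4 / (x * Q ^ 2) =
      -(u₁ * u₂ * s ^ 2 * t ^ 4 - x * Q ^ 4) / (x * Q ^ 4) by field_simp; ring,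
    show 1 - (t / Q) ^ 2 * Q ^ 2 = 1 - t ^ 2 by field_simp,
    show 1 - u₂ * (t / Q) ^ 2 = (Q ^ 2 - u₂ * t ^ 2) / Q ^ 2 by field_simp]
  generalize u₂ * t ^ 4 - x * Q ^ 2 = d1 at *
  generalize u₂ * t ^ 4 - x * Q ^ 4 = d2 at *
  generalize u₁ * u₂ * s ^ 4 * t ^ 4 - x * Q ^ 4 = d3 at *
  generalize 1 - x = d4 at *
  rw [show x * Q ^ 4 - u₁ * u₂ * s ^ 2 * t ^ 4 = -(u₁ * u₂ * s ^ 2 * t ^ 4 - x * Q ^ 4) by ring]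
  generalize u₁ * u₂ * s ^ 2 * t ^ 4 - x * Q ^ 4 = d5 at *
  generalize 1 - t ^ 2 = d6 at *
  generalize Q ^ 2 - u₂ * t ^ 2 = d7 at *
  field_simp
  ring

end MatrixIdentities

/-! # Eigenvectors of the Casimir element in `H^{ω₁} ⊗̄ H^{ω₂}` -/

section Eigenvectors

open HRep DynTensor

variable {q : ℝ} {ω₁ ω₂ : ℂ}

theorem xq_ne_algebraMap (hq : 0 < q) (hq1 : q < 1) (c : ℂ) : xq q ≠ algebraMap ℂ Mer c :=
  Mer.qexp_ne_const hq hq1 two_ne_zero _ _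

/-- Every denominator involving `λ` is nonzero for the same reason: `q^(2λ)` is not constant.
Restrictions on `ω₁`, `ω₂` are needed only for the factors that do not contain `λ`. -/
theorem algebraMap_sub_xq_ne (hq : 0 < q) (hq1 : q < 1) (c : ℂ) (n : ℕ) :
    algebraMap ℂ Mer c - xq q * qc q ^ n ≠ 0 := by
  intro h
  have h2 : qc q ^ n ≠ 0 := pow_ne_zero _ (qc_ne hq)
  refine xq_ne_algebraMap hq hq1 (c * ((q : ℂ) ^ n)⁻¹) ?_
  rw [map_mul, map_inv₀, map_pow]
  change _ = _ * (qc q ^ n)⁻¹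
  field_simp
  linear_combination -h

theorem qc_pow_ne_one (hq : 0 < q) (hq1 : q < 1) {n : ℕ} (hn : n ≠ 0) : qc q ^ n ≠ 1 := by
  rw [← map_pow, ← map_one (algebraMap ℂ Mer)]
  intro h
  have h1 : (q : ℂ) ^ n = 1 := (algebraMap ℂ Mer).injective h
  have h2 : q ^ n = 1 := by exact_mod_cast h1
  exact (pow_lt_one₀ hq.le hq1 hn).ne h2

theorem uq_mul_pow (hq : 0 < q) (ω : ℂ) (j : ℕ) :
    uq q ω * qc q ^ (2 * j) = algebraMap ℂ Mer ((q : ℂ) ^ (2 * (ω + j))) := by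
  have h : (q : ℂ) ≠ 0 := by exact_mod_cast hq.ne'
  rw [uq, ← map_pow, ← map_mul, mul_add, Complex.cpow_add _ _ h, ← Complex.cpow_natCast]
  push_cast; rfl

theorem uq_mul_pow_ne_one (hq : 0 < q) {ω : ℂ} {j : ℕ} (h : (q : ℂ) ^ (2 * (ω + j)) ≠ 1) :
    uq q ω * qc q ^ (2 * j) ≠ 1 := by
  rw [uq_mul_pow hq, ← map_one (algebraMap ℂ Mer)]
  exact fun h' => h ((algebraMap ℂ Mer).injective h')

theorem casNonDeg (hq : 0 < q) (hq1 : q < 1) (ω₁ ω₂ : ℂ) (i j : ℕ) :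
    CasNonDeg (xq q) (uq q ω₁) (uq q ω₂) (qc q ^ i) (qc q ^ j) (qc q) := by
  have hc := algebraMap_sub_xq_ne hq hq1
  have h2 := hc ((q : ℂ) ^ (2 * ω₂) * ((q : ℂ) ^ j) ^ 4)
  have h4 := hc ((q : ℂ) ^ (2 * ω₁) * (q : ℂ) ^ (2 * ω₂) * ((q : ℂ) ^ i) ^ 4 * ((q : ℂ) ^ j) ^ 4)
  have h3 := hc ((q : ℂ) ^ (2 * ω₁) * (q : ℂ) ^ (2 * ω₂) * ((q : ℂ) ^ i) ^ 2 * ((q : ℂ) ^ j) ^ 4)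
  simp only [map_mul, map_pow] at h2 h3 h4
  refine ⟨xq_ne hq, uq_ne hq, uq_ne hq, pow_ne_zero _ (qc_ne hq), pow_ne_zero _ (qc_ne hq),
    qc_ne hq, ?_, ?_, h2 2, h2 4, h4 4, h3 2⟩
  · simpa using hc 1 0
  · simpa [uq] using h2 0

/-! ### The matrix of `γ β` -/

theorem T_neg_wt_xq (hq : 0 < q) (ω : ℂ) (k : ℕ) :
    Mer.T (-1 + -(ω + 2 * k)) (xq q) = xq q / qc q ^ 2 / (uq q ω * (qc q ^ k) ^ 4) := by
  rw [← Mer.T_T, T_wt_xq hq, map_div₀, T_neg_xq hq, map_mul, map_pow, map_pow, uq,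
    AlgHom.commutes, AlgHom.commutes]

variable (hq : 0 < q) (hq1 : q < 1)

/-- The matrix coefficient of `γα ⊗ αβ`. -/
noncomputable def casUp (q : ℝ) (ω₁ ω₂ : ℂ) (i j : ℕ) : Mer :=
  casFactor (xq q) (uq q ω₁) (uq q ω₂) (qc q ^ i) (qc q ^ j) (qc q) *
    (-(qc q)⁻¹ * fA (xq q) (uq q ω₂) (qc q ^ j) (qc q) *
      (fA (xq q / qc q ^ 2 / (uq q ω₂ * (qc q ^ j) ^ 4)) (uq q ω₁) (qc q ^ i / qc q) (qc q) *
        fB (xq q / qc q ^ 2) (uq q ω₂) (qc q ^ j * qc q) (qc q)))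

/-- The matrix coefficient of `δβ ⊗ γδ`. -/
noncomputable def casLo (q : ℝ) (ω₁ ω₂ : ℂ) (i j : ℕ) : Mer :=
  casFactor (xq q) (uq q ω₁) (uq q ω₂) (qc q ^ i) (qc q ^ j) (qc q) *
    (-(qc q)⁻¹ * fD (xq q / (uq q ω₂ * (qc q ^ j) ^ 4)) (qc q ^ i) (qc q) *
      (fB (xq q / qc q ^ 2 / (uq q ω₂ * (qc q ^ j / qc q) ^ 4)) (uq q ω₁) (qc q ^ i * qc q) (qc q) *
        fD (xq q / qc q ^ 2) (qc q ^ j / qc q) (qc q)))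

/-- `Δ(γ) Δ(β)` has four terms: `γβ ⊗ αδ` and `δα ⊗ γβ` are diagonal, while `γα ⊗ αβ` and `δβ ⊗ γδ`
move one step between the factors. The two diagonal terms give exactly `A_k` and `C_k`. -/
theorem co_cb (i j : ℕ) (y : DynTensor (HRep ω₁) (HRep ω₂)) :
    casFactor (xq q) (uq q ω₁) (uq q ω₂) (qc q ^ i) (qc q ^ j) (qc q) *
        co ω₁ ω₂ i j ((tRep ω₁ ω₂ hq hq1).c ((tRep ω₁ ω₂ hq hq1).b y)) =
      (casA (xq q) (uq q ω₁) (uq q ω₂) (qc q ^ i) (qc q ^ j) (qc q) +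
        casC (xq q) (uq q ω₁) (uq q ω₂) (qc q ^ i) (qc q ^ j) (qc q)) * co ω₁ ω₂ i j y +
      (if i = 0 then 0 else casUp q ω₁ ω₂ i j) * co ω₁ ω₂ (i - 1) (j + 1) y +
      (if j = 0 then 0 else casLo q ω₁ ω₂ i j) * co ω₁ ω₂ (i + 1) (j - 1) y := by
  have hn := casNonDeg hq hq1 ω₁ ω₂ i j
  have hQ := qc_ne hq
  have hT : ∀ f : Mer, Mer.T (-1) (Mer.T 1 f) = f := fun f => by rw [Mer.T_T]; norm_num
  have hTA : ∀ i j : ℕ, Mer.T (-1) (Mer.T (-(ω₂ + 2 * j)) (cA q ω₁ i)) =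
      fA (xq q / qc q ^ 2 / (uq q ω₂ * (qc q ^ j) ^ 4)) (uq q ω₁) (qc q ^ i) (qc q) :=
    fun i j => by rw [Mer.T_T, T_A hq, T_neg_wt_xq hq]
  have hTB : ∀ i j : ℕ, Mer.T (-1) (Mer.T (-(ω₂ + 2 * j)) (cB q ω₁ i)) =
      fB (xq q / qc q ^ 2 / (uq q ω₂ * (qc q ^ j) ^ 4)) (uq q ω₁) (qc q ^ i) (qc q) :=
    fun i j => by rw [Mer.T_T, T_B hq, T_neg_wt_xq hq]
  have h1 : (if i = 0 then 0 else
      casFactor (xq q) (uq q ω₁) (uq q ω₂) (qc q ^ i) (qc q ^ j) (qc q) *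
      ((-(qc q)⁻¹ * cA q ω₂ j) * Mer.T (-1) (co ω₁ ω₂ (i - 1) j ((tRep ω₁ ω₂ hq hq1).b y)))) =
      casA (xq q) (uq q ω₁) (uq q ω₂) (qc q ^ i) (qc q ^ j) (qc q) * co ω₁ ω₂ i j y +
      (if i = 0 then 0 else casUp q ω₁ ω₂ i j) * co ω₁ ω₂ (i - 1) (j + 1) y := by
    rcases i with _ | i
    -- At `i = 0` no term can come from `γ` on the left factor, in agreement with `casA = 0` at `q^i
    -- = 1`.
    · rw [casA_eq hn]; simp
    · rw [← cas_diag₁ hn, casUp]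
      simp only [Nat.add_sub_cancel, Nat.succ_ne_zero, if_false, co_b, map_add, map_mul, hT,
        hTA, hTB]
      simp only [T_B hq, T_D hq, T_neg_xq hq, eA hq]
      rw [pow_succ (qc q) i, pow_succ (qc q) j, mul_div_cancel_right₀ _ hQ]
      ring
  have h2 : (if j = 0 then 0 else
      casFactor (xq q) (uq q ω₁) (uq q ω₂) (qc q ^ i) (qc q ^ j) (qc q) *
      ((Mer.T (-(ω₂ + 2 * j)) (cD q i) * -(qc q)⁻¹) *
        Mer.T (-1) (co ω₁ ω₂ i (j - 1) ((tRep ω₁ ω₂ hq hq1).b y)))) =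
      casC (xq q) (uq q ω₁) (uq q ω₂) (qc q ^ i) (qc q ^ j) (qc q) * co ω₁ ω₂ i j y +
      (if j = 0 then 0 else casLo q ω₁ ω₂ i j) * co ω₁ ω₂ (i + 1) (j - 1) y := by
    rcases j with _ | j
    · rw [casC_eq hn]; simp
    · rw [← cas_diag₂ hn, casLo]
      simp only [Nat.add_sub_cancel, Nat.succ_ne_zero, if_false, co_b, map_add, map_mul, hT,
        hTA, hTB]
      simp only [T_B hq, T_D hq, T_neg_xq hq, T_wt_xq hq]
      rw [pow_succ (qc q) i, pow_succ (qc q) j, mul_div_cancel_right₀ _ hQ]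
      ring
  rw [co_c, add_mul, mul_add]
  have e1 : ∀ (P : Prop) [Decidable P] (a b c : Mer), a * ((if P then 0 else b) * c) =
      if P then 0 else a * (b * c) := by
    intro P _ a b c; split_ifs <;> simp
  rw [e1, e1, h1, h2]
  ring

/-- By `cas_upper` a zero of this entry would be a zero of `casA`. The factors of `casA` without `λ`
are `q^(2(i+1)) - 1` and, up to a power of `q`, `q^(2(ω₁+i)) - 1`; the condition on `ω₂` makes the
weight ratio in `cas_upper` well defined. -/
theorem casUp_ne_zero (hq : 0 < q) (hq1 : q < 1) {i j : ℕ} (h₁ : (q : ℂ) ^ (2 * (ω₁ + i)) ≠ 1)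
    (h₂ : (q : ℂ) ^ (2 * (ω₂ + j)) ≠ 1) : casUp q ω₁ ω₂ (i + 1) j ≠ 0 := by
  have hn := casNonDeg hq hq1 ω₁ ω₂ (i + 1) j
  have hQ := qc_ne hq
  have a1 : 1 - (qc q ^ j) ^ 2 * qc q ^ 2 ≠ 0 := by
    rw [← pow_mul, ← pow_add]
    exact sub_ne_zero.2 (qc_pow_ne_one hq hq1 (by omega)).symm
  have a2 : 1 - uq q ω₂ * (qc q ^ j) ^ 2 ≠ 0 := by
    rw [← pow_mul, mul_comm j]
    exact sub_ne_zero.2 (uq_mul_pow_ne_one hq h₂).symm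
  have h := cas_upper hn a1 a2
  intro h0
  rw [casUp] at h0
  rw [h0, zero_mul, eq_comm, neg_eq_zero, casA_eq hn] at h
  have b1 : xq q - (qc q ^ j) ^ 2 ≠ 0 := by
    have := algebraMap_sub_xq_ne hq hq1 (((q : ℂ) ^ j) ^ 2) 0
    rw [map_pow, map_pow, pow_zero, mul_one] at this
    rw [← neg_sub]; exact neg_ne_zero.2 this
  have b2 : xq q * qc q ^ 2 - uq q ω₂ * (qc q ^ j) ^ 2 ≠ 0 := by
    have := algebraMap_sub_xq_ne hq hq1 ((q : ℂ) ^ (2 * ω₂) * ((q : ℂ) ^ j) ^ 2) 2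
    rw [map_mul, map_pow, map_pow] at this
    rw [← neg_sub]; exact neg_ne_zero.2 this
  have b3 : uq q ω₁ * (qc q ^ (i + 1)) ^ 2 - qc q ^ 2 ≠ 0 := by
    have : uq q ω₁ * (qc q ^ (i + 1)) ^ 2 - qc q ^ 2 =
      qc q ^ 2 * (uq q ω₁ * qc q ^ (2 * i) - 1) := by ring
    rw [this]
    exact mul_ne_zero (pow_ne_zero _ hQ) (sub_ne_zero.2 (uq_mul_pow_ne_one hq h₁))
  have b4 : (qc q ^ (i + 1)) ^ 2 - 1 ≠ 0 := by
    rw [← pow_mul]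
    exact sub_ne_zero.2 (qc_pow_ne_one hq hq1 (by omega))
  refine div_ne_zero (mul_ne_zero (mul_ne_zero (mul_ne_zero b1 b2) b3) b4) ?_ h
  exact mul_ne_zero (mul_ne_zero hn.u₁0 (pow_ne_zero _ hn.s0)) (mul_ne_zero hn.e2 hn.e0)

/-- An eigenvector of `γ β` in a weight space is determined by its coordinate at `e_p ⊗ e_0`. -/
theorem eq_zero_of_cb {p : ℕ}
    (h : ∀ j : ℕ, j < p → (q : ℂ) ^ (2 * (ω₁ + j)) ≠ 1 ∧ (q : ℂ) ^ (2 * (ω₂ + j)) ≠ 1)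
    {y : DynTensor (HRep ω₁) (HRep ω₂)} (hy : y ∈ wtSpace _ (ω₁ + ω₂ + 2 * p)) {κ : Mer}
    (hκ : (tRep ω₁ ω₂ hq hq1).c ((tRep ω₁ ω₂ hq hq1).b y) = κ • y)
    (h0 : co ω₁ ω₂ p 0 y = 0) : y = 0 := by
  have key : ∀ n, ∀ i j, j ≤ n → i + j = p → co ω₁ ω₂ i j y = 0 := by
    intro n
    induction n with
    | zero =>
      intro i j hj hij
      obtain rfl : j = 0 := by omega
      obtain rfl : i = p := by omega
      exact h0
    | succ n ih =>
      intro i j hj hij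
      rcases Nat.lt_or_ge n j with hn | hn
      · obtain rfl : j = n + 1 := by omega
        -- In this row of the eigenvector equation the coordinates with second index at most `n` are
        -- already zero. What remains is a nonvanishing entry times the coordinate at `e_i ⊗
        -- e_{n+1}`.
        have h1 := co_cb hq hq1 (i + 1) n y
        rw [hκ, map_smul, ih (i + 1) n le_rfl (by omega), if_neg (Nat.succ_ne_zero i)] at h1
        have h2 : (if n = 0 then 0 else casLo q ω₁ ω₂ (i + 1) n) *
            co ω₁ ω₂ (i + 1 + 1) (n - 1) y = 0 := by
          split_ifs with hn0
          · rw [zero_mul]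
          · rw [ih (i + 1 + 1) (n - 1) (by omega) (by omega), mul_zero]
        rw [h2] at h1
        simp only [smul_zero, mul_zero, zero_add, add_zero, Nat.add_sub_cancel] at h1
        exact (mul_eq_zero.1 h1.symm).resolve_left
          (casUp_ne_zero hq hq1 (h i (by omega)).1 (h n (by omega)).2)
      · exact ih i j hn hij
  refine ext_co fun i j => ?_
  rw [map_zero]
  by_cases hij : i + j = p
  · exact key j i j le_rfl hij
  · exact co_eq_zero hy hij

/-- The eigenspaces of the tridiagonal operator are at most one-dimensional: subtracting the right
multiple of `v` removes the coordinate at `e_p ⊗ e_0`, and then `eq_zero_of_cb` applies. -/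
theorem eq_smul_of_cb {p : ℕ}
    (h : ∀ j : ℕ, j < p → (q : ℂ) ^ (2 * (ω₁ + j)) ≠ 1 ∧ (q : ℂ) ^ (2 * (ω₂ + j)) ≠ 1)
    {y v : DynTensor (HRep ω₁) (HRep ω₂)} (hy : y ∈ wtSpace _ (ω₁ + ω₂ + 2 * p))
    (hv : v ∈ wtSpace _ (ω₁ + ω₂ + 2 * p)) {κ : Mer}
    (hκ : (tRep ω₁ ω₂ hq hq1).c ((tRep ω₁ ω₂ hq hq1).b y) = κ • y)
    (hκ' : (tRep ω₁ ω₂ hq hq1).c ((tRep ω₁ ω₂ hq hq1).b v) = κ • v)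
    (h0 : co ω₁ ω₂ p 0 v = 1) : y = co ω₁ ω₂ p 0 y • v := by
  rw [← sub_eq_zero]
  refine eq_zero_of_cb hq hq1 h (Submodule.sub_mem _ hy (Submodule.smul_mem _ _ hv)) (κ := κ) ?_ ?_
  · rw [map_sub, map_sub, DynRep.b_smul, DynRep.c_smul, Mer.T_T, neg_add_cancel, Mer.T_zero, hκ,
      hκ', smul_sub, smul_comm]
  · rw [map_sub, map_smul, h0, smul_eq_mul, mul_one, sub_self]

end Eigenvectors

section EigVec

open HRep DynTensor

variable {q : ℝ} {ω₁ ω₂ : ℂ}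

/-! ### Powers of `q` -/

/-- The constant `q^z`. -/
noncomputable def kq (q : ℝ) (z : ℂ) : Mer := algebraMap ℂ Mer ((q : ℂ) ^ z)

theorem kq_add (hq : 0 < q) (z w : ℂ) : kq q (z + w) = kq q z * kq q w := by
  rw [kq, Complex.cpow_add _ _ (by exact_mod_cast hq.ne'), map_mul]; rfl

theorem kq_neg (z : ℂ) : kq q (-z) = (kq q z)⁻¹ := by
  rw [kq, Complex.cpow_neg, map_inv₀]; rfl

theorem kq_sub (hq : 0 < q) (z w : ℂ) : kq q (z - w) = kq q z / kq q w := by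
  rw [sub_eq_add_neg, kq_add hq, kq_neg, div_eq_mul_inv]

theorem kq_nat (n : ℕ) : kq q n = qc q ^ n := by
  rw [kq, Complex.cpow_natCast, map_pow]

theorem kq_one : kq q 1 = qc q := by rw [kq, Complex.cpow_one]

theorem kq_nat_mul (n : ℕ) (z : ℂ) : kq q (n * z) = kq q z ^ n := by
  rw [kq, Complex.cpow_nat_mul, map_pow]; rfl

theorem kq_two_mul (z : ℂ) : kq q (2 * z) = kq q z ^ 2 := by
  have := kq_nat_mul (q := q) 2 z
  push_cast at this
  exact this

theorem uq_eq_kq (ω : ℂ) : uq q ω = kq q ω ^ 2 := by rw [← kq_two_mul]; rfl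

theorem kq_ne (hq : 0 < q) (z : ℂ) : kq q z ≠ 0 := by
  rw [kq, ← Mer.qexp_zero_left]; exact Mer.qexp_ne_zero hq _ _

theorem qexp_zero_eq (z : ℂ) : Mer.qexp q 0 z = kq q z := Mer.qexp_zero_left z

theorem qexp_two_eq (hq : 0 < q) (z : ℂ) : Mer.qexp q 2 z = kq q z * xq q :=
  Mer.qexp_split hq 2 z

theorem qexp_neg_two_eq (hq : 0 < q) (z : ℂ) : Mer.qexp q (-2) z = kq q z / xq q := by
  rw [eq_div_iff (xq_ne hq), xq, Mer.qexp_mul hq, neg_add_cancel, add_zero, qexp_zero_eq]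

/-- Splitting off the constant `q^(w-1)` leaves a rational function of `q^(2λ)`, `q^(2ω₁)`,
`q^(2ω₂)`, `q^i`, `q^j` and `q`, in which the matrix identities are stated. -/
theorem casCoeff_eq (hq : 0 < q) (i j : ℕ) : casCoeff q (ω₁ + ω₂ + 2 * (i + j)) =
    kq q (ω₁ + ω₂ + 2 * (i + j) - 1) *
      casFactor (xq q) (uq q ω₁) (uq q ω₂) (qc q ^ i) (qc q ^ j) (qc q) := by
  have h1 := qc_ne hq
  have h2 := xq_ne hq
  have h3 := kq_ne hq ω₁
  have h4 := kq_ne hq ω₂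
  set w := ω₁ + ω₂ + 2 * ((i : ℂ) + j) with hw
  have hkw : kq q w = kq q ω₁ * kq q ω₂ * (qc q ^ i * qc q ^ j) ^ 2 := by
    rw [hw, kq_add hq, kq_add hq, kq_two_mul, kq_add hq, kq_nat, kq_nat]
  rw [casCoeff, map_mul, map_sub, map_one, Mer.T_qexp, Mer.T_qexp,
    show ∀ a b c d : Mer, a * b * (c * d) = (a * c) * (b * d) by intros; ring, Mer.qexp_mul hq,
    show (-1 : ℂ) + -1 = -2 by ring, qexp_neg_two_eq hq, qexp_two_eq hq, casFactor,
    show -2 + -1 * -w + 0 = w - 1 - 1 by ring, show 4 + 2 * -w = ((4 : ℕ) : ℂ) - 2 * w by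
      push_cast; ring, kq_sub hq (w - 1), kq_one, kq_sub hq _ (2 * w), kq_nat, kq_two_mul, hkw,
    uq_eq_kq, uq_eq_kq]
  change _ * (_ * (1 - xq q)) = _
  have e : 1 - qc q ^ 4 / (kq q ω₁ * kq q ω₂ * (qc q ^ i * qc q ^ j) ^ 2) ^ 2 * xq q =
      1 - xq q * qc q ^ 4 / (kq q ω₁ ^ 2 * kq q ω₂ ^ 2 * (qc q ^ i) ^ 4 * (qc q ^ j) ^ 4) := by
    congr 1
    ring
  rw [e]
  field_simp

theorem casFactor_ne_zero (hq : 0 < q) (hq1 : q < 1) (i j : ℕ) :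
    casFactor (xq q) (uq q ω₁) (uq q ω₂) (qc q ^ i) (qc q ^ j) (qc q) ≠ 0 := by
  have h := casNonDeg hq hq1 ω₁ ω₂ i j
  rw [casFactor_eq h]
  obtain ⟨n1, n2, n3, n4, n5, n6, n7, n8, n9, n10, n11, n12⟩ := h
  positivity

/-! ### The coefficients of the eigenvectors -/

open Mer in
/-- The factor of `v_k` in front of the `q`-Racah polynomial. -/
noncomputable def eigWeight (q : ℝ) (ω₁ ω₂ : ℂ) (p k : ℕ) : Mer :=
  (-1) ^ k * qexp q 0 (2 * k * (ω₁ + ω₂) + k * (3 * p - 1)) *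
    (qPoch (qexp q (-2) 0) (qc q ^ 2) k *
        qPoch (qexp q 0 (-2 * (ω₁ + p - 1))) (qc q ^ 2) k *
        qPoch (qexp q 0 (-2 * p)) (qc q ^ 2) k) /
      (qPoch (qc q ^ 2) (qc q ^ 2) k * qPoch (qexp q 0 (2 * ω₂)) (qc q ^ 2) k *
        qPoch (qexp q (-2) (2 * (ω₁ + ω₂ + p - 1))) (qc q ^ 2) k)

theorem kq_par₁ (hq : 0 < q) (i j : ℕ) : kq q (-2 * (ω₁ + (i + j : ℕ) - 1)) =
    qc q ^ 2 / (uq q ω₁ * (qc q ^ i) ^ 2 * (qc q ^ j) ^ 2) := by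
  rw [neg_mul, kq_neg, kq_two_mul, kq_sub hq, kq_add hq, kq_nat, kq_one, uq_eq_kq, pow_add,
    ← inv_pow, inv_div, div_pow, mul_pow, mul_pow, mul_assoc]

theorem kq_par₂ (i j : ℕ) : kq q (-2 * ((i + j : ℕ) : ℂ)) =
    1 / ((qc q ^ i) ^ 2 * (qc q ^ j) ^ 2) := by
  rw [neg_mul, kq_neg, kq_two_mul, kq_nat, pow_add, mul_pow, one_div]

theorem kq_par₃ (hq : 0 < q) (i j : ℕ) : kq q (2 * (ω₁ + ω₂ + (i + j : ℕ) - 1)) =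
    uq q ω₁ * uq q ω₂ * (qc q ^ i) ^ 2 * (qc q ^ j) ^ 2 / qc q ^ 2 := by
  rw [kq_two_mul, kq_sub hq, kq_add hq, kq_add hq, kq_nat, kq_one, uq_eq_kq, uq_eq_kq, pow_add]
  simp only [div_pow, mul_pow, mul_assoc]

theorem kq_par₄ (hq : 0 < q) (i j : ℕ) : kq q (-2 * (ω₁ + ω₂ + (i + j : ℕ) - 1)) =
    qc q ^ 2 / (uq q ω₁ * uq q ω₂ * (qc q ^ i) ^ 2 * (qc q ^ j) ^ 2) := by
  rw [neg_mul, kq_neg, kq_par₃ hq, inv_div]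

theorem kq_par₅ (hq : 0 < q) (i j : ℕ) : kq q (-2 * (((i + j : ℕ) : ℂ) + 1)) =
    1 / ((qc q ^ i) ^ 2 * (qc q ^ j) ^ 2 * qc q ^ 2) := by
  rw [neg_mul, kq_neg, kq_two_mul, kq_add hq, kq_one, kq_nat, pow_add, mul_pow, mul_pow, one_div]

theorem kq_par₆ (hq : 0 < q) : kq q (2 * (ω₂ - 1)) = uq q ω₂ / qc q ^ 2 := by
  rw [kq_two_mul, kq_sub hq, kq_one, uq_eq_kq, div_pow]

theorem kq_par₇ : kq q (-2) / xq q = 1 / (xq q * qc q ^ 2) := by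
  rw [show (-2 : ℂ) = -((2 : ℕ) : ℂ) by norm_num, kq_neg, kq_nat]
  field_simp

theorem kq_par₈ (hq : 0 < q) (i j k : ℕ) :
    kq q (2 * (k + 1 : ℕ) * (ω₁ + ω₂) + (k + 1 : ℕ) * (3 * (i + j : ℕ) - 1)) =
      kq q (2 * k * (ω₁ + ω₂) + k * (3 * (i + j : ℕ) - 1)) *
        (uq q ω₁ * uq q ω₂ * (qc q ^ i * qc q ^ j) ^ 3 / qc q) := by
  have h : kq q (2 * ω₁ + 2 * ω₂ + (3 : ℕ) * (i + j : ℕ) - 1) =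
      uq q ω₁ * uq q ω₂ * (qc q ^ i * qc q ^ j) ^ 3 / qc q := by
    rw [kq_sub hq, kq_add hq, kq_add hq, kq_nat_mul, kq_nat, kq_one, pow_add, kq_two_mul,
      kq_two_mul, uq_eq_kq, uq_eq_kq]
  rw [← h, ← kq_add hq]
  congr 1
  push_cast
  ring

/-- Each shifted factorial gains one factor. With `p = i + k` the powers of `q^k` inside these
factors combine so that the ratio becomes rational in `q^i` and `q^k`, as the matrix identities
require. -/
theorem eigWeight_succ (hq : 0 < q) (i k : ℕ) : eigWeight q ω₁ ω₂ (i + k) (k + 1) =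
    eigWeight q ω₁ ω₂ (i + k) k *
      casRatio (xq q) (uq q ω₁) (uq q ω₂) (qc q ^ i) (qc q ^ k) (qc q) := by
  have h1 := qc_ne hq
  have h2 := xq_ne hq
  have h3 := uq_ne (ω := ω₁) hq
  have h4 := uq_ne (ω := ω₂) hq
  have h5 := pow_ne_zero i h1
  have h6 := pow_ne_zero k h1
  have k0 : kq q 0 = 1 := by rw [← Nat.cast_zero, kq_nat, pow_zero]
  have e1 : Mer.qexp q 0 (2 * (k + 1 : ℕ) * (ω₁ + ω₂) + (k + 1 : ℕ) * (3 * (i + k : ℕ) - 1)) =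
      Mer.qexp q 0 (2 * k * (ω₁ + ω₂) + k * (3 * (i + k : ℕ) - 1)) *
        (uq q ω₁ * uq q ω₂ * (qc q ^ i * qc q ^ k) ^ 3 / qc q) := by
    rw [qexp_zero_eq, kq_par₈ hq, qexp_zero_eq]
  rw [eigWeight, eigWeight, e1, casRatio]
  simp only [qPoch_succ]
  have f1 : 1 - Mer.qexp q (-2) 0 * (qc q ^ 2) ^ k = 1 - (qc q ^ k) ^ 2 / xq q := by
    rw [qexp_neg_two_eq hq, k0, ← pow_mul, ← pow_mul, mul_comm k]; ring
  have f2 : 1 - Mer.qexp q 0 (-2 * (ω₁ + (i + k : ℕ) - 1)) * (qc q ^ 2) ^ k =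
      1 - qc q ^ 2 / (uq q ω₁ * (qc q ^ i) ^ 2) := by
    rw [qexp_zero_eq, kq_par₁ hq, ← pow_mul (qc q) 2, mul_comm 2 k, pow_mul (qc q) k]
    field_simp
  have f3 : 1 - Mer.qexp q 0 (-2 * (i + k : ℕ)) * (qc q ^ 2) ^ k = 1 - 1 / (qc q ^ i) ^ 2 := by
    rw [qexp_zero_eq, kq_par₂, ← pow_mul (qc q) 2, mul_comm 2 k, pow_mul (qc q) k]
    field_simp
  have f4 : 1 - qc q ^ 2 * (qc q ^ 2) ^ k = 1 - (qc q ^ k) ^ 2 * qc q ^ 2 := by ring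
  have f5 : 1 - Mer.qexp q 0 (2 * ω₂) * (qc q ^ 2) ^ k = 1 - uq q ω₂ * (qc q ^ k) ^ 2 := by
    rw [qexp_zero_eq, ← pow_mul, ← pow_mul, mul_comm k]; rfl
  have f6 : 1 - Mer.qexp q (-2) (2 * (ω₁ + ω₂ + (i + k : ℕ) - 1)) * (qc q ^ 2) ^ k =
      1 - uq q ω₁ * uq q ω₂ * (qc q ^ i) ^ 2 * (qc q ^ k) ^ 4 / (xq q * qc q ^ 2) := by
    rw [qexp_neg_two_eq hq, kq_par₃ hq, ← pow_mul (qc q) 2, mul_comm 2 k, pow_mul (qc q) k]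
    field_simp
  rw [f1, f2, f3, f4, f5, f6, pow_succ (-1 : Mer)]
  simp only [div_eq_mul_inv, mul_inv]
  ring

theorem eigCoeff_eq (hq : 0 < q) (y i j k : ℕ) : eigCoeff q ω₁ ω₂ y (i + j) k =
    eigWeight q ω₁ ω₂ (i + j) k * qRacah k (i + j - y) (1 / (xq q * qc q ^ 2))
      (uq q ω₂ / qc q ^ 2) (1 / ((qc q ^ i) ^ 2 * (qc q ^ j) ^ 2 * qc q ^ 2))
      (qc q ^ 2 / (uq q ω₁ * uq q ω₂ * (qc q ^ i) ^ 2 * (qc q ^ j) ^ 2)) (qc q ^ 2) := by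
  rw [eigCoeff, ← eigWeight, qexp_neg_two_eq hq, qexp_zero_eq, qexp_zero_eq, qexp_zero_eq,
    kq_par₄ hq, kq_par₅ hq, kq_par₆ hq, kq_par₇]

theorem eigCoeff_zero (y p : ℕ) : eigCoeff q ω₁ ω₂ y p 0 = 1 := by
  have k0 : kq q 0 = 1 := by rw [← Nat.cast_zero, kq_nat, pow_zero]
  simp [eigCoeff, qPoch_zero, qRacah, qexp_zero_eq, k0]

/-- The weights turn the off-diagonal entries into `-A_k` and `-C_k`, so the row of the matrix
becomes minus the left side of the `q`-Racah recurrence. The degree of the polynomial is the index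
`k` of the basis vector, and its argument `p - y` labels the eigenvalue. -/
theorem eigCoeff_rec (hq : 0 < q) (hq1 : q < 1) {i k y : ℕ} (hy : y ≤ i + k)
    (h : ∀ j : ℕ, j < i + k → (q : ℂ) ^ (2 * (ω₁ + j)) ≠ 1 ∧ (q : ℂ) ^ (2 * (ω₂ + j)) ≠ 1) :
    (casA (xq q) (uq q ω₁) (uq q ω₂) (qc q ^ i) (qc q ^ k) (qc q) +
        casC (xq q) (uq q ω₁) (uq q ω₂) (qc q ^ i) (qc q ^ k) (qc q)) *
        eigCoeff q ω₁ ω₂ y (i + k) k +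
      (if i = 0 then 0 else casUp q ω₁ ω₂ i k) * eigCoeff q ω₁ ω₂ y (i + k) (k + 1) +
      (if k = 0 then 0 else casLo q ω₁ ω₂ i k) * eigCoeff q ω₁ ω₂ y (i + k) (k - 1) =
    (1 - (qc q ^ 2)⁻¹ ^ (i + k - y)) * (1 - (1 / ((qc q ^ i) ^ 2 * (qc q ^ k) ^ 2 * qc q ^ 2)) *
      (qc q ^ 2 / (uq q ω₁ * uq q ω₂ * (qc q ^ i) ^ 2 * (qc q ^ k) ^ 2)) *
        (qc q ^ 2) ^ (i + k - y + 1)) * eigCoeff q ω₁ ω₂ y (i + k) k := by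
  have hn := casNonDeg hq hq1 ω₁ ω₂ i k
  have hQ := qc_ne hq
  have hu₁ := uq_ne (ω := ω₁) hq
  have hu₂ := uq_ne (ω := ω₂) hq
  have hx := xq_ne hq
  -- the coefficients next to the diagonal
  have e1 : (if i = 0 then 0 else casUp q ω₁ ω₂ i k) * eigWeight q ω₁ ω₂ (i + k) (k + 1) =
      -casA (xq q) (uq q ω₁) (uq q ω₂) (qc q ^ i) (qc q ^ k) (qc q) *
        eigWeight q ω₁ ω₂ (i + k) k := by
    split_ifs with hi
    · subst hi; rw [casA_eq hn]; simp
    · have a1 : 1 - (qc q ^ k) ^ 2 * qc q ^ 2 ≠ 0 := by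
        rw [← pow_mul, ← pow_add]
        exact sub_ne_zero.2 (qc_pow_ne_one hq hq1 (by omega)).symm
      have a2 : 1 - uq q ω₂ * (qc q ^ k) ^ 2 ≠ 0 := by
        rw [← pow_mul, mul_comm k]
        exact sub_ne_zero.2 (uq_mul_pow_ne_one hq (h k (by omega)).2).symm
      have := cas_upper hn a1 a2
      rw [eigWeight_succ hq, casUp]
      linear_combination eigWeight q ω₁ ω₂ (i + k) k * this
  have e2 : (if k = 0 then 0 else casLo q ω₁ ω₂ i k) * eigWeight q ω₁ ω₂ (i + k) (k - 1) =
      -casC (xq q) (uq q ω₁) (uq q ω₂) (qc q ^ i) (qc q ^ k) (qc q) *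
        eigWeight q ω₁ ω₂ (i + k) k := by
    rcases k with _ | k
    · rw [casC_eq hn]; simp
    · have a1 : 1 - (qc q ^ (k + 1)) ^ 2 ≠ 0 := by
        rw [← pow_mul]
        exact sub_ne_zero.2 (qc_pow_ne_one hq hq1 (by omega)).symm
      have a2 : qc q ^ 2 - uq q ω₂ * (qc q ^ (k + 1)) ^ 2 ≠ 0 := by
        rw [show qc q ^ 2 - uq q ω₂ * (qc q ^ (k + 1)) ^ 2 =
          qc q ^ 2 * (1 - uq q ω₂ * qc q ^ (2 * k)) by ring]
        exact mul_ne_zero (pow_ne_zero _ hQ)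
          (sub_ne_zero.2 (uq_mul_pow_ne_one hq (h k (by omega)).2).symm)
      have a3 : uq q ω₁ * uq q ω₂ * (qc q ^ i) ^ 2 * (qc q ^ (k + 1)) ^ 4 - xq q * qc q ^ 4 ≠ 0 := by
        have := algebraMap_sub_xq_ne hq hq1 ((q : ℂ) ^ (2 * ω₁) * (q : ℂ) ^ (2 * ω₂) *
          ((q : ℂ) ^ i) ^ 2 * ((q : ℂ) ^ (k + 1)) ^ 4) 4
        simp only [map_mul, map_pow] at this
        exact this
      have := cas_lower hn a3 a1 a2
      -- The ratio is needed one step below the current row. The position there is `(i + 1, k)`,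
      -- which has the same sum `p`, so `q^i` is multiplied by `q` and `q^(k+1)` is divided by `q`.
      have hs := eigWeight_succ (ω₁ := ω₁) (ω₂ := ω₂) hq (i + 1) k
      rw [show i + 1 + k = i + (k + 1) by ring, pow_succ (qc q) i,
        show qc q ^ k = qc q ^ (k + 1) / qc q by rw [pow_succ]; field_simp] at hs
      rw [if_neg (Nat.succ_ne_zero k), hs, Nat.add_sub_cancel, casLo, this]
      ring
  -- the recurrence of the polynomials
  have hden : ∀ j < i + k, qc q ^ 2 * (qc q ^ 2) ^ j ≠ 1 ∧
      1 / (xq q * qc q ^ 2) * qc q ^ 2 * (qc q ^ 2) ^ j ≠ 1 ∧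
      uq q ω₂ / qc q ^ 2 * (qc q ^ 2 / (uq q ω₁ * uq q ω₂ * (qc q ^ i) ^ 2 * (qc q ^ k) ^ 2)) *
        qc q ^ 2 * (qc q ^ 2) ^ j ≠ 1 ∧
      1 / ((qc q ^ i) ^ 2 * (qc q ^ k) ^ 2 * qc q ^ 2) * qc q ^ 2 * (qc q ^ 2) ^ j ≠ 1 := by
    intro j hj
    -- With `n = p - j - 1`, the product for `b d` equals `q^(-2(ω₁+n))` and the one for `c` equals
    -- `q^(-2(n+1))`. Here `0 ≤ n < p`, so the first is covered by the condition on `ω₁`; the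
    -- condition on `ω₂` was used for the weights.
    obtain ⟨n, hn⟩ : ∃ n, i + k = n + j + 1 := ⟨i + k - (j + 1), by omega⟩
    have hP : (qc q ^ i) ^ 2 * (qc q ^ k) ^ 2 = (qc q ^ 2) ^ n * (qc q ^ 2) ^ j * qc q ^ 2 := by
      rw [← mul_pow, ← pow_add, hn]; ring
    have hj0 : (qc q ^ 2) ^ j ≠ 0 := pow_ne_zero _ (pow_ne_zero _ hQ)
    refine ⟨?_, ?_, ?_, ?_⟩
    · rw [← pow_succ', ← pow_mul]
      exact qc_pow_ne_one hq hq1 (by omega)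
    · intro h0
      have := algebraMap_sub_xq_ne hq hq1 ((q : ℂ) ^ (2 * j)) 0
      rw [map_pow, pow_zero, mul_one, pow_mul] at this
      refine this ?_
      field_simp at h0
      rw [← pow_mul] at h0 ⊢
      rw [mul_comm 2 j]
      linear_combination h0
    · intro h0
      refine uq_mul_pow_ne_one hq (h n (by omega)).1 ?_
      have e : uq q ω₁ * uq q ω₂ * (qc q ^ i) ^ 2 * (qc q ^ k) ^ 2 =
          uq q ω₁ * uq q ω₂ * ((qc q ^ 2) ^ n * (qc q ^ 2) ^ j * qc q ^ 2) := by
        rw [mul_assoc, hP]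
      rw [e, show uq q ω₂ / qc q ^ 2 * (qc q ^ 2 / (uq q ω₁ * uq q ω₂ *
        ((qc q ^ 2) ^ n * (qc q ^ 2) ^ j * qc q ^ 2))) * qc q ^ 2 * (qc q ^ 2) ^ j =
          (uq q ω₁ * (qc q ^ 2) ^ n)⁻¹ by field_simp, inv_eq_one] at h0
      rw [pow_mul, h0]
    · intro h0
      refine qc_pow_ne_one hq hq1 (n := 2 * (n + 1)) (by omega) ?_
      rw [hP, show 1 / ((qc q ^ 2) ^ n * (qc q ^ 2) ^ j * qc q ^ 2 * qc q ^ 2) * qc q ^ 2 *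
        (qc q ^ 2) ^ j = ((qc q ^ 2) ^ (n + 1))⁻¹ by field_simp; ring, inv_eq_one] at h0
      rw [pow_mul, h0]
  have hx1 : ∀ n : ℕ, ∀ m : ℕ, uq q ω₂ * (qc q ^ k) ^ m - xq q * qc q ^ n ≠ 0 := by
    intro n m
    have := algebraMap_sub_xq_ne hq hq1 ((q : ℂ) ^ (2 * ω₂) * ((q : ℂ) ^ k) ^ m) n
    simp only [map_mul, map_pow] at this
    exact this
  have hrec := qRacah_rec (a := 1 / (xq q * qc q ^ 2)) (b := uq q ω₂ / qc q ^ 2)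
    (c := 1 / ((qc q ^ i) ^ 2 * (qc q ^ k) ^ 2 * qc q ^ 2))
    (d := qc q ^ 2 / (uq q ω₁ * uq q ω₂ * (qc q ^ i) ^ 2 * (qc q ^ k) ^ 2)) (q := qc q ^ 2)
    (n := k) (x := i + k - y) (z := 1 / (qc q ^ k) ^ 2)
    (m := uq q ω₂ * (qc q ^ k) ^ 2 / (xq q * qc q ^ 2)) (pow_ne_zero _ hQ)
    (fun j hj => hden j (by omega))
    (by rw [← pow_mul, inv_pow, ← pow_mul, mul_comm k, one_div])
    (by field_simp; ring)
    (one_div_ne_zero (mul_ne_zero hx (pow_ne_zero _ hQ)))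
    (by
      intro h0
      refine hn.e2 ?_
      field_simp at h0
      linear_combination -h0)
    (by
      intro h0
      refine hn.e0 ?_
      field_simp at h0
      linear_combination -h0)
    (by
      intro h0
      refine hn.e4 ?_
      field_simp at h0
      linear_combination -h0)
    (by
      -- At `i = 0` the degree is `k = p`, and `R_{p+1}` has a zero denominator because `c =
      -- q^(-2(p+1))`. There `A_p = 0` and `p - y ≤ p`, so the truncated form of the recurrence
      -- applies.
      rcases Nat.eq_zero_or_pos i with hi | hi
      · right
        refine ⟨?_, by omega⟩
        change casA _ _ _ _ _ _ = 0
        rw [casA_eq hn, hi]; simp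
      · exact Or.inl (hden k (by omega)))
  change casA _ _ _ _ _ _ * _ - (casA _ _ _ _ _ _ + casC _ _ _ _ _ _) * _ +
    casC _ _ _ _ _ _ * _ = _ at hrec
  simp only [eigCoeff_eq hq]
  -- Only the degree varies among the polynomials, so they are abbreviated by a sequence in the
  -- degree and the rest is linear algebra.
  obtain ⟨R, hR⟩ : ∃ R : ℕ → Mer, ∀ n, qRacah n (i + k - y) (1 / (xq q * qc q ^ 2))
      (uq q ω₂ / qc q ^ 2) (1 / ((qc q ^ i) ^ 2 * (qc q ^ k) ^ 2 * qc q ^ 2))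
      (qc q ^ 2 / (uq q ω₁ * uq q ω₂ * (qc q ^ i) ^ 2 * (qc q ^ k) ^ 2)) (qc q ^ 2) = R n :=
    ⟨_, fun _ => rfl⟩
  simp only [hR] at hrec ⊢
  linear_combination R (k + 1) * e1 + R (k - 1) * e2 - eigWeight q ω₁ ω₂ (i + k) k * hrec

end EigVec

section CasimirEigen

open HRep DynTensor

variable {q : ℝ} {ω₁ ω₂ : ℂ}

/-! ### Eigenvectors of the Casimir element -/

/-- The constant `q^(Ω+2y-1) + q^(1-Ω-2y)`. -/
noncomputable def casEig (q : ℝ) (Ω : ℂ) (y : ℕ) : ℂ :=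
  (q : ℂ) ^ (Ω + 2 * y - 1) + (q : ℂ) ^ (1 - Ω - 2 * y)

/-- The eigenvalue of `γ β` on the eigenvectors of `Ξ` of weight `Ω + 2p` and eigenvalue
`casEig q Ω y`. -/
noncomputable def cbEig (q : ℝ) (Ω : ℂ) (y p : ℕ) : Mer :=
  algebraMap ℂ Mer (casEig q Ω p - casEig q Ω y) / casCoeff q (Ω + 2 * p)

theorem casCoeff_ne_zero (hq : 0 < q) (hq1 : q < 1) (w : ℂ) : casCoeff q w ≠ 0 := by
  have := casCoeff_eq (ω₁ := w) (ω₂ := 0) hq 0 0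
  simp only [Nat.cast_zero, add_zero, mul_zero] at this
  rw [this]
  have h := casFactor_ne_zero (ω₁ := w) (ω₂ := 0) hq hq1 0 0
  exact mul_ne_zero (kq_ne hq _) h

section

variable {V : Type*} [AddCommGroup V] [Module ℂ V] [Module Mer V] [IsScalarTower ℂ Mer V]
  [DynSpace V] (π : DynRep q V)

/-- In weight `Ω + 2p` the scalar part of `Ξ` is `casEig q Ω p`, and the coefficient of `γβ` is
invertible. An eigenvalue of one operator is therefore an affine function of an eigenvalue of the
other. -/
theorem DynRep.Xi_eq_iff (hq : 0 < q) (hq1 : q < 1) {Ω : ℂ} {p y : ℕ} {v : V}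
    (hv : v ∈ wtSpace V (Ω + 2 * p)) :
    π.hom (FRSL2.Xi q) v = casEig q Ω y • v ↔ π.c (π.b v) = cbEig q Ω y p • v := by
  have h0 := casCoeff_ne_zero hq hq1 (Ω + 2 * p)
  have e : (q : ℂ) ^ (1 - (Ω + 2 * p)) + (q : ℂ) ^ (Ω + 2 * p - 1) = casEig q Ω p := by
    rw [casEig, add_comm, show 1 - (Ω + 2 * p) = 1 - Ω - 2 * p by ring]
  rw [π.Xi_apply hq hv, e, sub_eq_iff_eq_add', ← sub_eq_iff_eq_add, ← sub_smul, cbEig,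
    div_eq_inv_mul, mul_smul, IsScalarTower.algebraMap_smul, eq_comm]
  exact ⟨fun h => by rw [← h, inv_smul_smul₀ h0], fun h => by rw [h, smul_inv_smul₀ h0]⟩

end

/-- With `P = q^(Ω+2p-1)` and `Y = q^(Ω+2y-1)`, where `Ω = ω₁ + ω₂`, this is `(P + 1/P - Y - 1/Y) /
P = (1 - Y/P)(1 - 1/(P Y))`. The right side is the eigenvalue in the `q`-Racah recurrence at `x = p
- y`. -/
theorem casFactor_mul_cbEig (hq : 0 < q) (hq1 : q < 1) {i k y : ℕ} (hy : y ≤ i + k) :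
    casFactor (xq q) (uq q ω₁) (uq q ω₂) (qc q ^ i) (qc q ^ k) (qc q) *
      cbEig q (ω₁ + ω₂) y (i + k) =
    (1 - (qc q ^ 2)⁻¹ ^ (i + k - y)) * (1 - (1 / ((qc q ^ i) ^ 2 * (qc q ^ k) ^ 2 * qc q ^ 2)) *
      (qc q ^ 2 / (uq q ω₁ * uq q ω₂ * (qc q ^ i) ^ 2 * (qc q ^ k) ^ 2)) *
        (qc q ^ 2) ^ (i + k - y + 1)) := by
  obtain ⟨n, hn⟩ : ∃ n, i + k = n + y := ⟨i + k - y, by omega⟩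
  have hQ := qc_ne hq
  have hP : (qc q ^ i) ^ 2 * (qc q ^ k) ^ 2 = (qc q ^ n) ^ 2 * (qc q ^ y) ^ 2 := by
    rw [← mul_pow, ← pow_add, hn, pow_add, mul_pow]
  have hF := casFactor_ne_zero (ω₁ := ω₁) (ω₂ := ω₂) hq hq1 i k
  have h1 := kq_ne hq ω₁
  have h2 := kq_ne hq ω₂
  have eE : ∀ m : ℕ, algebraMap ℂ Mer (casEig q (ω₁ + ω₂) m) =
      kq q ω₁ * kq q ω₂ * (qc q ^ m) ^ 2 / qc q + qc q / (kq q ω₁ * kq q ω₂ * (qc q ^ m) ^ 2) := by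
    intro m
    rw [casEig, map_add]
    change kq q _ + kq q _ = _
    rw [show 1 - (ω₁ + ω₂) - 2 * (m : ℂ) = -(ω₁ + ω₂ + 2 * m - 1) by ring, kq_neg, kq_sub hq,
      kq_add hq, kq_add hq, kq_two_mul, kq_nat, kq_one, inv_div]
  have eK : kq q (ω₁ + ω₂ + 2 * ((i : ℂ) + k) - 1) =
      kq q ω₁ * kq q ω₂ * (qc q ^ n * qc q ^ y) ^ 2 / qc q := by
    rw [kq_sub hq, kq_add hq, kq_add hq, kq_two_mul, kq_add hq, kq_nat, kq_nat, kq_one,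
      ← pow_add, hn, pow_add]
  have e1 : (qc q ^ 2)⁻¹ ^ n = 1 / (qc q ^ n) ^ 2 := by
    rw [inv_pow, one_div, ← pow_mul, ← pow_mul, mul_comm]
  have e2 : (qc q ^ 2) ^ (n + 1) = (qc q ^ n) ^ 2 * qc q ^ 2 := by ring
  rw [cbEig, Nat.cast_add, casCoeff_eq hq, map_sub, eE, eE, eK, hn, Nat.add_sub_cancel, hP,
    show uq q ω₁ * uq q ω₂ * (qc q ^ i) ^ 2 * (qc q ^ k) ^ 2 =
      uq q ω₁ * uq q ω₂ * ((qc q ^ n) ^ 2 * (qc q ^ y) ^ 2) by rw [mul_assoc, hP],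
    pow_add (qc q) n y, e1, e2]
  rw [uq_eq_kq, uq_eq_kq] at hF ⊢
  field_simp
  ring

/-! ### Vectors of a fixed weight and the coordinates of `v(y; p)` -/

theorem co_sum_E (c : ℕ → Mer) (p i j : ℕ) :
    co ω₁ ω₂ i j (∑ k ∈ Finset.range (p + 1), c k • E ω₁ ω₂ (p - k) k) =
      if i + j = p then c j else 0 := by
  rw [map_sum]
  have : ∀ k ∈ Finset.range (p + 1), co ω₁ ω₂ i j (c k • E ω₁ ω₂ (p - k) k) =
      if k = j then (if i + j = p then c j else 0) else 0 := by
    intro k hk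
    rw [Finset.mem_range] at hk
    rw [map_smul, co_E, smul_eq_mul, mul_ite, mul_one, mul_zero]
    by_cases h : k = j
    · subst h
      rw [if_pos rfl]
      exact if_congr (by omega) rfl rfl
    · rw [if_neg h, if_neg fun h' => h h'.2]
  rw [Finset.sum_congr rfl this, Finset.sum_ite_eq']
  by_cases h : i + j = p
  · rw [if_pos (Finset.mem_range.2 (by omega))]
  · rw [if_neg h, ite_self]

theorem sum_E_mem (c : ℕ → Mer) (p : ℕ) :
    ∑ k ∈ Finset.range (p + 1), c k • E ω₁ ω₂ (p - k) k ∈ wtSpace _ (ω₁ + ω₂ + 2 * (p : ℂ)) := by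
  refine mem_wtSpace_co.2 fun i j h => ?_
  rw [co_sum_E] at h
  split_ifs at h with hp
  · rw [← hp, Nat.cast_add]
  · exact absurd rfl h

theorem co_eigVec (y p i j : ℕ) :
    co ω₁ ω₂ i j (eigVec q ω₁ ω₂ y p) = if i + j = p then eigCoeff q ω₁ ω₂ y p j else 0 :=
  co_sum_E _ p i j

theorem eigVec_mem (y p : ℕ) : eigVec q ω₁ ω₂ y p ∈ wtSpace _ (ω₁ + ω₂ + 2 * (p : ℂ)) :=
  sum_E_mem _ p

theorem co_eigVec_zero (y p : ℕ) : co ω₁ ω₂ p 0 (eigVec q ω₁ ω₂ y p) = 1 := by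
  rw [co_eigVec, if_pos (add_zero p), eigCoeff_zero]

theorem eigVec_ne_zero (y p : ℕ) : eigVec q ω₁ ω₂ y p ≠ 0 := by
  intro h
  have := co_eigVec_zero (q := q) (ω₁ := ω₁) (ω₂ := ω₂) y p
  rw [h, map_zero] at this
  exact zero_ne_one this

/-- Equality is checked coordinatewise after multiplication by the nonzero `casFactor`: the matrix
of `γβ` gives one side of `eigCoeff_rec` and the eigenvalue gives the other. At the ends of the
range the out-of-range neighbour has coefficient zero. -/
theorem cb_eigVec (hq : 0 < q) (hq1 : q < 1) {p y : ℕ} (hy : y ≤ p)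
    (h : ∀ j : ℕ, j < p → (q : ℂ) ^ (2 * (ω₁ + j)) ≠ 1 ∧ (q : ℂ) ^ (2 * (ω₂ + j)) ≠ 1) :
    (tRep ω₁ ω₂ hq hq1).c ((tRep ω₁ ω₂ hq hq1).b (eigVec q ω₁ ω₂ y p)) =
      cbEig q (ω₁ + ω₂) y p • eigVec q ω₁ ω₂ y p := by
  have hm := eigVec_mem (q := q) (ω₁ := ω₁) (ω₂ := ω₂) y p
  refine ext_co fun i k => ?_
  by_cases hp : i + k = p
  · subst hp
    refine mul_left_cancel₀ (casFactor_ne_zero (ω₁ := ω₁) (ω₂ := ω₂) hq hq1 i k) ?_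
    rw [co_cb, map_smul, smul_eq_mul, ← mul_assoc, casFactor_mul_cbEig hq hq1 hy, co_eigVec,
      co_eigVec, co_eigVec, if_pos rfl, ← eigCoeff_rec hq hq1 hy h]
    refine congrArg₂ _ (congrArg₂ _ rfl ?_) ?_
    · rcases i with _ | i
      · simp
      · rw [if_pos (show i + 1 - 1 + (k + 1) = i + 1 + k by omega)]
    · rcases k with _ | k
      · simp
      · rw [if_pos (show i + 1 + (k + 1 - 1) = i + (k + 1) by omega)]
  · rw [co_eq_zero ((tRep ω₁ ω₂ hq hq1).cb_wt hm) hp, co_eq_zero (Submodule.smul_mem _ _ hm) hp]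

theorem Xi_eigVec (hq : 0 < q) (hq1 : q < 1) {p y : ℕ} (hy : y ≤ p)
    (h : ∀ j : ℕ, j < p → (q : ℂ) ^ (2 * (ω₁ + j)) ≠ 1 ∧ (q : ℂ) ^ (2 * (ω₂ + j)) ≠ 1) :
    (tRep ω₁ ω₂ hq hq1).hom (FRSL2.Xi q) (eigVec q ω₁ ω₂ y p) =
      casEig q (ω₁ + ω₂) y • eigVec q ω₁ ω₂ y p :=
  ((tRep ω₁ ω₂ hq hq1).Xi_eq_iff hq hq1 (eigVec_mem y p)).2 (cb_eigVec hq hq1 hy h)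

end CasimirEigen

section LowestWeight

open HRep DynTensor

variable {q : ℝ} {ω₁ ω₂ : ℂ}

/-! ### Lowest weight vectors of the tensor product -/

theorem one_sub_qexp_two_ne (hq : 0 < q) (hq1 : q < 1) (b : ℂ) : 1 - Mer.qexp q 2 b ≠ 0 := by
  rw [sub_ne_zero, ← map_one (algebraMap ℂ Mer)]
  exact (Mer.qexp_ne_const hq hq1 two_ne_zero _ _).symm

theorem HRep.cA_ne_zero (hq : 0 < q) (hq1 : q < 1) (ω : ℂ) (k : ℕ) : cA q ω k ≠ 0 :=
  div_ne_zero (mul_ne_zero (pow_ne_zero _ (inv_ne_zero (qc_ne hq)))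
    (one_sub_qexp_two_ne hq hq1 _)) (one_sub_qexp_two_ne hq hq1 _)

theorem HRep.cB_succ_ne_zero (hq : 0 < q) (hq1 : q < 1) {ω : ℂ} {k : ℕ}
    (h : (q : ℂ) ^ (2 * (ω + k)) ≠ 1) : cB q ω (k + 1) ≠ 0 := by
  have h1 : 1 - Mer.qexp q (-2) (2 * (ω + 2 * (k + 1 : ℕ) - 3)) ≠ 0 := by
    rw [sub_ne_zero, ← map_one (algebraMap ℂ Mer)]
    exact (Mer.qexp_ne_const hq hq1 (neg_ne_zero.2 two_ne_zero) _ _).symm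
  refine div_ne_zero (mul_ne_zero ?_ ?_) (mul_ne_zero (one_sub_qexp_two_ne hq hq1 _) h1)
  · exact sub_ne_zero.2 (qc_pow_ne_one hq hq1 (by omega)).symm
  · rw [Mer.qexp_zero_left, sub_ne_zero, ← map_one (algebraMap ℂ Mer)]
    intro h'
    refine h ?_
    have := (algebraMap ℂ Mer).injective h'
    rw [this]
    congr 2
    push_cast
    ring

theorem HRep.cB_succ_eq_zero {ω : ℂ} {k : ℕ} (h : (q : ℂ) ^ (2 * (ω + k)) = 1) :
    cB q ω (k + 1) = 0 := by
  rw [cB, show 2 * (ω + (k + 1 : ℕ) - 1) = 2 * (ω + k) by push_cast; ring, Mer.qexp_zero_left, h,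
    map_one, sub_self, mul_zero, zero_div]

theorem T_ne_zero (s : ℂ) {f : Mer} (hf : f ≠ 0) : Mer.T s f ≠ 0 := (map_ne_zero _).2 hf

theorem T_qPoch (s : ℂ) (a b : Mer) (n : ℕ) :
    Mer.T s (qPoch a b n) = qPoch (Mer.T s a) (Mer.T s b) n := by
  simp only [qPoch, map_prod, map_sub, map_one, map_mul, map_pow]

theorem qexp_mul_qc_pow (hq : 0 < q) (a b : ℂ) (n : ℕ) :
    Mer.qexp q a b * (qc q ^ 2) ^ n = Mer.qexp q a (b + 2 * n) := by
  rw [← pow_mul, ← kq_nat, ← qexp_zero_eq, Mer.qexp_mul hq, add_zero]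
  push_cast; rfl

theorem qPoch_qexp_ne_zero (hq : 0 < q) (hq1 : q < 1) (b : ℂ) (n : ℕ) :
    qPoch (Mer.qexp q 2 b) (qc q ^ 2) n ≠ 0 :=
  qPoch_ne_zero fun j _ => by
    rw [qexp_mul_qc_pow hq]
    exact (sub_ne_zero.1 (one_sub_qexp_two_ne hq hq1 _)).symm

/-- The translation of a shifted factorial. -/
theorem one_sub_div_mul_T_qPoch (hq : 0 < q) (hq1 : q < 1) (b : ℂ) (n : ℕ) :
    (1 - Mer.qexp q 2 (b - 2 + 2 * n)) / (1 - Mer.qexp q 2 (b - 2)) *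
      Mer.T (-1) (qPoch (Mer.qexp q 2 b) (qc q ^ 2) n) = qPoch (Mer.qexp q 2 b) (qc q ^ 2) n := by
  -- `T_{-1}` moves the first argument down by a factor `q²`. Both factorials sit inside one
  -- factorial of length `n + 1`, obtained by splitting off its last or its first factor.
  have h1 := qPoch_succ (Mer.qexp q 2 (b - 2)) (qc q ^ 2) n
  have h2 : Mer.qexp q 2 (b - 2) * qc q ^ 2 = Mer.qexp q 2 b := by
    have := qexp_mul_qc_pow hq 2 (b - 2) 1
    rw [pow_one] at this
    rw [this]; push_cast; congr 1; ring
  rw [qPoch_succ', qexp_mul_qc_pow hq, h2] at h1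
  rw [T_qPoch, Mer.T_qexp, map_pow, AlgHom.commutes, show b + 2 * -1 = b - 2 by ring,
    div_mul_eq_mul_div, div_eq_iff (one_sub_qexp_two_ne hq hq1 _), mul_comm, ← h1, mul_comm]

/-- The solutions of `α v = v` among the multiples of a lowest weight vector. -/
noncomputable def lowCoeff (q : ℝ) (ω₁ ω₂ : ℂ) (i j : ℕ) : Mer :=
  Mer.qexp q (-(i + j)) 0 * qPoch (Mer.qexp q 2 (2 * (2 - ω₁ - ω₂ - 2 * (i + j)))) (qc q ^ 2) i *
    qPoch (Mer.qexp q 2 (2 * (2 - ω₂ - 2 * j))) (qc q ^ 2) j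

theorem lowCoeff_ne_zero (hq : 0 < q) (hq1 : q < 1) (i j : ℕ) : lowCoeff q ω₁ ω₂ i j ≠ 0 :=
  mul_ne_zero (mul_ne_zero (Mer.qexp_ne_zero hq _ _) (qPoch_qexp_ne_zero hq hq1 _ _))
    (qPoch_qexp_ne_zero hq hq1 _ _)

theorem lowCoeff_zero (s : ℕ) : lowCoeff q ω₁ ω₂ s 0 = intCoeff q ω₁ ω₂ s 0 := by
  simp [lowCoeff, intCoeff, qPoch_zero]

/-- The shift `T_{-1}` changes each of the two shifted factorials only at its ends, which accounts
for the quotients in `A_i` and `A_j`. The power `q^(-(i+j)λ)` produces `q^(i+j)` and cancels the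
remaining `q^(-i) q^(-j)`. -/
theorem lowCoeff_T (hq : 0 < q) (hq1 : q < 1) (i j : ℕ) :
    Mer.T (-(ω₂ + 2 * j)) (cA q ω₁ i) * cA q ω₂ j * Mer.T (-1) (lowCoeff q ω₁ ω₂ i j) =
      lowCoeff q ω₁ ω₂ i j := by
  have h1 := one_sub_div_mul_T_qPoch hq hq1 (2 * (2 - ω₁ - ω₂ - 2 * (i + j))) i
  have h2 := one_sub_div_mul_T_qPoch hq hq1 (2 * (2 - ω₂ - 2 * j)) j
  have h3 : (qc q)⁻¹ ^ i * (qc q)⁻¹ ^ j * Mer.qexp q (-(i + j)) (0 + -(i + j) * -1) =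
      Mer.qexp q (-(i + j)) 0 := by
    rw [Mer.qexp_split hq, ← pow_add, show 0 + -((i : ℂ) + j) * -1 = ((i + j : ℕ) : ℂ) by
      push_cast; ring]
    change _ * (kq q _ * _) = _
    rw [kq_nat, ← mul_assoc, ← mul_pow, inv_mul_cancel₀ (qc_ne hq), one_pow, one_mul]
  rw [lowCoeff]
  simp only [map_mul]
  rw [Mer.T_qexp]
  conv_rhs => rw [← h1, ← h2, ← h3]
  simp only [cA, map_div₀, map_mul, map_sub, map_one, map_pow, map_inv₀, AlgHom.commutes,
    Mer.T_qexp]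
  rw [show 2 * (-ω₁ - (i : ℂ) + 1) + 2 * -(ω₂ + 2 * j) =
      2 * (2 - ω₁ - ω₂ - 2 * (i + j)) - 2 + 2 * i by ring,
    show 2 * (-ω₁ - 2 * (i : ℂ) + 1) + 2 * -(ω₂ + 2 * j) =
      2 * (2 - ω₁ - ω₂ - 2 * (i + j)) - 2 by ring,
    show 2 * (-ω₂ - (j : ℂ) + 1) = 2 * (2 - ω₂ - 2 * j) - 2 + 2 * j by ring,
    show 2 * (-ω₂ - 2 * (j : ℂ) + 1) = 2 * (2 - ω₂ - 2 * j) - 2 by ring]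
  simp only [div_eq_mul_inv]
  ring

/-- Here `j₀` is one more than the last place below `s` where `P` holds, or `0` if there is none. It
will be the position of the first nonzero coordinate of a lowest weight vector. -/
theorem exists_last (P : ℕ → Prop) (s : ℕ) :
    ∃ j₀ ≤ s, (∀ k, j₀ ≤ k → k < s → ¬ P k) ∧ (∀ k, k + 1 = j₀ → P k) := by
  induction s with
  | zero => exact ⟨0, le_rfl, fun k _ h => absurd h (Nat.not_lt_zero k), fun k h => by omega⟩
  | succ s ih =>
    by_cases h : P s
    · exact ⟨s + 1, le_rfl, fun k h1 h2 => by omega, fun k hk => by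
        rwa [Nat.succ_injective hk]⟩
    · obtain ⟨j₀, h0, h1, h2⟩ := ih
      refine ⟨j₀, by omega, fun k hk hk' => ?_, h2⟩
      rcases Nat.lt_succ_iff_lt_or_eq.1 hk' with h' | rfl
      · exact h1 k hk h'
      · exact h

theorem exists_seq {F : Type*} [Field F] (r : ℕ → F) (j₀ : ℕ) :
    ∃ c : ℕ → F, (∀ j < j₀, c j = 0) ∧ c j₀ = 1 ∧ ∀ j, j₀ ≤ j → c (j + 1) = r j * c j := by
  refine ⟨fun j => if j < j₀ then 0 else ∏ i ∈ Finset.Ico j₀ j, r i, fun j hj => if_pos hj, ?_,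
    fun j hj => ?_⟩
  · simp
  · simp only
    rw [if_neg (by omega), if_neg (by omega), Finset.prod_Ico_succ_top hj, mul_comm]

variable (hq : 0 < q) (hq1 : q < 1)

/-- The coordinate at `e_i ⊗ e_j` of `β x` relates the coordinates of `x` at `e_i ⊗ e_{j+1}` and
`e_{i+1} ⊗ e_j`. For `j ≥ j₀` the coefficient of the former is nonzero, so vanishing propagates
upwards from `j₀`. -/
theorem eq_zero_of_b {s j₀ : ℕ} (h : ∀ k, j₀ ≤ k → k < s → (q : ℂ) ^ (2 * (ω₂ + k)) ≠ 1)
    {x : DynTensor (HRep ω₁) (HRep ω₂)} (hx : x ∈ wtSpace _ (ω₁ + ω₂ + 2 * (s : ℂ)))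
    (hb : (tRep ω₁ ω₂ hq hq1).b x = 0)
    (h0 : ∀ i j, j ≤ j₀ → i + j = s → co ω₁ ω₂ i j x = 0) : x = 0 := by
  have key : ∀ j i, i + j = s → co ω₁ ω₂ i j x = 0 := by
    intro j
    induction j with
    | zero => exact fun i hi => h0 i 0 (Nat.zero_le _) hi
    | succ j ih =>
      intro i hi
      by_cases hj : j + 1 ≤ j₀
      · exact h0 i _ hj hi
      · have h1 := co_b hq hq1 i j x
        rw [hb, map_zero, ih (i + 1) (by omega), map_zero, mul_zero, add_zero, eq_comm] at h1
        refine (map_eq_zero (Mer.T 1)).1 ((mul_eq_zero.1 h1).resolve_left (mul_ne_zero ?_ ?_))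
        · exact T_ne_zero _ (cA_ne_zero hq hq1 _ _)
        · exact cB_succ_ne_zero hq hq1 (h j (by omega) (by omega))
  refine ext_co fun i j => ?_
  rw [map_zero]
  by_cases hij : i + j = s
  · exact key j i hij
  · exact co_eq_zero hx hij

/-- `β v = 0` is a first-order recurrence, which can break down only where a coefficient `B_{k+1}`
for `ω₂` vanishes. Starting just after the last such place needs no genericity. The solution is then
an eigenvector of `α` up to a function, and that function is removed by rescaling with `lowCoeff`.
-/
theorem exists_lowest (s : ℕ) : ∃ v ∈ wtSpace (DynTensor (HRep ω₁) (HRep ω₂))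
    (ω₁ + ω₂ + 2 * (s : ℂ)), v ≠ 0 ∧ (tRep ω₁ ω₂ hq hq1).b v = 0 ∧ (tRep ω₁ ω₂ hq hq1).a v = v ∧
      ((∀ j : ℕ, (q : ℂ) ^ (2 * (ω₂ + j)) ≠ 1) → co ω₁ ω₂ s 0 v = intCoeff q ω₁ ω₂ s 0) := by
  obtain ⟨j₀, hj₀, hX, hY⟩ := exists_last (fun k => (q : ℂ) ^ (2 * (ω₂ + k)) = 1) s
  -- The ratio solves the row `(s-1-j, j)` of `β v = 0` for the next coordinate; the outer `T_{-1}`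
  -- undoes the shift that `β` applies to coordinates.
  obtain ⟨c, hc0, hc1, hc⟩ := exists_seq (fun j => -Mer.T (-1)
    (Mer.T (-(ω₂ + 2 * j)) (cB q ω₁ (s - 1 - j + 1)) * cD q j /
      (Mer.T (-(ω₂ + 2 * j)) (cA q ω₁ (s - 1 - j)) * cB q ω₂ (j + 1)))) j₀
  set v := ∑ k ∈ Finset.range (s + 1), c k • E ω₁ ω₂ (s - k) k with hv
  have hvm := sum_E_mem (ω₁ := ω₁) (ω₂ := ω₂) c s
  have hco := co_sum_E (ω₁ := ω₁) (ω₂ := ω₂) c s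
  rw [← hv] at hvm hco
  have hT : ∀ f : Mer, Mer.T 1 (Mer.T (-1) f) = f := fun f => by rw [Mer.T_T]; norm_num
  have hb : (tRep ω₁ ω₂ hq hq1).b v = 0 := by
    refine ext_co fun i j => ?_
    rw [co_b, map_zero, hco, hco]
    by_cases hij : i + (j + 1) = s
    · rw [if_pos hij, if_pos (show i + 1 + j = s by omega)]
      rcases Nat.lt_or_ge j j₀ with h | h
      · rw [hc0 j h, map_zero, mul_zero, add_zero]
        rcases Nat.lt_or_ge (j + 1) j₀ with h' | h'
        · rw [hc0 _ h', map_zero, mul_zero]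
        -- This is the row `j + 1 = j₀`: the first nonzero coordinate does not contribute because
        -- its coefficient `B_{j₀}` vanishes by the choice of `j₀`.
        · rw [cB_succ_eq_zero (hY j (by omega)), mul_zero, zero_mul]
      · have n1 := T_ne_zero (-(ω₂ + 2 * j)) (cA_ne_zero hq hq1 ω₁ i)
        have n2 := cB_succ_ne_zero hq hq1 (hX j h (by omega))
        rw [hc j h, map_mul, map_neg, hT, show s - 1 - j = i by omega]
        field_simp
        ring
    · rw [if_neg hij, if_neg (show ¬ i + 1 + j = s by omega), map_zero, mul_zero, mul_zero,
        add_zero]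
  have ha : (tRep ω₁ ω₂ hq hq1).a v =
      (Mer.T (-(ω₂ + 2 * j₀)) (cA q ω₁ (s - j₀)) * cA q ω₂ j₀) • v := by
    rw [← sub_eq_zero]
    -- The relation between `αβ` and `βα` shows that `β` kills `α v`, and `α` preserves the weight.
    -- By uniqueness it is enough to compare the coordinates up to `j₀`.
    refine eq_zero_of_b hq hq1 hX (Submodule.sub_mem _ ((tRep ω₁ ω₂ hq hq1).a_wt hvm)
      (Submodule.smul_mem _ _ hvm)) ?_ fun i j hj hij => ?_
    · rw [map_sub, DynRep.b_smul, hb, smul_zero, sub_zero]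
      have h := (tRep ω₁ ω₂ hq hq1).p_ab hq hq1 v
      rw [hb, map_zero, eq_comm, smul_eq_zero] at h
      refine h.resolve_left (T_ne_zero _ fun h0 => ?_)
      have := dynK_mul hq hq1
      rw [h0, map_zero, mul_zero] at this
      exact zero_ne_one this
    · rw [map_sub, map_smul, co_a, hco, hco, if_pos hij, smul_eq_mul]
      have h2 : (if j = 0 then 0 else Mer.T (-(ω₂ + 2 * j)) (cB q ω₁ (i + 1)) * -(qc q)⁻¹) *
          Mer.T (-1) (if i + 1 + (j - 1) = s then c (j - 1) else 0) = 0 := by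
        rcases Nat.eq_zero_or_pos j with h3 | h3
        · rw [if_pos h3, zero_mul]
        · rw [hc0 (j - 1) (by omega), ite_self, map_zero, mul_zero]
      rw [h2, add_zero]
      rcases hj.lt_or_eq with h | rfl
      · rw [hc0 j h, map_zero, mul_zero, mul_zero, sub_zero]
      · rw [hc1, map_one, show s - j = i by omega, sub_self]
  have hg := lowCoeff_T (ω₁ := ω₁) (ω₂ := ω₂) hq hq1 (s - j₀) j₀
  have hg0 := lowCoeff_ne_zero (ω₁ := ω₁) (ω₂ := ω₂) hq hq1 (s - j₀) j₀
  refine ⟨lowCoeff q ω₁ ω₂ (s - j₀) j₀ • v, Submodule.smul_mem _ _ hvm, smul_ne_zero hg0 ?_, ?_,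
    ?_, fun h => ?_⟩
  · intro h
    have := hco (s - j₀) j₀
    rw [h, map_zero, if_pos (by omega), hc1] at this
    exact zero_ne_one this
  · rw [DynRep.b_smul, hb, smul_zero]
  · rw [DynRep.a_smul, ha, smul_smul, mul_comm, hg]
  -- If no `q^(2(ω₂+j))` equals `1`, the recurrence starts at `e_s ⊗ e_0`, so the coordinate there
  -- is the rescaling factor itself.
  · obtain rfl : j₀ = 0 := by
      rcases j₀ with _ | j
      · rfl
      · exact absurd (hY j rfl) (h j)
    rw [map_smul, hco, if_pos (add_zero s), hc1, Nat.sub_zero, smul_eq_mul, mul_one, lowCoeff_zero]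

end LowestWeight

section Decomposition

open HRep DynTensor

variable {q : ℝ} {ω₁ ω₂ : ℂ}

/-! ### The Casimir element on `H^ω` -/

theorem kq_zero : kq q 0 = 1 := by rw [← Nat.cast_zero, kq_nat, pow_zero]

/-- This identifies the eigenvalue of `γβ` on `e_k` in `H^ω` with the one predicted by `Ξ`. It
reuses `casFactor_mul_cbEig` with `ω₂ = 0`, no second index and `y = 0`. -/
theorem cbEig_zero (hq : 0 < q) (hq1 : q < 1) (ω : ℂ) (k : ℕ) :
    cbEig q ω 0 k = Mer.T (-1) (cB q ω k) * -(qc q)⁻¹ := by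
  have hn := casNonDeg hq hq1 ω 0 k 0
  have hF := casFactor_ne_zero (ω₁ := ω) (ω₂ := 0) hq hq1 k 0
  have h := casFactor_mul_cbEig (ω₁ := ω) (ω₂ := 0) hq hq1 (Nat.zero_le (k + 0))
  have u0 : uq q 0 = 1 := by rw [uq_eq_kq, kq_zero, one_pow]
  refine mul_left_cancel₀ hF ?_
  rw [add_zero, add_zero, Nat.sub_zero] at h
  rw [h, T_B hq, T_neg_xq hq, casFactor_eq hn, fB]
  obtain ⟨n1, n2, n3, n4, n5, n6, n7, n8, n9, n10, n11, n12⟩ := hn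
  have e1 : (qc q ^ 2)⁻¹ ^ k = 1 / (qc q ^ k) ^ 2 := by
    rw [inv_pow, one_div, ← pow_mul, ← pow_mul, mul_comm]
  have e2 : (qc q ^ 2) ^ (k + 1) = (qc q ^ k) ^ 2 * qc q ^ 2 := by ring
  rw [e1, e2]
  simp only [u0, pow_zero, one_pow, mul_one] at *
  have m1 : 1 - uq q ω * (qc q ^ k) ^ 4 / (qc q ^ 6 * (xq q / qc q ^ 2)) =
      -(uq q ω * (qc q ^ k) ^ 4 - xq q * qc q ^ 4) / (xq q * qc q ^ 4) := by
    field_simp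
    ring
  have m2 : 1 - xq q / qc q ^ 2 * qc q ^ 2 ≠ 0 := by
    rwa [div_mul_cancel₀ _ (pow_ne_zero _ n6)]
  obtain ⟨D, hD⟩ : ∃ D, D = uq q ω * (qc q ^ k) ^ 4 - xq q * qc q ^ 4 := ⟨_, rfl⟩
  rw [m1, ← hD]
  rw [← hD] at n11
  field_simp
  ring

theorem piRep_b_e (hq : 0 < q) (hq1 : q < 1) (ω : ℂ) (k : ℕ) :
    (piRep hq hq1 ω).b (e ω (k + 1)) = cB q ω (k + 1) • e ω k := by
  rw [piRep_b, e, opB_ge, map_one, mul_one, ge_eq_smul_e]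

theorem piRep_b_e_zero (hq : 0 < q) (hq1 : q < 1) (ω : ℂ) : (piRep hq hq1 ω).b (e ω 0) = 0 := by
  rw [piRep_b, e, opB_ge_zero]

/-- Every `e_k` has the same eigenvalue, so `Ξ` is a scalar on `H^ω`; this scalar serves to separate
the summands of the decomposition. -/
theorem Xi_e (hq : 0 < q) (hq1 : q < 1) (ω : ℂ) (k : ℕ) :
    (piRep hq hq1 ω).hom (FRSL2.Xi q) (e ω k) = casEig q ω 0 • e ω k := by
  refine ((piRep hq hq1 ω).Xi_eq_iff hq hq1 (ge_mem k 1)).2 ?_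
  rw [cbEig_zero hq hq1]
  change (piRep hq hq1 ω).c ((piRep hq hq1 ω).b (e ω k)) = _ • e ω k
  rcases k with _ | k
  · rw [piRep_b_e_zero, map_zero, cB_zero, map_zero, zero_mul, zero_smul]
  · rw [piRep_b_e, DynRep.c_smul, piRep_c_e, smul_smul]

/-! ### Intertwiners from `H^(ω₁+ω₂+2s)` -/

/-- With `X_n = q^(Ω+2n-1)`, equality of `X_s + 1/X_s` and `X_t + 1/X_t` forces `X_s = X_t` or `X_s
X_t = 1`. The first is impossible for `s ≠ t` since `0 < q < 1`; the second says `q^(2(Ω+s+t-1)) =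
1`, which the hypothesis excludes. -/
theorem casEig_injective (hq : 0 < q) (hq1 : q < 1) {Ω : ℂ}
    (h : ∀ n : ℕ, (q : ℂ) ^ (2 * (Ω + n)) ≠ 1) : Function.Injective (casEig q Ω) := by
  have h0 : (q : ℂ) ≠ 0 := by exact_mod_cast hq.ne'
  have hne : ∀ z : ℂ, (q : ℂ) ^ z ≠ 0 := fun z => by
    rw [Ne, Complex.cpow_eq_zero_iff]; exact fun h => h0 h.1
  intro s t hst
  by_contra hne'
  have e : ∀ n : ℕ, casEig q Ω n =
      (q : ℂ) ^ (Ω + 2 * n - 1) + ((q : ℂ) ^ (Ω + 2 * n - 1))⁻¹ := fun n => by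
    rw [casEig, ← Complex.cpow_neg]; congr 2; ring
  rw [e, e] at hst
  have a1 := hne (Ω + 2 * s - 1)
  have a2 := hne (Ω + 2 * t - 1)
  have h1 : ((q : ℂ) ^ (Ω + 2 * s - 1) - (q : ℂ) ^ (Ω + 2 * t - 1)) *
      ((q : ℂ) ^ (Ω + 2 * s - 1) * (q : ℂ) ^ (Ω + 2 * t - 1) - 1) = 0 := by
    field_simp at hst
    linear_combination hst
  have key : ∀ m n : ℕ, m < n → (q : ℂ) ^ (Ω + 2 * m - 1) ≠ (q : ℂ) ^ (Ω + 2 * n - 1) := by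
    intro m n hmn h2
    obtain ⟨d, rfl⟩ : ∃ d, n = m + (d + 1) := ⟨n - m - 1, by omega⟩
    rw [show Ω + 2 * (m + (d + 1) : ℕ) - 1 = Ω + 2 * m - 1 + (2 * (d + 1) : ℕ) by push_cast; ring,
      Complex.cpow_add _ _ h0, Complex.cpow_natCast, eq_comm,
      mul_eq_left₀ (hne _)] at h2
    have h3 : q ^ (2 * (d + 1)) = 1 := by exact_mod_cast h2
    exact (pow_lt_one₀ hq.le hq1 (by omega)).ne h3
  rcases mul_eq_zero.1 h1 with h2 | h2
  · rcases Nat.lt_or_gt_of_ne hne' with h3 | h3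
    · exact key s t h3 (sub_eq_zero.1 h2)
    · exact key t s h3 (sub_eq_zero.1 h2).symm
  -- Distinct natural numbers have positive sum, so the exponent `s + t - 1` is a natural number and
  -- falls under the hypothesis.
  · obtain ⟨n, hn⟩ : ∃ n, s + t = n + 1 := ⟨s + t - 1, by omega⟩
    refine h n ?_
    rw [← Complex.cpow_add _ _ h0] at h2
    rw [← sub_eq_zero.1 h2]
    congr 1
    have : (s : ℂ) + t = n + 1 := by exact_mod_cast hn
    linear_combination (-2) * this

theorem casEig_add (Ω : ℂ) (s : ℕ) : casEig q (Ω + 2 * s) 0 = casEig q Ω s := by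
  rw [casEig, casEig]
  congr 2 <;> push_cast <;> ring

section

variable (hq : 0 < q) (hq1 : q < 1) {Ω : ℂ} {s : ℕ}
  {V : Type*} [AddCommGroup V] [Module ℂ V] [Module Mer V] [IsScalarTower ℂ Mer V]
  [DynSpace V] {π : DynRep q V} {C : HRep (Ω + 2 * s) →ₗ[Mer] V}

theorem IsIntertwiner.Xi_e (hC : IsIntertwiner (piRep hq hq1 (Ω + 2 * s)) π C) (k : ℕ) :
    π.hom (FRSL2.Xi q) (C (e _ k)) = casEig q Ω s • C (e _ k) := by
  rw [← hC.2, _root_.Xi_e, map_csmul, casEig_add]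

theorem IsIntertwiner.e_mem (hC : IsIntertwiner (piRep hq hq1 (Ω + 2 * s)) π C) (k : ℕ) :
    C (e _ k) ∈ wtSpace V (Ω + 2 * (s + k : ℕ)) := by
  have := hC.1 _ _ (ge_mem k 1)
  rwa [show Ω + 2 * s + 2 * (k : ℂ) = Ω + 2 * (s + k : ℕ) by push_cast; ring] at this

/-- If `e_{k+1}` were sent to zero, applying `β` would give `B_{k+1} C e_k = 0`. For the parameter
`Ω + 2s` the coefficient `B_{k+1}` is nonzero because `q^(2(Ω+2s+k)) ≠ 1`. -/
theorem IsIntertwiner.e_ne_zero (hC : IsIntertwiner (piRep hq hq1 (Ω + 2 * s)) π C)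
    (h : ∀ n : ℕ, (q : ℂ) ^ (2 * (Ω + n)) ≠ 1) (h0 : C (e _ 0) ≠ 0) (k : ℕ) :
    C (e _ k) ≠ 0 := by
  induction k with
  | zero => exact h0
  | succ k ih =>
    intro h1
    have h2 : C ((piRep hq hq1 _).b (e _ (k + 1))) = π.b (C (e _ (k + 1))) := hC.2 _ _
    rw [h1, map_zero, piRep_b_e, map_smul, smul_eq_zero] at h2
    refine h2.elim (cB_succ_ne_zero hq hq1 fun h3 => h (2 * s + k) ?_) ih
    rw [← h3]
    congr 2
    push_cast
    ring

end

/-! ### Linear independence from `Ξ` and the weights, and a dimension count -/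

section

variable {V : Type*} [AddCommGroup V] [Module ℂ V] [Module Mer V] [IsScalarTower ℂ Mer V]
  [DynSpace V]

/-- Vectors in different joint eigenspaces of the Casimir element and the weight operator are
linearly independent. -/
theorem DynRep.linearIndependent (π : DynRep q V) (hq : 0 < q) (hq1 : q < 1) {ι : Type*}
    {u : ι → V} {θ w : ι → ℂ} (hθ : ∀ i, π.hom (FRSL2.Xi q) (u i) = θ i • u i)
    (hw : ∀ i, u i ∈ wtSpace V (w i)) (h0 : ∀ i, u i ≠ 0)
    (hinj : ∀ i j, θ i = θ j → w i = w j → i = j) : LinearIndependent Mer u := by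
  let X : Module.End Mer V := { π.hom (FRSL2.Xi q) with map_smul' := π.Xi_smul }
  -- One operator detects both labels: its eigenvalue is `θ + q^(2λ) w` with `θ` and `w` constant,
  -- and since `q^(2λ)` is not constant this function determines the pair.
  refine Module.End.eigenvectors_linearIndependent' (X + xq q • (DynSpace.wt : Module.End Mer V))
    (fun i => algebraMap ℂ Mer (θ i) + xq q * algebraMap ℂ Mer (w i)) (fun i j hij => ?_) u
    fun i => ⟨Module.End.mem_eigenspace_iff.2 ?_, h0 i⟩
  · have h1 : w i = w j := by
      by_contra h
      refine xq_ne_algebraMap hq hq1 ((θ j - θ i) / (w i - w j)) ?_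
      have h2 : algebraMap ℂ Mer (w i - w j) ≠ 0 :=
        (map_ne_zero _).2 (sub_ne_zero.2 h)
      rw [map_div₀, eq_div_iff h2, map_sub, map_sub]
      simp only at hij
      linear_combination hij
    refine hinj i j ?_ h1
    simp only [h1] at hij
    exact (algebraMap ℂ Mer).injective (add_right_cancel hij)
  · have h1 : X (u i) = θ i • u i := hθ i
    rw [LinearMap.add_apply, LinearMap.smul_apply, h1, mem_wtSpace.1 (hw i), add_smul, mul_smul,
      IsScalarTower.algebraMap_smul, IsScalarTower.algebraMap_smul]

end

theorem eq_sum_E {x : DynTensor (HRep ω₁) (HRep ω₂)} {p : ℕ}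
    (hx : x ∈ wtSpace _ (ω₁ + ω₂ + 2 * (p : ℂ))) :
    x = ∑ k ∈ Finset.range (p + 1), co ω₁ ω₂ (p - k) k x • E ω₁ ω₂ (p - k) k := by
  refine ext_co fun i j => ?_
  rw [co_sum_E fun k => co ω₁ ω₂ (p - k) k x]
  split_ifs with h
  · rw [show p - j = i by omega]
  · exact co_eq_zero hx h

/-- A linearly independent family with one vector of weight `ω₁+ω₂+2(s+k)` for all `s`, `k` is
a basis. -/
theorem span_eq_top_of_weights {u : (_ : ℕ) × ℕ → DynTensor (HRep ω₁) (HRep ω₂)}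
    (hu : LinearIndependent Mer u)
    (hw : ∀ s k, u ⟨s, k⟩ ∈ wtSpace _ (ω₁ + ω₂ + 2 * ((s + k : ℕ) : ℂ))) :
    ⊤ ≤ Submodule.span Mer (Set.range u) := by
  intro x _
  induction x using induction_E with
  | h0 => exact zero_mem _
  | hadd x y hx hy => exact add_mem (hx trivial) (hy trivial)
  | hE i j g =>
    refine Submodule.smul_mem _ _ ?_
    let a : Fin (i + j + 1) → DynTensor (HRep ω₁) (HRep ω₂) := fun k => E ω₁ ω₂ (i + j - k) k
    let b : Fin (i + j + 1) → DynTensor (HRep ω₁) (HRep ω₂) := fun k => u ⟨k, i + j - k⟩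
    have hb : LinearIndependent Mer b := by
      refine hu.comp (fun k : Fin (i + j + 1) => ⟨k, i + j - k⟩) fun k l hkl => ?_
      have := congrArg Sigma.fst hkl
      exact Fin.ext this
    have hle : Submodule.span Mer (Set.range b) ≤ Submodule.span Mer (Set.range a) := by
      rw [Submodule.span_le]
      rintro _ ⟨k, rfl⟩
      have := hw k (i + j - k)
      rw [show (k : ℕ) + (i + j - k) = i + j by omega] at this
      change u _ ∈ _
      rw [eq_sum_E this]
      refine Submodule.sum_mem _ fun l hl => Submodule.smul_mem _ _ (Submodule.subset_span ?_)
      exact ⟨⟨l, Finset.mem_range.1 hl⟩, rfl⟩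
    have : Module.Finite Mer (Submodule.span Mer (Set.range a)) :=
      Module.Finite.span_of_finite _ (Set.finite_range a)
    -- In weight `ω₁+ω₂+2(i+j)` there are `i+j+1` independent vectors inside the span of `i+j+1`
    -- basis tensors, so the two spans coincide.
    have heq := Submodule.eq_of_le_of_finrank_le hle (by
      rw [finrank_span_eq_card hb]
      exact finrank_range_le_card a)
    have h1 : E ω₁ ω₂ i j ∈ Submodule.span Mer (Set.range b) := by
      rw [heq]
      exact Submodule.subset_span ⟨⟨j, by omega⟩, by
        change E ω₁ ω₂ (i + j - j) j = _
        rw [Nat.add_sub_cancel]⟩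
    refine Submodule.span_mono ?_ h1
    rintro _ ⟨k, rfl⟩
    exact ⟨_, rfl⟩

/-! ### Sums of intertwiners -/

section

open DirectSum

variable {ι : Type*} [DecidableEq ι] {V : ι → Type*} [∀ i, AddCommGroup (V i)]
  [∀ i, Module ℂ (V i)] [∀ i, Module Mer (V i)] [∀ i, IsScalarTower ℂ Mer (V i)]
  [∀ i, DynSpace (V i)]
  {W : Type*} [AddCommGroup W] [Module ℂ W] [Module Mer W] [IsScalarTower ℂ Mer W] [DynSpace W]

theorem IsIntertwiner.toModule {π : ∀ i, DynRep q (V i)} {π' : DynRep q W}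
    {C : ∀ i, V i →ₗ[Mer] W} (h : ∀ i, IsIntertwiner (π i) π' (C i)) :
    IsIntertwiner (DynRep.directSum π) π' (DirectSum.toModule Mer ι W C) := by
  refine ⟨wtSpace_map fun x => ?_, fun a x => ?_⟩
  · induction x using DirectSum.induction_on with
    | zero => simp
    | add x y hx hy => simp only [map_add, hx, hy]
    | of i v =>
      change (DynSpace.wt : Module.End Mer W) (DirectSum.toModule Mer ι W C
        (DirectSum.lof Mer ι V i v)) = DirectSum.toModule Mer ι W C
          (DirectSum.lmap _ (DirectSum.lof Mer ι V i v))
      rw [DirectSum.lmap_lof, DirectSum.toModule_lof, DirectSum.toModule_lof,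
        wt_comm_of_wtSpace_map (h i).1]
  · induction x using DirectSum.induction_on with
    | zero => simp
    | add x y hx hy => simp only [map_add, hx, hy]
    | of i v =>
      have h1 : (DynRep.directSum π).hom a (DirectSum.of V i v) =
          DirectSum.lof Mer ι V i ((π i).hom a v) :=
        DirectSum.lmap_lof (R := ℂ) (fun i => (π i).hom a) i v
      rw [h1]
      change DirectSum.toModule Mer ι W C _ =
        π'.hom a (DirectSum.toModule Mer ι W C (DirectSum.lof Mer ι V i v))
      rw [DirectSum.toModule_lof, DirectSum.toModule_lof, (h i).2]

end

/-- If the images of the basis vectors form a basis, then the sum of the maps is bijective. -/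
theorem exists_equiv_of_basis {V : Type*} [AddCommGroup V] [Module Mer V] {w : ℕ → ℂ}
    {C : ∀ s, HRep (w s) →ₗ[Mer] V}
    (b : Module.Basis ((_ : ℕ) × ℕ) Mer V) (hb : ∀ s k, b ⟨s, k⟩ = C s (e (w s) k)) :
    ∃ Φ : (DirectSum ℕ fun s => HRep (w s)) ≃ₗ[Mer] V,
      Φ.toLinearMap = DirectSum.toModule Mer ℕ V C := by
  let Ψ : V →ₗ[Mer] DirectSum ℕ fun s => HRep (w s) :=
    b.constr Mer fun n => DirectSum.lof Mer ℕ (fun s => HRep (w s)) n.1 (e (w n.1) n.2)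
  have hΨ : ∀ s k, Ψ (C s (e (w s) k)) =
      DirectSum.lof Mer ℕ (fun s => HRep (w s)) s (e (w s) k) := fun s k => by
    rw [← hb]; exact b.constr_basis Mer _ _
  refine ⟨LinearEquiv.ofLinearMap (DirectSum.toModule Mer ℕ V C) Ψ ?_ ?_, rfl⟩
  · refine b.ext fun n => ?_
    rw [LinearMap.comp_apply, hb, hΨ, DirectSum.toModule_lof, LinearMap.id_apply]
  · refine DirectSum.linearMap_ext _ fun s => LinearMap.ext fun x => ?_
    simp only [LinearMap.comp_apply, LinearMap.id_apply, DirectSum.toModule_lof]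
    induction x using HRep.induction with
    | h0 => simp
    | hadd x y hx hy => simp only [map_add, hx, hy]
    | hge k g => rw [ge_eq_smul_e, map_smul, map_smul, hΨ, map_smul]

/-- The explicit factor in front of `v(s;s+k)` solves the recursion imposed by `γ`, which acts on
coefficients through the shift `T_{-1}`. -/
theorem T_intCoeff (s k : ℕ) :
    Mer.T (-1) (intCoeff q ω₁ ω₂ s k) = intCoeff q ω₁ ω₂ s (k + 1) := by
  rw [intCoeff, intCoeff, map_mul, T_qPoch, Mer.T_qexp, Mer.T_qexp, map_pow, AlgHom.commutes]
  congr 3 <;> push_cast <;> ring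

/-- Both vectors have weight `ω₁+ω₂+2(s+k)` and the same eigenvalue of `γβ`, so they are
proportional, and the factor is the coordinate of `C e_k` at `e_{s+k} ⊗ e_0`. -/
theorem IsIntertwiner.eq_smul_eigVec (hq : 0 < q) (hq1 : q < 1)
    (h : ∀ j : ℕ, (q : ℂ) ^ (2 * (ω₁ + j)) ≠ 1 ∧ (q : ℂ) ^ (2 * (ω₂ + j)) ≠ 1) {s : ℕ}
    {C : HRep (ω₁ + ω₂ + 2 * s) →ₗ[Mer] DynTensor (HRep ω₁) (HRep ω₂)}
    (hC : IsIntertwiner (piRep hq hq1 (ω₁ + ω₂ + 2 * s)) (tRep ω₁ ω₂ hq hq1) C)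
    (h0 : co ω₁ ω₂ s 0 (C (e _ 0)) = intCoeff q ω₁ ω₂ s 0) (k : ℕ) :
    C (e _ k) = intCoeff q ω₁ ω₂ s k • eigVec q ω₁ ω₂ s (s + k) := by
  have hco : co ω₁ ω₂ (s + k) 0 (C (e _ k)) = intCoeff q ω₁ ω₂ s k := by
    induction k with
    | zero => exact h0
    | succ k ih =>
      have h1 : C ((piRep hq hq1 _).c (e _ k)) = (tRep ω₁ ω₂ hq hq1).c (C (e _ k)) := hC.2 _ _
      -- At second index `0` only `γ ⊗ α` contributes. Its coefficient is `-q⁻¹` because `A_0 = 1`,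
      -- and this cancels the factor in `e_{k+1} = -q γ e_k`, so the coordinate is only shifted by
      -- `T_{-1}`.
      rw [e_succ hq hq1, map_smul, h1, map_smul, co_c, if_neg (by omega), if_pos rfl, zero_mul,
        add_zero,
        show s + (k + 1) - 1 = s + k by omega, ih, T_intCoeff, cA_zero hq hq1, mul_one,
        smul_eq_mul, ← mul_assoc, neg_mul_neg, mul_inv_cancel₀ (qc_ne hq), one_mul]
  have hm := hC.e_mem hq hq1 k
  have := eq_smul_of_cb hq hq1 (fun j _ => h j) hm (eigVec_mem s (s + k))
    (((tRep ω₁ ω₂ hq hq1).Xi_eq_iff hq hq1 hm).1 (hC.Xi_e hq hq1 k))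
    (cb_eigVec hq hq1 (Nat.le_add_right s k) fun j _ => h j) (co_eigVec_zero s (s + k))
  rw [this, hco]

end Decomposition

/-! ### Assembly of the eigenvectors, the decomposition and the explicit intertwiners -/

theorem mainTheorem7 (q : ℝ) (hq : 0 < q) (hq1 : q < 1) (ω₁ ω₂ : ℂ) :
    -- the eigenvectors `v(y; p)` of the Casimir element
    (∀ p : ℕ, (∀ j : ℕ, j < p → (q : ℂ) ^ (2 * (ω₁ + j)) ≠ 1 ∧ (q : ℂ) ^ (2 * (ω₂ + j)) ≠ 1) →
      ∀ y : ℕ, y ≤ p →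
        eigVec q ω₁ ω₂ y p ∈ wtSpace (DynTensor (HRep ω₁) (HRep ω₂)) (ω₁ + ω₂ + 2 * p) ∧
        eigVec q ω₁ ω₂ y p ≠ 0 ∧
        (DynRep.tensor hq hq1 (piRep hq hq1 ω₁) (piRep hq hq1 ω₂)).hom (FRSL2.Xi q)
            (eigVec q ω₁ ω₂ y p) =
          ((q : ℂ) ^ (ω₁ + ω₂ + 2 * y - 1) + (q : ℂ) ^ (1 - ω₁ - ω₂ - 2 * y)) •
            eigVec q ω₁ ω₂ y p) ∧
    -- the decomposition and the explicit intertwiners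
    ((∀ n : ℕ, (q : ℂ) ^ (2 * (ω₁ + ω₂ + n)) ≠ 1) →
      ∃ Φ : (DirectSum ℕ fun s => HRep (ω₁ + ω₂ + 2 * s)) ≃ₗ[Mer] DynTensor (HRep ω₁) (HRep ω₂),
        IsIntertwiner (DynRep.directSum fun s : ℕ => piRep hq hq1 (ω₁ + ω₂ + 2 * s))
          (DynRep.tensor hq hq1 (piRep hq hq1 ω₁) (piRep hq hq1 ω₂)) Φ.toLinearMap ∧
        ((∀ j : ℕ, (q : ℂ) ^ (2 * (ω₁ + j)) ≠ 1 ∧ (q : ℂ) ^ (2 * (ω₂ + j)) ≠ 1) →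
          ∀ s : ℕ, ∃ C : HRep (ω₁ + ω₂ + 2 * s) →ₗ[Mer] DynTensor (HRep ω₁) (HRep ω₂),
            IsIntertwiner (piRep hq hq1 (ω₁ + ω₂ + 2 * s))
              (DynRep.tensor hq hq1 (piRep hq hq1 ω₁) (piRep hq hq1 ω₂)) C ∧
            (∀ k : ℕ, C (HRep.e (ω₁ + ω₂ + 2 * s) k) =
              intCoeff q ω₁ ω₂ s k • eigVec q ω₁ ω₂ s (s + k)) ∧
            ∀ x : HRep (ω₁ + ω₂ + 2 * s),
              Φ (DirectSum.of (fun s : ℕ => HRep (ω₁ + ω₂ + 2 * s)) s x) = C x)) := by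
  refine ⟨fun p h y hy => ⟨eigVec_mem y p, eigVec_ne_zero y p, ?_⟩, fun hΩ => ?_⟩
  · rw [Xi_eigVec hq hq1 hy h, casEig,
      show 1 - ω₁ - ω₂ - 2 * (y : ℂ) = 1 - (ω₁ + ω₂) - 2 * y by ring]
  -- The intertwiners are chosen before any genericity of `ω₁`, `ω₂` is assumed. Their normalization
  -- is recorded conditionally, so that the same `Φ` serves the explicit statement.
  · have hex : ∀ s : ℕ, ∃ C : HRep (ω₁ + ω₂ + 2 * s) →ₗ[Mer] DynTensor (HRep ω₁) (HRep ω₂),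
        IsIntertwiner (piRep hq hq1 (ω₁ + ω₂ + 2 * s)) (tRep ω₁ ω₂ hq hq1) C ∧
        C (HRep.e _ 0) ≠ 0 ∧ ((∀ j : ℕ, (q : ℂ) ^ (2 * (ω₂ + j)) ≠ 1) →
          DynTensor.co ω₁ ω₂ s 0 (C (HRep.e _ 0)) = intCoeff q ω₁ ω₂ s 0) := by
      intro s
      obtain ⟨v, hv, hv0, hb, ha, hc⟩ := exists_lowest (ω₁ := ω₁) (ω₂ := ω₂) hq hq1 s
      obtain ⟨C, hC, hCv⟩ := DynRep.exists_intertwiner hq hq1 _ _ hv hb ha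
      exact ⟨C, hC, by rwa [hCv], by rwa [hCv]⟩
    choose C hC hC0 hCc using hex
    have hli : LinearIndependent Mer
        fun n : (_ : ℕ) × ℕ => C n.1 (HRep.e (ω₁ + ω₂ + 2 * n.1) n.2) := by
      refine (tRep ω₁ ω₂ hq hq1).linearIndependent hq hq1
        (θ := fun n => casEig q (ω₁ + ω₂) n.1)
        (w := fun n => ω₁ + ω₂ + 2 * (n.1 + n.2 : ℕ))
        (fun n => (hC n.1).Xi_e hq hq1 n.2) (fun n => (hC n.1).e_mem hq hq1 n.2)
        (fun n => (hC n.1).e_ne_zero hq hq1 hΩ (hC0 n.1) n.2) ?_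
      -- The eigenvalue of `Ξ` determines `s`, and the weight then determines `s + k`, hence `k`.
      rintro ⟨s, k⟩ ⟨t, l⟩ h1 h2
      obtain rfl : s = t := casEig_injective hq hq1 hΩ h1
      have h3 : ((s + k : ℕ) : ℂ) = (s + l : ℕ) := by
        simpa using h2
      obtain rfl : k = l := by
        have : s + k = s + l := by exact_mod_cast h3
        omega
      rfl
    have hsp := span_eq_top_of_weights hli fun s k => (hC s).e_mem hq hq1 k
    obtain ⟨Φ, hΦ⟩ := exists_equiv_of_basis (C := C) (Module.Basis.mk hli hsp) fun s k => by
      rw [Module.Basis.mk_apply]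
    refine ⟨Φ, ?_, fun h s => ⟨C s, hC s, fun k => ?_, fun x => ?_⟩⟩
    · rw [hΦ]
      exact IsIntertwiner.toModule hC
    · exact (hC s).eq_smul_eigVec hq hq1 h (hCc s fun j => (h j).2) k
    · have := congrArg (fun f : _ →ₗ[Mer] _ => f (DirectSum.of _ s x)) hΦ
      exact this.trans (DirectSum.toModule_lof (M := fun s : ℕ => HRep (ω₁ + ω₂ + 2 * s)) (φ := C)
        Mer s x)
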